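/- Setting. Let $\Omega\subset\mathbb R^2$ be a smooth bounded domain whose boundary is a simple closed curve of length $\ell$, let $\gamma(\theta)$ be its positively oriented ($\ell$-periodic) arclength parametrization, $\nu$ the outer unit normal and $k$ the curvature, $\nu'=k\gamma'$. Let $V$ be a smooth function, positive on $\overline\Omega$, and write $V(t,\theta)=V(\gamma(\theta)-t\nu(\theta))$, $\beta(\theta)=V(0,\theta)^{1/2}$, $\beta_1(\theta)=V_t(0,\theta)$. Assume $k-\frac{V_t(0,\theta)}{2V(0,\theta)}>0$ for all $\theta$. Let $N\ge 1$ be an integer, $H(x)=\tanh(x/\sqrt2)$ and $\gamma_0=\int_{\mathbb R}H_x^2\,dx$. Whenever $(f_1,\dots,f_N)$ is a list of layer positions, or of parts of them, put $f_0=-f_1$. Coefficients. For $\epsilon\in(0,\epsilon_0)$ let $f_j=\dot f_j+\bar f_j+\check f_j$ for $j=1,\dots,N$, where $$\dot f_j=\frac1{2\sqrt2\beta}\ln\frac1{N\epsilon}+\frac1{\sqrt2\beta}\ln\frac{(N-j)!}{(N-1)!\,\epsilon^{j-1}} .$$ Let $\chi_1,\dots,\chi_N$ be cut-off functions, $\chi_j(s)=\Theta_j\big(s-\tfrac{f_{j-1}+f_j}2\big)-\Theta_{j+1}\big(s-\tfrac{f_j+f_{j+1}}2\big)$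 for $j<N$ and $\chi_N(s)=\Theta_N\big(s-\tfrac{f_{N-1}+f_N}2\big)$, where the $\Theta_j:\mathbb R\to[0,1]$ are fixed smooth functions with $\Theta_j=0$ on $(-\infty,-\delta]$ and $\Theta_j=1$ on $[\delta,\infty)$ for some $\delta>0$, and $\Theta_1=1$ on $[0,\infty)$. Set $$\gamma_{1,j}=\int_{\mathbb R}\chi_j\big(\tfrac x\beta+f_j\big)H_x^2e^{-\sqrt2x}\,dx,\qquad \gamma_{2,j}=\int_{\mathbb R}\chi_j\big(\tfrac x\beta+f_j\big)H_x^2e^{\sqrt2x}\,dx,$$ $$\mathbf d_j=(N-j+1)e^{-\sqrt2\beta(\bar f_j-\bar f_{j-1})},\qquad \mathbf k_j=\mathbf d_je^{-\sqrt2\beta(\check f_j-\check f_{j-1})}\quad(1\le j\le N),\qquad \mathbf d_{N+1}=\mathbf k_{N+1}=0 .$$ The functions $\bar f_j=\bar f_j^\epsilon(\theta)$ are bounded uniformly in $\theta$ and $\epsilon$ and solve $$\tfrac{2\sqrt2}3k-\tfrac{\sqrt2}3\tfrac{\beta_1}{\beta^2}=6\sqrt2\,\beta^2\big[\gamma_{1,j}\mathbf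 d_j-\gamma_{2,j}\mathbf d_{j+1}\big],\qquad j=1,\dots,N .$$ The functions $\check f_j=\check f_j^\epsilon(\theta)$ are of class $C^2$ and $\ell$-periodic in $\theta$, and for some constant $K$ independent of $\epsilon$, $\epsilon'$ and $\theta$ they satisfy $|\check f^\epsilon_j|\le K\epsilon^{1/2}$, $|(\check f_j^\epsilon)'|+|(\check f_j^\epsilon)''|\le K$ and $|\check f_j^{\epsilon}-\check f_j^{\epsilon'}|\le K|\sqrt\epsilon-\sqrt{\epsilon'}|$ for all $\epsilon,\epsilon'\in(0,\epsilon_0)$. Let $\mathfrak c_n=12\beta^2\gamma_{1,n}\mathbf k_n$, $\mathfrak d_n=12\beta^2\gamma_{2,n}\mathbf k_{n+1}$, and let $\mathbf B=\mathbf B^\epsilon(\theta)$ be the tridiagonal $N\times N$ matrix given by $(\mathbf Bu)_n=\mathfrak c_n(u_n-u_{n-1})-\mathfrak d_n(u_{n+1}-u_n)$ with $u_0=-u_1$ (and $\mathfrak d_N=0$). Let $\rho_1^\epsilon(\theta)\ge\dots\ge\rho_N^\epsilon(\theta)$ be the eigenvalues of $\mathbf B^\epsilon(\theta)$. Claim.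 There are a sequence $\epsilon_l\in(0,\epsilon_0)$, $\epsilon_l\to0$, and a constant $C>0$ such that for every $l$ and every $h=(h_1,\dots,h_N)$ with $h_n\in L^2(0,\ell)$ the system $$-\epsilon_l\gamma_0v_n''-\rho_n^{\epsilon_l}(\theta)v_n=h_n\ \text{ in }(0,\ell),\qquad v_n(0)=v_n(\ell),\quad v_n'(0)=v_n'(\ell),\qquad n=1,\dots,N,$$ has a unique solution $v=(v_1,\dots,v_N)$ with $v_n\in H^2(0,\ell)$, and for all $n=1,\dots,N$ $$\epsilon_l\|v_n''\|_{L^2(0,\ell)}+\sqrt{\epsilon_l}\,\|v_n'\|_{L^2(0,\ell)}+\|v_n\|_{L^\infty(0,\ell)}\le C\sqrt{\tfrac1{\epsilon_l}}\;\|h_n\|_{L^2(0,\ell)} .$$ Moreover, if $h_n\in H^2(0,\ell)$ is periodic, that is $h_n(0)=h_n(\ell)$ and $h_n'(0)=h_n'(\ell)$, then $$\epsilon_l\|v_n''\|_{L^2(0,\ell)}+\|v_n'\|_{L^2(0,\ell)}+\|v_n\|_{L^\infty(0,\ell)}\le C\,\|h_n\|_{H^2(0,\ell)} .$$ -/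

import Mathlib

open MeasureTheory Filter Topology Set
open scoped ContDiff

namespace BoundaryLayers

noncomputable section

/-! ### The domain, its boundary curve and the potential near the boundary -/

abbrev Plane : Type := EuclideanSpace ℝ (Fin 2)

/-- The unit normal obtained by rotating the tangent clockwise; it is the outer normal when the
boundary is positively oriented. -/
def normal (γ : ℝ → Plane) (θ : ℝ) : Plane := !₂[deriv γ θ 1, -(deriv γ θ 0)]

/-- The curvature `k`, given by `ν' = k γ'` (positive for a positively oriented circle). -/
def curvature (γ : ℝ → Plane) (θ : ℝ) : ℝ := inner ℝ (deriv (normal γ) θ) (deriv γ θ)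

/-- `Ω` is a smooth bounded planar domain whose boundary is the simple closed curve `γ`, of length
`ℓ`, positively oriented and parametrized by arclength. -/
structure IsDomainWithBoundary (Ω : Set Plane) (ℓ : ℝ) (γ : ℝ → Plane) : Prop where
  isOpen : IsOpen Ω
  isConnected : IsConnected Ω
  isBounded : Bornology.IsBounded Ω
  length_pos : 0 < ℓ
  smooth : ContDiff ℝ ∞ γ
  periodic : Function.Periodic γ ℓ
  injOn : InjOn γ (Ico 0 ℓ)
  unit_speed : ∀ θ, ‖deriv γ θ‖ = 1
  range_eq : range γ = frontier Ω
  outer_normal : ∃ δ₀ > 0, ∀ θ t : ℝ, 0 < t → t < δ₀ →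
    γ θ - t • normal γ θ ∈ Ω ∧ γ θ + t • normal γ θ ∉ Ω

/-- `V` in the coordinates `y = γ(θ) - t ν(θ)`. -/
def fermi (γ : ℝ → Plane) (V : Plane → ℝ) (t θ : ℝ) : ℝ := V (γ θ - t • normal γ θ)

/-- `β(θ) = V(0,θ)^{1/2}`. -/
def beta (γ : ℝ → Plane) (V : Plane → ℝ) (θ : ℝ) : ℝ := √(fermi γ V 0 θ)

/-- `β₁(θ) = V_t(0,θ)`. -/
def betaOne (γ : ℝ → Plane) (V : Plane → ℝ) (θ : ℝ) : ℝ := deriv (fun t => fermi γ V t θ) 0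

/-- The generalized mean curvature `k - V_t / (2 V)` of the boundary. -/
def genMeanCurvature (γ : ℝ → Plane) (V : Plane → ℝ) (θ : ℝ) : ℝ :=
  curvature γ θ - betaOne γ V θ / (2 * fermi γ V 0 θ)

/-! ### The heteroclinic profile -/

/-- `H(x) = tanh (x / √2)`. -/
def heteroclinic (x : ℝ) : ℝ := Real.tanh (x / √2)

/-- `γ₀ = ∫ H_x²`. -/
def gammaZero : ℝ := ∫ x : ℝ, deriv heteroclinic x ^ 2

/-! ### Layer positions, cut-offs, coefficients (pointwise in `θ`; `b` stands for `β(θ)`)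

A family indexed by `ℕ` is used at the indices `1, …, N` of the layers. -/

/-- The convention `f₀ = -f₁`. -/
def reflect (f : ℕ → ℝ) : ℕ → ℝ
  | 0 => -f 1
  | j + 1 => f (j + 1)

/-- `f_j - f_{j-1}`, for `j ≥ 1`. -/
def gap (f : ℕ → ℝ) (j : ℕ) : ℝ := reflect f j - reflect f (j - 1)

/-- The logarithmically large part of the position of the `j`-th layer. -/
def fDot (N : ℕ) (b ε : ℝ) (j : ℕ) : ℝ :=
  1 / (2 * √2 * b) * Real.log (1 / (N * ε)) +
    1 / (√2 * b) * Real.log ((N - j).factorial / ((N - 1).factorial * ε ^ (j - 1)))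

/-- Transition functions between consecutive layers: `Θ j` switches on the `j`-th cut-off in
the `δ`-neighbourhood of the midpoint of layers `j - 1` and `j`. For `j = 1` this midpoint is the
boundary `s = 0` and the transition takes place in `-δ < s < 0`. -/
structure IsTransition (N : ℕ) (δ : ℝ) (Θ : ℕ → ℝ → ℝ) : Prop where
  width_pos : 0 < δ
  smooth : ∀ j, 1 ≤ j → j ≤ N → ContDiff ℝ ∞ (Θ j)
  mem_Icc : ∀ j, 1 ≤ j → j ≤ N → ∀ s, Θ j s ∈ Icc (0 : ℝ) 1
  eq_zero : ∀ j, 1 ≤ j → j ≤ N → ∀ s, s ≤ -δ → Θ j s = 0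
  eq_one : ∀ j, 1 ≤ j → j ≤ N → ∀ s, δ ≤ s → Θ j s = 1
  eq_one_boundary : ∀ s, 0 ≤ s → Θ 1 s = 1

/-- The cut-off `χ_j(s)`; the functions `χ₁, …, χ_N` add up to `1` on `s ≥ 0`. -/
def cutoff (N : ℕ) (Θ : ℕ → ℝ → ℝ) (f : ℕ → ℝ) (j : ℕ) (s : ℝ) : ℝ :=
  Θ j (s - (reflect f (j - 1) + f j) / 2) -
    if j < N then Θ (j + 1) (s - (f j + f (j + 1)) / 2) else 0

/-- `γ_{1,j} = ∫ χ_j H_x² e^{-√2 x}` with `x = β (s - f_j)`. -/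
def gammaOne (N : ℕ) (Θ : ℕ → ℝ → ℝ) (b : ℝ) (f : ℕ → ℝ) (j : ℕ) : ℝ :=
  ∫ x : ℝ, cutoff N Θ f j (x / b + f j) * deriv heteroclinic x ^ 2 * Real.exp (-√2 * x)

/-- `γ_{2,j} = ∫ χ_j H_x² e^{√2 x}` with `x = β (s - f_j)`. -/
def gammaTwo (N : ℕ) (Θ : ℕ → ℝ → ℝ) (b : ℝ) (f : ℕ → ℝ) (j : ℕ) : ℝ :=
  ∫ x : ℝ, cutoff N Θ f j (x / b + f j) * deriv heteroclinic x ^ 2 * Real.exp (√2 * x)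

/-- `d_j = (N - j + 1) e^{-√2 β (f̄_j - f̄_{j-1})}`, and `d_{N+1} = 0`. -/
def dCoef (N : ℕ) (b : ℝ) (fbar : ℕ → ℝ) (j : ℕ) : ℝ :=
  if j ≤ N then ((N : ℝ) - j + 1) * Real.exp (-√2 * b * gap fbar j) else 0

/-- `k_j = d_j e^{-√2 β (f̌_j - f̌_{j-1})}`, and `k_{N+1} = 0`. -/
def kCoef (N : ℕ) (b : ℝ) (fbar fcheck : ℕ → ℝ) (j : ℕ) : ℝ :=
  dCoef N b fbar j * Real.exp (-√2 * b * gap fcheck j)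

/-- The layer positions `f_j = ḟ_j + f̄_j + f̌_j`. -/
def position (N : ℕ) (b ε : ℝ) (fbar fcheck : ℕ → ℝ) (j : ℕ) : ℝ :=
  fDot N b ε j + fbar j + fcheck j

/-- `𝔠_j = 12 β² γ_{1,j} k_j`. -/
def cEntry (N : ℕ) (Θ : ℕ → ℝ → ℝ) (b ε : ℝ) (fbar fcheck : ℕ → ℝ) (j : ℕ) : ℝ :=
  12 * b ^ 2 * gammaOne N Θ b (position N b ε fbar fcheck) j * kCoef N b fbar fcheck j

/-- `𝔡_j = 12 β² γ_{2,j} k_{j+1}`. -/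
def dEntry (N : ℕ) (Θ : ℕ → ℝ → ℝ) (b ε : ℝ) (fbar fcheck : ℕ → ℝ) (j : ℕ) : ℝ :=
  12 * b ^ 2 * gammaTwo N Θ b (position N b ε fbar fcheck) j * kCoef N b fbar fcheck (j + 1)

/-- The tridiagonal matrix `B` of the linearized system:
`(B u)_n = 𝔠_n (u_n - u_{n-1}) - 𝔡_n (u_{n+1} - u_n)` with `u₀ = -u₁` and `𝔡_N = 0`.
The index `i : Fin N` stands for `n = i + 1`. -/
def layerMatrix (N : ℕ) (Θ : ℕ → ℝ → ℝ) (b ε : ℝ) (fbar fcheck : ℕ → ℝ) :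
    Matrix (Fin N) (Fin N) ℝ :=
  Matrix.of fun i j =>
    if i = j then
      (if (i : ℕ) = 0 then 2 else 1) * cEntry N Θ b ε fbar fcheck (i + 1) +
        dEntry N Θ b ε fbar fcheck (i + 1)
    else if (i : ℕ) = j + 1 then -cEntry N Θ b ε fbar fcheck (i + 1)
    else if (j : ℕ) = i + 1 then -dEntry N Θ b ε fbar fcheck (i + 1)
    else 0

/-- The real eigenvalues of a matrix, with multiplicity, in decreasing order. -/
def sortedEigenvalue {N : ℕ} (M : Matrix (Fin N) (Fin N) ℝ) (n : Fin N) : ℝ :=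
  (M.charpoly.roots.sort (· ≥ ·)).getD n 0

/-- `ρ_n^ε(θ)`: the `n`-th eigenvalue of the matrix `B` at `θ`. -/
def rho (N : ℕ) (γ : ℝ → Plane) (V : Plane → ℝ) (Θ : ℕ → ℝ → ℝ)
    (fbar fcheck : ℕ → ℝ → ℝ → ℝ) (ε : ℝ) (n : Fin N) (θ : ℝ) : ℝ :=
  sortedEigenvalue
    (layerMatrix N Θ (beta γ V θ) ε (fun j => fbar j ε θ) (fun j => fcheck j ε θ)) n

/-! ### The corrections of the layer positions -/

/-- The corrections `f̌_j^ε(θ)` are `O(ε^{1/2})`, with first and second `θ`-derivatives bounded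
uniformly in `ε`, and depend on `ε` in a Lipschitz way with respect to `√ε`. -/
structure IsSmallCorrection (N : ℕ) (ℓ ε₀ K : ℝ) (fcheck : ℕ → ℝ → ℝ → ℝ) : Prop where
  contDiff : ∀ j ε, 1 ≤ j → j ≤ N → 0 < ε → ε < ε₀ → ContDiff ℝ 2 (fcheck j ε)
  periodic : ∀ j ε, 1 ≤ j → j ≤ N → 0 < ε → ε < ε₀ → Function.Periodic (fcheck j ε) ℓ
  bound : ∀ j ε θ, 1 ≤ j → j ≤ N → 0 < ε → ε < ε₀ → |fcheck j ε θ| ≤ K * √ε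
  bound_deriv : ∀ j ε θ, 1 ≤ j → j ≤ N → 0 < ε → ε < ε₀ → |deriv (fcheck j ε) θ| ≤ K
  bound_deriv_two : ∀ j ε θ, 1 ≤ j → j ≤ N → 0 < ε → ε < ε₀ →
    |deriv (deriv (fcheck j ε)) θ| ≤ K
  lipschitz : ∀ j ε ε' θ, 1 ≤ j → j ≤ N → 0 < ε → ε < ε₀ → 0 < ε' → ε' < ε₀ →
    |fcheck j ε θ - fcheck j ε' θ| ≤ K * |√ε - √ε'|

/-- The functions `f̄_j^ε(θ)` are of order one and solve the algebraic balance system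
`(2√2/3) k - (√2/3) β₁/β² = 6√2 β² [(N-j+1) γ_{1,j} e^{-√2β(f̄_j - f̄_{j-1})}
  - (N-j) γ_{2,j} e^{-√2β(f̄_{j+1} - f̄_j)}]`, `j = 1, …, N`, with `f̄₀ = -f̄₁`. -/
structure IsBalanced (N : ℕ) (γ : ℝ → Plane) (V : Plane → ℝ) (Θ : ℕ → ℝ → ℝ) (ε₀ K : ℝ)
    (fbar fcheck : ℕ → ℝ → ℝ → ℝ) : Prop where
  bound : ∀ j ε θ, 1 ≤ j → j ≤ N → 0 < ε → ε < ε₀ → |fbar j ε θ| ≤ K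
  balance : ∀ j ε θ, 1 ≤ j → j ≤ N → 0 < ε → ε < ε₀ →
    2 * √2 / 3 * curvature γ θ - √2 / 3 * (betaOne γ V θ / beta γ V θ ^ 2) =
      6 * √2 * beta γ V θ ^ 2 *
        (gammaOne N Θ (beta γ V θ)
            (position N (beta γ V θ) ε (fun i => fbar i ε θ) (fun i => fcheck i ε θ)) j *
            dCoef N (beta γ V θ) (fun i => fbar i ε θ) j -
          gammaTwo N Θ (beta γ V θ)
            (position N (beta γ V θ) ε (fun i => fbar i ε θ) (fun i => fcheck i ε θ)) j *
            dCoef N (beta γ V θ) (fun i => fbar i ε θ) (j + 1))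

/-! ### Function spaces on `(0, ℓ)` and the periodic problem -/

/-- Lebesgue measure on `(0, ℓ)`. -/
def intervalMeasure (ℓ : ℝ) : Measure ℝ := volume.restrict (Ioo 0 ℓ)

def normL2 (ℓ : ℝ) (g : ℝ → ℝ) : ℝ := (eLpNorm g 2 (intervalMeasure ℓ)).toReal

def normLinf (ℓ : ℝ) (g : ℝ → ℝ) : ℝ := (eLpNorm g ⊤ (intervalMeasure ℓ)).toReal

/-- `v` belongs to `H²(0, ℓ)`, with first and second weak derivatives `v₁` and `v₂`: the function
`v₂` is square integrable, and `v₁` and `v` (the continuous representatives on `[0, ℓ]`) are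
primitives of `v₂` and `v₁`. -/
structure IsH2 (ℓ : ℝ) (v v₁ v₂ : ℝ → ℝ) : Prop where
  memLp : MemLp v₂ 2 (intervalMeasure ℓ)
  first : ∀ x ∈ Icc 0 ℓ, v₁ x = v₁ 0 + ∫ t in (0 : ℝ)..x, v₂ t
  zeroth : ∀ x ∈ Icc 0 ℓ, v x = v 0 + ∫ t in (0 : ℝ)..x, v₁ t

/-- `IsH2`, with equal values and equal first derivatives at the two end points. -/
structure IsPeriodicH2 (ℓ : ℝ) (v v₁ v₂ : ℝ → ℝ) : Prop where
  isH2 : IsH2 ℓ v v₁ v₂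
  periodic : v 0 = v ℓ
  periodic_deriv : v₁ 0 = v₁ ℓ

def normH2 (ℓ : ℝ) (g g₁ g₂ : ℝ → ℝ) : ℝ :=
  √(normL2 ℓ g ^ 2 + normL2 ℓ g₁ ^ 2 + normL2 ℓ g₂ ^ 2)

/-- `v` is a strong solution of `-ε γ₀ v'' - ρ v = h` on `(0, ℓ)`, `v(0) = v(ℓ)`,
`v'(0) = v'(ℓ)`, with derivatives `v₁`, `v₂`. -/
structure IsPeriodicSolution (ℓ ε : ℝ) (ρ h v v₁ v₂ : ℝ → ℝ) : Prop where
  isPeriodicH2 : IsPeriodicH2 ℓ v v₁ v₂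
  equation : ∀ᵐ θ ∂(intervalMeasure ℓ), -ε * gammaZero * v₂ θ - ρ θ * v θ = h θ

end

end BoundaryLayers

open BoundaryLayers

/-! Write s = √ε and η = s√γ₀. Each of the N decoupled equations is -η²v'' - ρv = h with ρ > 0, so
homogeneous solutions oscillate with frequency of order 1/η. What has to be shown is that along a
sequence ε → 0 the total phase around the curve stays away from 2πℤ for all N equations at once, and
that this controls the solution.

Scalar problem. Suppose ρ = q⁴ + r with q of class C² and r of size O(η) with Lipschitz constant
O(η). Put z = qv + iηv'/q and y = e^{iφ}z with φ' = (q² + r/(2q²))/η. Then y' = bȳ + g, where b is a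
bounded Lipschitz amplitude times e^{2iφ} and g = -ie^{iφ}h/(ηq). One integration by parts shows
that K = ∫b is O(η), hence y - Kȳ - ∫g is almost constant. Periodicity gives y(ℓ) = e^{iφ(ℓ)}y(0),
and a lower bound on |e^{iφ(ℓ)} - 1| then bounds y (`norm_le_of_oscillating_system`,
`exists_wkb_estimate`). The factor 1/η in g is the loss ε^{-1/2}. For periodic h in H² it
disappears: v + h/q⁴ solves the same equation with a right-hand side whose oscillatory integrals are
O(η²) (`exists_wkb_estimate_smooth`). The a priori bound gives uniqueness, and uniqueness gives
existence because the periodic problem is a 2×2 linear system for the initial data.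

Eigenvalues. The balance system says that 12β²(γ_{1,j}d_j - γ_{2,j}d_{j+1}) is the same positive
function a = (4/3)(k - V_t/(2V)) for every j. All γ's equal one constant up to O(s), so summing
inwards from the last layer gives 12β²γ_{1,j}d_j = a(N - j + 1 + O(s)). Hence B = a(T + O(s)) with a
constant symmetric tridiagonal matrix T whose spectrum is simple and positive
(`exists_limitMatrix_eigenvalues`), and ρ_n is a times a C² function of B/a.

Regularity. The f̄_j are only assumed bounded, so their regularity has to come out of the balance
system. The γ's see the gaps only through tails of the cut-offs, whose size and Lipschitz constants
are O(s). The gaps are therefore Lipschitz in (s, θ) up to s times their own variation, which is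
absorbed (`exists_gapDist_le`). The f̌_j are O(s) with angular derivatives merely bounded; they
cannot go into r, but being C² they can go into q. So q⁴ is a times the linearization of the
eigenvalue at T along the matrices containing the f̌_j but the limit fluxes, and r is what is left
(`exists_eigenvalue_decomposition`).

Non-resonance. The phases are J_n(s)/s with J_n bounded, bounded below and Lipschitz in s. Among N +
1 suitably spaced values of 1/s one is good for all n: otherwise two of them would be bad for the
same n, although the corresponding phases differ by an amount bounded below and at most π
(`exists_nonresonant`). -/

namespace BoundaryLayers

/-! ### Primitives of integrable functions -/

/-- `f` is, on `[0, ℓ]`, a primitive of the integrable function `f'`. -/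
structure IsPrim {𝕜 : Type*} [RCLike 𝕜] (ℓ : ℝ) (f f' : ℝ → 𝕜) : Prop where
  integrable : IntervalIntegrable f' volume 0 ℓ
  eq : ∀ x ∈ Icc 0 ℓ, f x = f 0 + ∫ t in (0 : ℝ)..x, f' t

namespace IsPrim

variable {𝕜 : Type*} [RCLike 𝕜] {ℓ : ℝ} {f f' g g' : ℝ → 𝕜}

theorem integrable_of_mem (hf : IsPrim ℓ f f') {x : ℝ} (hx : x ∈ Icc 0 ℓ) :
    IntervalIntegrable f' volume 0 x :=
  hf.integrable.mono_set (by
    rw [uIcc_of_le hx.1, uIcc_of_le (hx.1.trans hx.2)]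
    exact Icc_subset_Icc_right hx.2)

theorem continuousOn (hf : IsPrim ℓ f f') (hℓ : 0 ≤ ℓ) : ContinuousOn f (Icc 0 ℓ) := by
  have h := intervalIntegral.continuousOn_primitive_interval
    ((intervalIntegrable_iff' (μ := volume)).1 hf.integrable)
  rw [uIcc_of_le hℓ] at h
  exact (continuousOn_const.add h).congr hf.eq

theorem congr (hf : IsPrim ℓ f f') (hℓ : 0 ≤ ℓ) (hfg : EqOn g f (Icc 0 ℓ))
    (hfg' : ∀ᵐ t, t ∈ Ioc 0 ℓ → g' t = f' t) : IsPrim ℓ g g' where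
  integrable := by
    refine hf.integrable.congr_ae ?_
    rw [uIoc_of_le hℓ, Filter.EventuallyEq, ae_restrict_iff' measurableSet_Ioc]
    filter_upwards [hfg'] with t ht h1 using (ht h1).symm
  eq x hx := by
    rw [hfg hx, hfg ⟨le_rfl, hℓ⟩, hf.eq x hx]
    congr 1
    refine intervalIntegral.integral_congr_ae ?_
    filter_upwards [hfg'] with t ht h1
    rw [uIoc_of_le hx.1] at h1
    exact (ht ⟨h1.1, h1.2.trans hx.2⟩).symm

theorem of_integral (hg : IntervalIntegrable g volume 0 ℓ) :
    IsPrim ℓ (fun x => ∫ t in (0 : ℝ)..x, g t) g :=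
  ⟨hg, fun x _ => by simp⟩

theorem of_hasDerivAt (hℓ : 0 ≤ ℓ) (h : ∀ x ∈ Icc 0 ℓ, HasDerivAt f (f' x) x)
    (hc : ContinuousOn f' (Icc 0 ℓ)) : IsPrim ℓ f f' where
  integrable := (hc.mono (by rw [uIcc_of_le hℓ])).intervalIntegrable
  eq x hx := by
    have hs : uIcc 0 x ⊆ Icc 0 ℓ := by rw [uIcc_of_le hx.1]; exact Icc_subset_Icc_right hx.2
    rw [intervalIntegral.integral_eq_sub_of_hasDerivAt (fun y hy => h y (hs hy))
      ((hc.mono hs).intervalIntegrable)]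
    ring

/-- The integral is split into real and imaginary parts, for which the real-valued theorem applies,
and reassembled with the constants 1 and I. -/
theorem absolutelyContinuous (hg : IntervalIntegrable g volume 0 ℓ) :
    AbsolutelyContinuousOnInterval (fun x => ∫ t in (0 : ℝ)..x, g t) 0 ℓ := by
  have h1 : IntervalIntegrable (fun x => RCLike.re (g x)) volume 0 ℓ :=
    ⟨hg.1.re, hg.2.re⟩
  have h2 : IntervalIntegrable (fun x => RCLike.im (g x)) volume 0 ℓ :=
    ⟨hg.1.im, hg.2.im⟩
  have a1 := h1.absolutelyContinuousOnInterval_intervalIntegral (c := 0) (by simp)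
  have a2 := h2.absolutelyContinuousOnInterval_intervalIntegral (c := 0) (by simp)
  have c1 : AbsolutelyContinuousOnInterval (fun _ : ℝ => (1 : 𝕜)) 0 ℓ :=
    (LipschitzWith.const (1 : 𝕜)).lipschitzOnWith.absolutelyContinuousOnInterval
  have c2 : AbsolutelyContinuousOnInterval (fun _ : ℝ => (RCLike.I : 𝕜)) 0 ℓ :=
    (LipschitzWith.const (RCLike.I : 𝕜)).lipschitzOnWith.absolutelyContinuousOnInterval
  have h := (a1.smul c1).add (a2.smul c2)
  have e : ∀ x ∈ uIcc 0 ℓ, ∫ t in (0 : ℝ)..x, g t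
      = (∫ t in (0 : ℝ)..x, RCLike.re (g t)) • (1 : 𝕜)
        + (∫ t in (0 : ℝ)..x, RCLike.im (g t)) • (RCLike.I : 𝕜) := by
    intro x hx
    have hgx : IntervalIntegrable g volume 0 x :=
      hg.mono_set (uIcc_subset_uIcc left_mem_uIcc hx)
    rw [← intervalIntegral.integral_smul_const, ← intervalIntegral.integral_smul_const,
      ← intervalIntegral.integral_add]
    · congr 1
      ext t
      simp only [RCLike.real_smul_eq_coe_mul, mul_one]
      exact (RCLike.re_add_im (g t)).symm
    · have := h1.mono_set (uIcc_subset_uIcc left_mem_uIcc hx)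
      exact ⟨this.1.smul_const _, this.2.smul_const _⟩
    · have := h2.mono_set (uIcc_subset_uIcc left_mem_uIcc hx)
      exact ⟨this.1.smul_const _, this.2.smul_const _⟩
  rw [absolutelyContinuousOnInterval_iff] at h ⊢
  intro ε hε
  obtain ⟨d, hd, H⟩ := h ε hε
  refine ⟨d, hd, fun E hE hlt => ?_⟩
  refine lt_of_eq_of_lt (Finset.sum_congr rfl fun i hi => ?_) (H E hE hlt)
  have := hE.1 i hi
  rw [e _ this.1, e _ this.2]
  rfl

theorem sub_const_eq (hf : IsPrim ℓ f f') {x : ℝ} (hx : x ∈ Icc 0 ℓ) :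
    ∫ t in (0 : ℝ)..x, f' t = f x - f 0 := by
  rw [hf.eq x hx]; ring

theorem add (hf : IsPrim ℓ f f') (hg : IsPrim ℓ g g') :
    IsPrim ℓ (fun x => f x + g x) (fun x => f' x + g' x) where
  integrable := hf.integrable.add hg.integrable
  eq x hx := by
    rw [intervalIntegral.integral_add (hf.integrable_of_mem hx) (hg.integrable_of_mem hx),
      hf.eq x hx, hg.eq x hx]
    ring

theorem const_mul (hf : IsPrim ℓ f f') (c : 𝕜) :
    IsPrim ℓ (fun x => c * f x) (fun x => c * f' x) where
  integrable := hf.integrable.const_mul c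
  eq x hx := by
    rw [intervalIntegral.integral_const_mul, hf.eq x hx]
    ring

theorem sub (hf : IsPrim ℓ f f') (hg : IsPrim ℓ g g') :
    IsPrim ℓ (fun x => f x - g x) (fun x => f' x - g' x) := by
  simpa [sub_eq_add_neg] using hf.add (hg.const_mul (-1))

theorem conj {f f' : ℝ → ℂ} (hf : IsPrim ℓ f f') :
    IsPrim ℓ (fun x => (starRingEnd ℂ) (f x)) (fun x => (starRingEnd ℂ) (f' x)) where
  integrable := ⟨Complex.conjCLE.toContinuousLinearMap.integrable_comp hf.integrable.1,
    Complex.conjCLE.toContinuousLinearMap.integrable_comp hf.integrable.2⟩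
  eq x hx := by
    rw [hf.eq x hx, map_add]
    congr 1
    exact (Complex.conjCLE.toContinuousLinearMap.intervalIntegral_comp_comm
      (hf.integrable_of_mem hx)).symm

theorem ofReal {f f' : ℝ → ℝ} (hf : IsPrim ℓ f f') :
    IsPrim ℓ (fun x => (f x : ℂ)) (fun x => (f' x : ℂ)) where
  integrable := ⟨hf.integrable.1.ofReal, hf.integrable.2.ofReal⟩
  eq x hx := by
    rw [intervalIntegral.integral_ofReal, hf.eq x hx]
    push_cast
    ring

/-- The product rule. -/
theorem mul (hf : IsPrim ℓ f f') (hg : IsPrim ℓ g g') (hℓ : 0 ≤ ℓ) :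
    IsPrim ℓ (fun x => f x * g x) (fun x => f' x * g x + f x * g' x) := by
  have hcf := hf.continuousOn hℓ
  have hcg := hg.continuousOn hℓ
  rw [← uIcc_of_le hℓ] at hcf hcg
  have hi : IntervalIntegrable (fun x => f' x * g x + f x * g' x) volume 0 ℓ :=
    (hf.integrable.mul_continuousOn hcg).add (hg.integrable.continuousOn_mul hcf)
  refine ⟨hi, ?_⟩
  -- `f` and `g` are known only on [0, ℓ]; the formulas `F` and `G` extend them to the line, which
  -- gives genuine derivatives almost everywhere.
  set F : ℝ → 𝕜 := fun x => f 0 + ∫ t in (0 : ℝ)..x, f' t with hF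
  set G : ℝ → 𝕜 := fun x => g 0 + ∫ t in (0 : ℝ)..x, g' t with hG
  have cc : ∀ c : 𝕜, AbsolutelyContinuousOnInterval (fun _ : ℝ => c) 0 ℓ := fun c =>
    (LipschitzWith.const c).lipschitzOnWith.absolutelyContinuousOnInterval
  have aF : AbsolutelyContinuousOnInterval F 0 ℓ :=
    (cc _).add (absolutelyContinuous hf.integrable)
  have aG : AbsolutelyContinuousOnInterval G 0 ℓ :=
    (cc _).add (absolutelyContinuous hg.integrable)
  -- The difference between the product and the candidate primitive is absolutely continuous with
  -- derivative zero almost everywhere, hence constant.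
  have aP := (aF.smul aG).sub (absolutelyContinuous hi)
  obtain ⟨C, hC⟩ := aP.const_of_ae_hasDerivAt_zero (by
    filter_upwards [hf.integrable.ae_hasDerivAt_integral, hg.integrable.ae_hasDerivAt_integral,
      hi.ae_hasDerivAt_integral] with x h1 h2 h3 hx
    have k1 : HasDerivAt F (f' x) x := by
      simpa [hF] using (h1 hx 0 left_mem_uIcc).const_add (f 0)
    have k2 : HasDerivAt G (g' x) x := by
      simpa [hG] using (h2 hx 0 left_mem_uIcc).const_add (g 0)
    have k3 := h3 hx 0 left_mem_uIcc
    have k := (k1.mul k2).sub k3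
    have hx' : x ∈ Icc 0 ℓ := by rwa [uIcc_of_le hℓ] at hx
    have e1 : F x = f x := (hf.eq x hx').symm
    have e2 : G x = g x := (hg.eq x hx').symm
    rw [e1, e2] at k
    rwa [sub_self] at k)
  intro x hx
  have hC0 := hC 0 left_mem_uIcc
  have hCx := hC x (by rwa [uIcc_of_le hℓ])
  simp only [Pi.sub_apply, smul_eq_mul, Pi.mul_apply, intervalIntegral.integral_same,
    sub_zero] at hC0 hCx
  have e1 : F x = f x := (hf.eq x hx).symm
  have e2 : G x = g x := (hg.eq x hx).symm
  have e3 : F 0 = f 0 := by simp [hF]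
  have e4 : G 0 = g 0 := by simp [hG]
  rw [e3, e4] at hC0
  rw [e1, e2] at hCx
  rw [hC0, ← hCx]
  ring

theorem norm_sub_le (hf : IsPrim ℓ f f') {x : ℝ} (hx : x ∈ Icc 0 ℓ) :
    ‖f x - f 0‖ ≤ ∫ t in (0 : ℝ)..ℓ, ‖f' t‖ := by
  rw [← hf.sub_const_eq hx]
  refine (intervalIntegral.norm_integral_le_integral_norm hx.1).trans ?_
  exact intervalIntegral.integral_mono_interval le_rfl hx.1 hx.2
    (Eventually.of_forall fun _ => norm_nonneg _) hf.integrable.norm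

/-- A Lipschitz function is the primitive of a bounded function. -/
theorem of_lipschitz {f : ℝ → ℝ} {A : ℝ} (hℓ : 0 ≤ ℓ) (hA : 0 ≤ A)
    (hf : ∀ x ∈ Icc 0 ℓ, ∀ y ∈ Icc 0 ℓ, |f x - f y| ≤ A * |x - y|) :
    ∃ f' : ℝ → ℝ, IsPrim ℓ f f' ∧ ∀ᵐ t, t ∈ Ioc 0 ℓ → |f' t| ≤ A := by
  have hl : LipschitzOnWith A.toNNReal f (Icc 0 ℓ) := by
    refine LipschitzOnWith.of_dist_le_mul fun x hx y hy => ?_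
    rw [Real.coe_toNNReal _ hA]
    exact hf x hx y hy
  have hac : AbsolutelyContinuousOnInterval f 0 ℓ :=
    LipschitzOnWith.absolutelyContinuousOnInterval (K := A.toNNReal) (by rwa [uIcc_of_le hℓ])
  refine ⟨deriv f, ⟨hac.intervalIntegrable_deriv, fun x hx => ?_⟩, ?_⟩
  · rw [(hac.mono (c := 0) (d := x) ?_).integral_deriv_eq_sub]
    · ring
    · rw [uIcc_of_le hx.1, uIcc_of_le hℓ]
      exact Icc_subset_Icc_right hx.2
  -- The derivative bound needs a neighbourhood of t inside [0, ℓ]; the end point ℓ is discarded as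
  -- a null set.
  · have : ∀ᵐ t : ℝ, t ≠ ℓ := by simp [ae_iff, measure_singleton]
    filter_upwards [this] with t ht hm
    have := norm_deriv_le_of_lipschitzOn
      (Icc_mem_nhds hm.1 (lt_of_le_of_ne hm.2 ht)) hl
    rwa [Real.coe_toNNReal _ hA] at this

end IsPrim

end BoundaryLayers

namespace BoundaryLayers

/-! ### Bounded Lipschitz functions -/

/-- `f` is bounded by `A` and Lipschitz with constant `A`. -/
structure IsBddLip (A : ℝ) (f : ℝ → ℝ) : Prop where
  bound : ∀ x, |f x| ≤ A
  lip : ∀ x y, |f x - f y| ≤ A * |x - y|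

namespace IsBddLip

variable {A B : ℝ} {f g : ℝ → ℝ}

theorem nonneg (hf : IsBddLip A f) : 0 ≤ A := (abs_nonneg _).trans (hf.bound 0)

theorem mono (hf : IsBddLip A f) (h : A ≤ B) : IsBddLip B f :=
  ⟨fun x => (hf.bound x).trans h, fun x y => (hf.lip x y).trans (by gcongr)⟩

theorem continuous (hf : IsBddLip A f) : Continuous f :=
  (LipschitzWith.of_dist_le_mul (K := A.toNNReal) fun x y => by
    rw [Real.coe_toNNReal _ hf.nonneg]; exact hf.lip x y).continuous

theorem add (hf : IsBddLip A f) (hg : IsBddLip B g) : IsBddLip (A + B) (fun x => f x + g x) where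
  bound x := (abs_add_le _ _).trans (add_le_add (hf.bound x) (hg.bound x))
  lip x y := by
    rw [add_sub_add_comm, add_mul]
    exact (abs_add_le _ _).trans (add_le_add (hf.lip x y) (hg.lip x y))

theorem mul (hf : IsBddLip A f) (hg : IsBddLip B g) :
    IsBddLip (2 * (A * B)) (fun x => f x * g x) where
  bound x := by
    have := mul_le_mul (hf.bound x) (hg.bound x) (abs_nonneg _) hf.nonneg
    have h2 := mul_nonneg hf.nonneg hg.nonneg
    rw [abs_mul]
    linarith
  lip x y := by
    have h1 := mul_le_mul (hf.lip x y) (hg.bound x) (abs_nonneg _)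
      (mul_nonneg hf.nonneg (abs_nonneg _))
    have h2 := mul_le_mul (hf.bound y) (hg.lip x y) (abs_nonneg _) hf.nonneg
    rw [← abs_mul] at h1 h2
    have : f x * g x - f y * g y = (f x - f y) * g x + f y * (g x - g y) := by ring
    rw [this]
    refine (abs_add_le _ _).trans ((add_le_add h1 h2).trans (le_of_eq ?_))
    ring

theorem const_mul (hf : IsBddLip A f) (c : ℝ) : IsBddLip (|c| * A) (fun x => c * f x) where
  bound x := by rw [abs_mul]; exact mul_le_mul_of_nonneg_left (hf.bound x) (abs_nonneg c)
  lip x y := by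
    rw [← mul_sub, abs_mul, mul_assoc]
    exact mul_le_mul_of_nonneg_left (hf.lip x y) (abs_nonneg c)

theorem inv {m : ℝ} (hf : IsBddLip A f) (hm : 0 < m) (hmf : ∀ x, m ≤ f x) :
    IsBddLip (m⁻¹ + A * (m⁻¹ * m⁻¹)) (fun x => (f x)⁻¹) := by
  have hA := hf.nonneg
  have hp : ∀ x, 0 < f x := fun x => hm.trans_le (hmf x)
  have hi : ∀ x, (f x)⁻¹ ≤ m⁻¹ := fun x => inv_anti₀ hm (hmf x)
  refine ⟨fun x => ?_, fun x y => ?_⟩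
  · rw [abs_of_pos (inv_pos.2 (hp x))]
    have : 0 ≤ A * (m⁻¹ * m⁻¹) := by positivity
    linarith [hi x]
  · have e : (f x)⁻¹ - (f y)⁻¹ = (f y - f x) * ((f x)⁻¹ * (f y)⁻¹) := by
      have := (hp x).ne'
      have := (hp y).ne'
      field_simp
    have h1 : (f x)⁻¹ * (f y)⁻¹ ≤ m⁻¹ * m⁻¹ :=
      mul_le_mul (hi x) (hi y) (inv_pos.2 (hp y)).le (inv_pos.2 hm).le
    have h0 : 0 ≤ (f x)⁻¹ * (f y)⁻¹ := (mul_pos (inv_pos.2 (hp x)) (inv_pos.2 (hp y))).le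
    rw [e, abs_mul, abs_of_nonneg h0, abs_sub_comm]
    calc |f x - f y| * ((f x)⁻¹ * (f y)⁻¹) ≤ (A * |x - y|) * (m⁻¹ * m⁻¹) :=
          mul_le_mul (hf.lip x y) h1 h0 (mul_nonneg hA (abs_nonneg _))
      _ ≤ (m⁻¹ + A * (m⁻¹ * m⁻¹)) * |x - y| := by
          have : 0 ≤ m⁻¹ * |x - y| := mul_nonneg (inv_pos.2 hm).le (abs_nonneg _)
          linarith

theorem of_hasDerivAt {f' : ℝ → ℝ} (hb : ∀ x, |f x| ≤ A) (hd : ∀ x, HasDerivAt f (f' x) x)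
    (hb' : ∀ x, |f' x| ≤ A) : IsBddLip A f :=
  ⟨hb, fun x y => by
    have := Convex.norm_image_sub_le_of_norm_hasDerivWithin_le (s := univ)
      (fun x _ => (hd x).hasDerivWithinAt) (fun x _ => hb' x) convex_univ (mem_univ y) (mem_univ x)
    simpa using this⟩

end IsBddLip

/-! ### Oscillatory integrals -/

/-- First-order decay of an oscillatory integral whose amplitude has an integrable derivative. -/
theorem norm_oscillatory_integral_le {ℓ B₁ B₂ : ℝ} (hℓ : 0 ≤ ℓ) {F F' : ℝ → ℂ}
    (hF : IsPrim ℓ F F') (hB₁ : ∀ x ∈ Icc 0 ℓ, ‖F x‖ ≤ B₁) (hB₂ : ∫ t in (0 : ℝ)..ℓ, ‖F' t‖ ≤ B₂)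
    {ψ μ : ℝ → ℝ} (hψ : ∀ x, HasDerivAt ψ (μ x) x) (hμ : Continuous μ) {x : ℝ}
    (hx : x ∈ Icc 0 ℓ) :
    ‖∫ t in (0 : ℝ)..x, F t * μ t * Complex.exp (Complex.I * ψ t)‖ ≤ 2 * B₁ + B₂ := by
  have hcψ : Continuous ψ := continuous_iff_continuousAt.2 fun x => (hψ x).continuousAt
  set u : ℝ → ℂ := fun t => Complex.exp (Complex.I * ψ t) with hu
  have hcu : Continuous u := by fun_prop
  have hu1 : ∀ t, ‖u t‖ = 1 := fun t => by
    rw [hu]; simp only [mul_comm Complex.I]; exact Complex.norm_exp_ofReal_mul_I _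
  have hd : ∀ t, HasDerivAt u (u t * (Complex.I * μ t)) t := fun t =>
    (((hψ t).ofReal_comp).const_mul Complex.I).cexp
  have hP : IsPrim ℓ u (fun t => u t * (Complex.I * μ t)) :=
    IsPrim.of_hasDerivAt hℓ (fun t _ => hd t) (by fun_prop)
  have hFu := hF.mul hP hℓ
  have hcF := hF.continuousOn hℓ
  have hs : uIcc 0 x ⊆ Icc 0 ℓ := by rw [uIcc_of_le hx.1]; exact Icc_subset_Icc_right hx.2
  have h1 : IntervalIntegrable (fun t => F' t * u t) volume 0 x :=
    (hF.integrable_of_mem hx).mul_continuousOn hcu.continuousOn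
  have h2 : IntervalIntegrable (fun t => F t * (u t * (Complex.I * μ t))) volume 0 x :=
    ContinuousOn.intervalIntegrable ((hcF.mono hs).mul (by fun_prop))
  have key := hFu.sub_const_eq hx
  rw [intervalIntegral.integral_add h1 h2] at key
  -- Since u' = iμu, the factor μ in the integrand is exactly what makes it F u' up to -i. No lower
  -- bound on μ is needed here; dividing by the frequency is left to the amplitude `F`.
  have e : ∫ t in (0 : ℝ)..x, F t * μ t * u t
      = -Complex.I * ∫ t in (0 : ℝ)..x, F t * (u t * (Complex.I * μ t)) := by
    rw [← intervalIntegral.integral_const_mul]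
    congr 1
    ext t
    linear_combination (F t * u t * μ t) * Complex.I_mul_I
  rw [e, eq_sub_of_add_eq' key, norm_mul, norm_neg, Complex.norm_I, one_mul]
  have b1 : ‖F x * u x‖ ≤ B₁ := by rw [norm_mul, hu1, mul_one]; exact hB₁ x hx
  have b2 : ‖F 0 * u 0‖ ≤ B₁ := by
    rw [norm_mul, hu1, mul_one]; exact hB₁ 0 ⟨le_rfl, hℓ⟩
  have b3 : ‖∫ t in (0 : ℝ)..x, F' t * u t‖ ≤ B₂ := by
    refine (intervalIntegral.norm_integral_le_integral_norm hx.1).trans (le_trans ?_ hB₂)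
    simp only [norm_mul, hu1, mul_one]
    exact intervalIntegral.integral_mono_interval le_rfl hx.1 hx.2
      (Eventually.of_forall fun _ => norm_nonneg _) hF.integrable.norm
  calc _ ≤ ‖F x * u x‖ + ‖F 0 * u 0‖ + ‖∫ t in (0 : ℝ)..x, F' t * u t‖ :=
        (norm_sub_le _ _).trans (add_le_add (norm_sub_le _ _) le_rfl)
    _ ≤ 2 * B₁ + B₂ := by linarith

theorem IsBddLip.exists_isPrim {A ℓ : ℝ} {f : ℝ → ℝ} (hf : IsBddLip A f) (hℓ : 0 ≤ ℓ) :
    ∃ f' : ℝ → ℝ, IsPrim ℓ f f' ∧ ∀ᵐ t, t ∈ Ioc 0 ℓ → |f' t| ≤ A :=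
  IsPrim.of_lipschitz hℓ hf.nonneg fun x _ y _ => hf.lip x y

theorem intervalIntegral_norm_le_of_ae {E : Type*} [NormedAddCommGroup E] {ℓ A : ℝ} (hℓ : 0 ≤ ℓ)
    {f : ℝ → E} (h : ∀ᵐ t, t ∈ Ioc 0 ℓ → ‖f t‖ ≤ A) :
    ∫ t in (0 : ℝ)..ℓ, ‖f t‖ ≤ A * ℓ := by
  have := intervalIntegral.norm_integral_le_of_norm_le_const_ae (f := fun t => ‖f t‖)
    (a := 0) (b := ℓ) (C := A) (by
      rw [uIoc_of_le hℓ]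
      filter_upwards [h] with t ht hm
      simpa using ht hm)
  rw [sub_zero, abs_of_nonneg hℓ] at this
  exact (le_abs_self _).trans this

/-- Decay of an oscillatory integral with a complex bounded Lipschitz amplitude. -/
theorem norm_oscillatory_integral_le_of_isBddLip {ℓ A : ℝ} (hℓ : 0 ≤ ℓ) {f g : ℝ → ℝ}
    (hf : IsBddLip A f) (hg : IsBddLip A g)
    {ψ μ : ℝ → ℝ} (hψ : ∀ x, HasDerivAt ψ (μ x) x) (hμ : Continuous μ) {x : ℝ}
    (hx : x ∈ Icc 0 ℓ) :
    ‖∫ t in (0 : ℝ)..x, ((f t : ℂ) + Complex.I * g t) * μ t * Complex.exp (Complex.I * ψ t)‖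
      ≤ 2 * (2 * A) + 2 * A * ℓ := by
  obtain ⟨f', hf', bf⟩ := hf.exists_isPrim hℓ
  obtain ⟨g', hg', bg⟩ := hg.exists_isPrim hℓ
  have hP := hf'.ofReal.add (hg'.ofReal.const_mul Complex.I)
  have hn : ∀ a b : ℝ, |a| ≤ A → |b| ≤ A → ‖(a : ℂ) + Complex.I * b‖ ≤ 2 * A := by
    intro a b ha hb
    refine (norm_add_le _ _).trans ?_
    rw [norm_mul, Complex.norm_I, one_mul, Complex.norm_real, Complex.norm_real,
      Real.norm_eq_abs, Real.norm_eq_abs]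
    linarith
  refine norm_oscillatory_integral_le hℓ hP (fun x _ => hn _ _ (hf.bound x) (hg.bound x)) ?_
    hψ hμ hx
  refine intervalIntegral_norm_le_of_ae hℓ ?_
  filter_upwards [bf, bg] with t h1 h2 hm using hn _ _ (h1 hm) (h2 hm)

end BoundaryLayers

namespace BoundaryLayers

/-! ### The oscillating scalar problem -/

/-- Coefficients of the scalar equation `-η² v'' - ρ v = h` with `ρ = q⁴ + r`: the amplitude `q` is
of class `C²`, and the remainder `r` is of order `η` together with its Lipschitz constant. -/
structure IsWKBData (ℓ m A η : ℝ) (q q₁ q₂ r : ℝ → ℝ) : Prop where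
  hasDerivAt : ∀ x, HasDerivAt q (q₁ x) x
  hasDerivAt_deriv : ∀ x, HasDerivAt q₁ (q₂ x) x
  continuous_deriv : Continuous q₂
  lower : ∀ x, m ≤ q x
  bound : ∀ x, |q x| ≤ A
  bound_deriv : ∀ x, |q₁ x| ≤ A
  bound_deriv_two : ∀ x, |q₂ x| ≤ A
  remainder : IsBddLip A (fun x => r x / η)
  periodic : q ℓ = q 0
  periodic_deriv : q₁ ℓ = q₁ 0

/-- The derivative of the phase, up to the factor `η`. -/
noncomputable def frequency (q r : ℝ → ℝ) (x : ℝ) : ℝ := q x ^ 2 + r x / (2 * q x ^ 2)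

/-- The phase of the solutions of `-η² v'' - (q⁴ + r) v = 0`. -/
noncomputable def phase (η : ℝ) (q r : ℝ → ℝ) (x : ℝ) : ℝ :=
  ∫ t in (0 : ℝ)..x, frequency q r t / η

/-- Uniform bounds for the quantities entering the phase-amplitude form of the equation. -/
theorem exists_wkb_bounds {m A : ℝ} (hm : 0 < m) :
    ∃ A₁ η₁ : ℝ, 0 < A₁ ∧ 0 < η₁ ∧ ∀ (ℓ η : ℝ) (q q₁ q₂ r : ℝ → ℝ), 0 < η → η < η₁ →
      IsWKBData ℓ m A η q q₁ q₂ r →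
      (∀ x, m ^ 2 / 2 ≤ frequency q r x) ∧
      IsBddLip A₁ (frequency q r) ∧
      IsBddLip A₁ (fun x => (frequency q r x)⁻¹) ∧
      IsBddLip A₁ (fun x => (q x)⁻¹) ∧
      IsBddLip A₁ (fun x => q₁ x * (q x)⁻¹) ∧
      IsBddLip A₁ (fun x => r x / η * ((q x)⁻¹ * (q x)⁻¹)) ∧
      IsBddLip A₁ (fun x => q₁ x * (q x)⁻¹ * (frequency q r x)⁻¹) ∧
      IsBddLip A₁ (fun x => r x / η * ((q x)⁻¹ * (q x)⁻¹) * (frequency q r x)⁻¹) := by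
  -- Each constant is fixed before the data are introduced, so it depends on `m` and `A` only; its
  -- value is read off from the rule proving the bound.
  obtain ⟨a1, h1⟩ : ∃ a, ∀ q : ℝ → ℝ, IsBddLip A q → (∀ x, m ≤ q x) →
      IsBddLip a (fun x => (q x)⁻¹) := ⟨_, fun q hq hl => hq.inv hm hl⟩
  obtain ⟨a2, h2⟩ : ∃ a, ∀ f g : ℝ → ℝ, IsBddLip A f → IsBddLip a1 g →
      IsBddLip a (fun x => f x * g x) := ⟨_, fun f g hf hg => hf.mul hg⟩
  obtain ⟨a3, h3⟩ : ∃ a, ∀ f g : ℝ → ℝ, IsBddLip A f → IsBddLip a1 g →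
      IsBddLip a (fun x => f x * (g x * g x)) := ⟨_, fun f g hf hg => hf.mul (hg.mul hg)⟩
  obtain ⟨a4, h4⟩ : ∃ a, ∀ f g : ℝ → ℝ, IsBddLip A f → IsBddLip a3 g →
      IsBddLip a (fun x => f x * f x + (1 / 2) * g x) :=
    ⟨_, fun f g hf hg => (hf.mul hf).add (hg.const_mul _)⟩
  obtain ⟨a5, h5⟩ : ∃ a, ∀ f : ℝ → ℝ, IsBddLip a4 f → (∀ x, m ^ 2 / 2 ≤ f x) →
      IsBddLip a (fun x => (f x)⁻¹) := ⟨_, fun q hq hl => hq.inv (by positivity) hl⟩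
  obtain ⟨a6, h6⟩ : ∃ a, ∀ f g : ℝ → ℝ, IsBddLip a2 f → IsBddLip a5 g →
      IsBddLip a (fun x => f x * g x) := ⟨_, fun f g hf hg => hf.mul hg⟩
  obtain ⟨a7, h7⟩ : ∃ a, ∀ f g : ℝ → ℝ, IsBddLip a3 f → IsBddLip a5 g →
      IsBddLip a (fun x => f x * g x) := ⟨_, fun f g hf hg => hf.mul hg⟩
  -- The threshold m²/(1 + |a3|) keeps the correction r/(2q²) below m²/2, so that the frequency
  -- stays above m²/2.
  refine ⟨1 + |a1| + |a2| + |a3| + |a4| + |a5| + |a6| + |a7|, min 1 (m ^ 2 / (1 + |a3|)),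
    by positivity, by positivity, ?_⟩
  intro ℓ η q q₁ q₂ r hη hη1 H
  have k0 := abs_nonneg a1
  have k1 := abs_nonneg a2
  have k2 := abs_nonneg a3
  have k3 := abs_nonneg a4
  have k4 := abs_nonneg a5
  have k5 := abs_nonneg a6
  have k6 := abs_nonneg a7
  have l0 := le_abs_self a1
  have l1 := le_abs_self a2
  have l2 := le_abs_self a3
  have l3 := le_abs_self a4
  have l4 := le_abs_self a5
  have l5 := le_abs_self a6
  have l6 := le_abs_self a7
  have hqp : ∀ x, 0 < q x := fun x => hm.trans_le (H.lower x)
  have bq : IsBddLip A q := IsBddLip.of_hasDerivAt H.bound H.hasDerivAt H.bound_deriv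
  have bq1 : IsBddLip A q₁ :=
    IsBddLip.of_hasDerivAt H.bound_deriv H.hasDerivAt_deriv H.bound_deriv_two
  have bi := h1 q bq H.lower
  have bb := h2 _ _ bq1 bi
  have br := h3 _ _ H.remainder bi
  have efr : ∀ x, frequency q r x
      = q x * q x + (1 / 2) * η * (r x / η * ((q x)⁻¹ * (q x)⁻¹)) := by
    intro x
    have := (hqp x).ne'
    simp only [frequency]
    field_simp
  have hlow : ∀ x, m ^ 2 / 2 ≤ frequency q r x := by
    intro x
    have e1 := (abs_le.1 (br.bound x)).1
    have e2 : η * (1 + |a3|) < m ^ 2 := by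
      rw [← lt_div_iff₀ (by positivity)]; exact hη1.trans_le (min_le_right _ _)
    have e3 := mul_self_le_mul_self hm.le (H.lower x)
    rw [efr]
    have e4 : -(η * (1 + |a3|)) ≤ η * (r x / η * ((q x)⁻¹ * (q x)⁻¹)) := by
      rw [← mul_neg]
      exact mul_le_mul_of_nonneg_left (by linarith) hη.le
    nlinarith
  have bη : IsBddLip a3 (fun x => η * (r x / η * ((q x)⁻¹ * (q x)⁻¹))) := by
    refine (br.const_mul η).mono ?_
    rw [abs_of_pos hη]
    have : η ≤ 1 := hη1.le.trans (min_le_left _ _)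
    nlinarith [br.nonneg]
  have bf : IsBddLip a4 (frequency q r) := by
    have := h4 _ _ bq bη
    refine ⟨fun x => ?_, fun x y => ?_⟩
    · rw [efr, mul_assoc (1 / 2)]; exact this.bound x
    · rw [efr, efr, mul_assoc (1 / 2), mul_assoc (1 / 2)]; exact this.lip x y
  have bfi := h5 _ bf hlow
  exact ⟨hlow, bf.mono (by linarith), bfi.mono (by linarith), bi.mono (by linarith),
    bb.mono (by linarith), br.mono (by linarith), (h6 _ _ bb bfi).mono (by linarith),
    (h7 _ _ br bfi).mono (by linarith)⟩

theorem hasDerivAt_phase {η : ℝ} {q r : ℝ → ℝ} (h : Continuous (frequency q r)) (x : ℝ) :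
    HasDerivAt (phase η q r) (frequency q r x / η) x :=
  intervalIntegral.integral_hasDerivAt_right ((h.div_const η).intervalIntegrable _ _)
    ((h.div_const η).stronglyMeasurableAtFilter _ _) (h.div_const η).continuousAt

/-- A priori bound for an equation `y' = b e^{2iφ} ȳ + g` with a rapidly oscillating coefficient
and a non-resonant condition at the end points. -/
theorem norm_le_of_oscillating_system {ℓ A k c Γ B S : ℝ} (hℓ : 0 ≤ ℓ) {y y' b g K : ℝ → ℂ}
    {w : ℂ} (hc : 0 < c) (hk0 : 0 ≤ k)
    (hy : IsPrim ℓ y y') (hyb : ∀ x, y' x = b x * (starRingEnd ℂ) (y x) + g x)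
    (hK : IsPrim ℓ K b) (hK0 : K 0 = 0) (hKb : ∀ x ∈ Icc 0 ℓ, ‖K x‖ ≤ k)
    (hbA : ∀ x, ‖b x‖ ≤ A)
    (hg : IntervalIntegrable g volume 0 ℓ)
    (hΓ : ∀ x ∈ Icc 0 ℓ, ‖∫ t in (0 : ℝ)..x, g t‖ ≤ Γ) (hB : ∫ t in (0 : ℝ)..ℓ, ‖g t‖ ≤ B)
    (hw : c ≤ ‖w - 1‖) (hper : y ℓ = w * y 0) (hS : ∀ x ∈ Icc 0 ℓ, ‖y x‖ ≤ S)
    (hsmall : (1 + 1 / c) * (k * (1 + A * ℓ)) ≤ 1 / 2)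
    (hSmax : ∃ x ∈ Icc 0 ℓ, S = ‖y x‖) :
    S ≤ 2 * (1 + 1 / c) * (Γ + k * B) := by
  have h0 : (0 : ℝ) ∈ Icc 0 ℓ := ⟨le_rfl, hℓ⟩
  have hA0 : 0 ≤ A := (norm_nonneg _).trans (hbA 0)
  have hS0 : 0 ≤ S := (norm_nonneg _).trans (hS 0 h0)
  -- The derivative of y - Kȳ - ∫g is -K times the conjugate of y': the term bȳ has cancelled, and
  -- what remains carries the small factor K.
  have hP := (hy.sub (hK.mul hy.conj hℓ)).sub (IsPrim.of_integral hg)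
  have hstep : ∀ x ∈ Icc 0 ℓ, ‖y x - y 0‖ ≤ Γ + k * B + k * (1 + A * ℓ) * S := by
    intro x hx
    have h1 := hP.norm_sub_le hx
    have h2 : ∫ t in (0 : ℝ)..ℓ, ‖y' t - (b t * (starRingEnd ℂ) (y t)
        + K t * (starRingEnd ℂ) (y' t)) - g t‖ ≤ k * (A * S * ℓ + B) := by
      have e : ∫ t in (0 : ℝ)..ℓ, k * (A * S + ‖g t‖) = k * (A * S * ℓ + ∫ t in (0 : ℝ)..ℓ, ‖g t‖) := by
        rw [intervalIntegral.integral_const_mul, intervalIntegral.integral_add (by simp) hg.norm]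
        simp only [intervalIntegral.integral_const, sub_zero, smul_eq_mul]
        ring
      have : ∫ t in (0 : ℝ)..ℓ, ‖y' t - (b t * (starRingEnd ℂ) (y t)
          + K t * (starRingEnd ℂ) (y' t)) - g t‖ ≤ ∫ t in (0 : ℝ)..ℓ, k * (A * S + ‖g t‖) := by
        refine intervalIntegral.integral_mono_on hℓ hP.integrable.norm
          ((((by simp : IntervalIntegrable (fun _ : ℝ => A * S) volume 0 ℓ)).add hg.norm).const_mul k)
          fun t ht => ?_
        have e : y' t - (b t * (starRingEnd ℂ) (y t) + K t * (starRingEnd ℂ) (y' t)) - g t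
            = -(K t * (starRingEnd ℂ) (y' t)) := by rw [hyb t]; ring
        rw [e, norm_neg, norm_mul, RCLike.norm_conj, hyb t]
        refine mul_le_mul (hKb t ht) ?_ (norm_nonneg _) hk0
        refine (norm_add_le _ _).trans ?_
        rw [norm_mul, RCLike.norm_conj]
        gcongr
        · exact hbA t
        · exact hS t ht
      rw [e] at this
      refine this.trans ?_
      gcongr
    have h3 := h1.trans h2
    simp only [hK0, zero_mul, sub_zero, intervalIntegral.integral_same] at h3
    have e : y x - y 0 = (y x - K x * (starRingEnd ℂ) (y x) - (∫ t in (0 : ℝ)..x, g t) - y 0)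
        + K x * (starRingEnd ℂ) (y x) + ∫ t in (0 : ℝ)..x, g t := by ring
    rw [e]
    have h4 : ‖K x * (starRingEnd ℂ) (y x)‖ ≤ k * S := by
      rw [norm_mul, RCLike.norm_conj]
      exact mul_le_mul (hKb x hx) (hS x hx) (norm_nonneg _) hk0
    have h5 := norm_add₃_le (a := y x - K x * (starRingEnd ℂ) (y x) - (∫ t in (0 : ℝ)..x, g t) - y 0)
      (b := K x * (starRingEnd ℂ) (y x)) (c := ∫ t in (0 : ℝ)..x, g t)
    have h6 := hΓ x hx
    nlinarith
  set X := Γ + k * B + k * (1 + A * ℓ) * S with hX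
  -- At x = ℓ the increment y ℓ - y 0 equals (w - 1) y 0, and non-resonance allows division by w -
  -- 1.
  have hy0 : ‖y 0‖ ≤ 1 / c * X := by
    have h1 := hstep ℓ ⟨hℓ, le_rfl⟩
    rw [hper, show w * y 0 - y 0 = (w - 1) * y 0 by ring, norm_mul] at h1
    have h2 : c * ‖y 0‖ ≤ X := (mul_le_mul_of_nonneg_right hw (norm_nonneg _)).trans h1
    rw [one_div, ← div_eq_inv_mul, le_div_iff₀ hc]
    linarith
  obtain ⟨x, hx, rfl⟩ := hSmax
  have h1 := hstep x hx
  have h2 : ‖y x‖ ≤ ‖y x - y 0‖ + ‖y 0‖ := by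
    simpa using norm_add_le (y x - y 0) (y 0)
  have h3 : ‖y x‖ ≤ (1 + 1 / c) * X := by linarith
  -- The part of the bound proportional to the maximum of ‖y‖ has coefficient at most 1/2 and is
  -- absorbed into the left side.
  have h4 : (1 + 1 / c) * (k * (1 + A * ℓ)) * ‖y x‖ ≤ 1 / 2 * ‖y x‖ :=
    mul_le_mul_of_nonneg_right hsmall (norm_nonneg _)
  rw [hX] at h3
  linarith

end BoundaryLayers

/-! ### Phase-amplitude form of the scalar equation -/

namespace BoundaryLayers

/-- This is iφ'z + z' = (q₁/q - (i/2)r/(ηq²)) z̄ - ih/(ηq) for z = qv + iηv'/q. The weights q and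
1/q put the q₁ terms on z̄ alone, and the correction r/(2q²) of the frequency does the same for the
r terms; after multiplication by e^{iφ} only a term oscillating like e^{2iφ} is left in front of ȳ.
-/
theorem phaseAmplitude_identity {q q₁ r η v v₁ v₂ h : ℝ} (hq : q ≠ 0) (hη : η ≠ 0)
    (heq : -η ^ 2 * v₂ - (q ^ 4 + r) * v = h) :
    Complex.I * ((q ^ 2 + r / (2 * q ^ 2)) / η : ℝ) *
        (((q * v : ℝ) : ℂ) + Complex.I * η * ((v₁ * q⁻¹ : ℝ) : ℂ)) +
      (((q₁ * v + q * v₁ : ℝ) : ℂ) +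
        Complex.I * η * ((v₂ * q⁻¹ + v₁ * (-(q₁ * (q⁻¹ * q⁻¹))) : ℝ) : ℂ)) =
    (((q₁ * q⁻¹ : ℝ) : ℂ) + Complex.I * ((-(1 / 2) * (r / η * (q⁻¹ * q⁻¹)) : ℝ) : ℂ)) *
        (((q * v : ℝ) : ℂ) - Complex.I * η * ((v₁ * q⁻¹ : ℝ) : ℂ)) +
      -(Complex.I * ((h / (η * q) : ℝ) : ℂ)) := by
  subst heq
  apply Complex.ext
  · simp only [Complex.add_re, Complex.mul_re, Complex.mul_im, Complex.ofReal_re, Complex.ofReal_im,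
      Complex.I_re, Complex.I_im, Complex.add_im, Complex.sub_re, Complex.sub_im, Complex.neg_re]
    field_simp
    ring
  · simp only [Complex.add_re, Complex.mul_re, Complex.mul_im, Complex.ofReal_re, Complex.ofReal_im,
      Complex.I_re, Complex.I_im, Complex.add_im, Complex.sub_re, Complex.sub_im, Complex.neg_im]
    field_simp
    ring

/-- A priori estimate for the periodic problem, away from resonance. The number `Γ` bounds the
oscillatory integrals of the right-hand side. -/
theorem exists_wkb_estimate {ℓ m A c : ℝ} (hℓ : 0 < ℓ) (hm : 0 < m) (hc : 0 < c) :
    ∃ C η₁ : ℝ, 0 < C ∧ 0 < η₁ ∧ ∀ (η : ℝ) (q q₁ q₂ r : ℝ → ℝ), 0 < η → η < η₁ →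
      IsWKBData ℓ m A η q q₁ q₂ r →
      c ≤ ‖Complex.exp (Complex.I * phase η q r ℓ) - 1‖ →
      ∀ (v v₁ v₂ h : ℝ → ℝ) (Γ : ℝ), IsPrim ℓ v v₁ → IsPrim ℓ v₁ v₂ → v 0 = v ℓ → v₁ 0 = v₁ ℓ →
      IntervalIntegrable h volume 0 ℓ →
      (∀ᵐ t, t ∈ Ioc 0 ℓ → -η ^ 2 * v₂ t - (q t ^ 4 + r t) * v t = h t) →
      (∀ x ∈ Icc 0 ℓ,
        ‖∫ t in (0 : ℝ)..x, Complex.exp (Complex.I * phase η q r t) * ((h t / q t : ℝ) : ℂ)‖ ≤ Γ) →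
      ∀ x ∈ Icc 0 ℓ, |v x| ≤ C * (Γ / η + ∫ t in (0 : ℝ)..ℓ, |h t|) ∧
        η * |v₁ x| ≤ C * (Γ / η + ∫ t in (0 : ℝ)..ℓ, |h t|) := by
  obtain ⟨A₁, η₁, hA₁, hη₁, hb⟩ := exists_wkb_bounds (A := A) hm
  -- η k₀ will bound ∫b: it is the oscillatory estimate 2(2A) + 2Aℓ with A = ηA₁/2. The constant `D`
  -- is chosen so that the smallness condition for y becomes ηD ≤ 1/2.
  set k₀ : ℝ := A₁ * (2 + ℓ) with hk₀
  have hk₀p : 0 < k₀ := by positivity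
  set D : ℝ := (1 + 1 / c) * (k₀ * (1 + 2 * A₁ * ℓ)) with hD
  have hDp : 0 < D := by positivity
  set C₀ : ℝ := 2 * (1 + 1 / c) * (1 + k₀ * A₁) with hC₀
  have hC₀p : 0 < C₀ := by positivity
  refine ⟨C₀ * (1 / m + |A|), min η₁ (1 / (2 * D)), by positivity, by positivity, ?_⟩
  intro η q q₁ q₂ r hη hηlt H hres v v₁ v₂ h Γ hv hv₁ hper hper₁ hh heq hΓ
  obtain ⟨hlow, hfr, -, hqi, hb1, hr1, hb2, hr2⟩ := hb ℓ η q q₁ q₂ r hη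
    (hηlt.trans_le (min_le_left _ _)) H
  have hℓ0 := hℓ.le
  have hqp : ∀ x, 0 < q x := fun x => hm.trans_le (H.lower x)
  have hcq : Continuous q := continuous_iff_continuousAt.2 fun x => (H.hasDerivAt x).continuousAt
  have hcq₁ : Continuous q₁ :=
    continuous_iff_continuousAt.2 fun x => (H.hasDerivAt_deriv x).continuousAt
  have hφ := fun x => hasDerivAt_phase (η := η) hfr.continuous x
  have hcφ : Continuous (phase η q r) :=
    continuous_iff_continuousAt.2 fun x => (hφ x).continuousAt
  have hcf := hfr.continuous
  set e : ℝ → ℂ := fun x => Complex.exp (Complex.I * phase η q r x) with he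
  have hce : Continuous e := by fun_prop
  have he1 : ∀ t, ‖e t‖ = 1 := fun t => by
    rw [he]; simp only [mul_comm Complex.I]; exact Complex.norm_exp_ofReal_mul_I _
  have hed : ∀ x, HasDerivAt e (e x * (Complex.I * (frequency q r x / η : ℝ))) x := fun x =>
    (((hφ x).ofReal_comp).const_mul Complex.I).cexp
  have hE : IsPrim ℓ e (fun x => e x * (Complex.I * (frequency q r x / η : ℝ))) :=
    IsPrim.of_hasDerivAt hℓ0 (fun x _ => hed x) (by fun_prop)
  have hQ : IsPrim ℓ q q₁ := IsPrim.of_hasDerivAt hℓ0 (fun x _ => H.hasDerivAt x) hcq₁.continuousOn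
  have hQi : IsPrim ℓ (fun x => (q x)⁻¹) (fun x => -(q₁ x * ((q x)⁻¹ * (q x)⁻¹))) := by
    refine IsPrim.of_hasDerivAt hℓ0 (fun x _ => ?_) ?_
    · convert (H.hasDerivAt x).fun_inv (hqp x).ne' using 1
      have := (hqp x).ne'
      field_simp
    · have : Continuous fun x => (q x)⁻¹ := hcq.inv₀ fun x => (hqp x).ne'
      fun_prop
  have hZ := (hQ.mul hv hℓ0).ofReal.add (((hv₁.mul hQi hℓ0).ofReal).const_mul (Complex.I * η))
  have hY := hE.mul hZ hℓ0
  set z : ℝ → ℂ := fun x => ((q x * v x : ℝ) : ℂ) + Complex.I * η * ((v₁ x * (q x)⁻¹ : ℝ) : ℂ)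
    with hz
  set y : ℝ → ℂ := fun x => e x * z x with hy
  set b : ℝ → ℂ := fun x => (((q₁ x * (q x)⁻¹ : ℝ) : ℂ)
    + Complex.I * ((-(1 / 2) * (r x / η * ((q x)⁻¹ * (q x)⁻¹)) : ℝ) : ℂ)) * (e x * e x) with hbdef
  set g : ℝ → ℂ := fun x => e x * -(Complex.I * ((h x / (η * q x) : ℝ) : ℂ)) with hg
  have hYp : IsPrim ℓ y (fun x => b x * (starRingEnd ℂ) (y x) + g x) := by
    refine hY.congr hℓ0 (fun x _ => rfl) ?_
    filter_upwards [heq] with t ht hm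
    have hid := phaseAmplitude_identity (q₁ := q₁ t) (v₁ := v₁ t) (hqp t).ne' hη.ne' (ht hm)
    -- Because e has modulus one, e z̄ = e² ȳ; this is the origin of the factor e² in `b`.
    have hee : e t * (starRingEnd ℂ) (e t) = 1 := by
      rw [Complex.mul_conj, Complex.normSq_eq_norm_sq, he1]; simp
    have hcz : (starRingEnd ℂ) (z t)
        = ((q t * v t : ℝ) : ℂ) - Complex.I * η * ((v₁ t * (q t)⁻¹ : ℝ) : ℂ) := by
      simp only [hz, map_add, map_mul, Complex.conj_ofReal, Complex.conj_I]
      ring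
    simp only [hbdef, hg, hy, map_mul]
    rw [hcz]
    have hfreq : frequency q r t = q t ^ 2 + r t / (2 * q t ^ 2) := rfl
    rw [← hfreq] at hid
    linear_combination (-(e t)) * hid + (((q₁ t * (q t)⁻¹ : ℝ) : ℂ)
      + Complex.I * ((-(1 / 2) * (r t / η * ((q t)⁻¹ * (q t)⁻¹)) : ℝ) : ℂ)) *
      (((q t * v t : ℝ) : ℂ) - Complex.I * η * ((v₁ t * (q t)⁻¹ : ℝ) : ℂ)) * e t * hee
  have hcb : Continuous b := by
    have h1 := hb1.continuous
    have h2 := hr1.continuous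
    have h3 : Continuous fun x => -(1 / 2) * (r x / η * ((q x)⁻¹ * (q x)⁻¹)) :=
      continuous_const.mul h2
    exact ((Complex.continuous_ofReal.comp h1).add (continuous_const.mul
      (Complex.continuous_ofReal.comp h3))).mul (hce.mul hce)
  have hK := IsPrim.of_integral (ℓ := ℓ) (hcb.intervalIntegrable (μ := volume) 0 ℓ)
  have hbA : ∀ x, ‖b x‖ ≤ 2 * A₁ := by
    intro x
    rw [hbdef]
    simp only [norm_mul, he1, mul_one]
    refine (norm_add_le _ _).trans ?_
    rw [norm_mul, Complex.norm_I, one_mul, Complex.norm_real, Complex.norm_real,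
      Real.norm_eq_abs, Real.norm_eq_abs, abs_mul (-(1 / 2) : ℝ)]
    have h1 := hb1.bound x
    have h2 := hr1.bound x
    have h3 : |(-(1 / 2) : ℝ)| = 1 / 2 := by norm_num
    rw [h3]
    linarith
  have hKb : ∀ x ∈ Icc 0 ℓ, ‖∫ t in (0 : ℝ)..x, b t‖ ≤ η * k₀ := by
    intro x hx
    -- The phase of `b` is 2φ, so its amplitude is divided by 2φ' = 2 `frequency`/η; hence the
    -- coefficients η/2 and -(1/2)(η/2) = -η/4.
    have b1 : IsBddLip (η / 2 * A₁) (fun x => η / 2 * (q₁ x * (q x)⁻¹ * (frequency q r x)⁻¹)) := by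
      have := hb2.const_mul (η / 2)
      rwa [abs_of_pos (by positivity)] at this
    have b2 : IsBddLip (η / 2 * A₁) (fun x => -(η / 4) * (r x / η * ((q x)⁻¹ * (q x)⁻¹)
        * (frequency q r x)⁻¹)) := by
      refine (hr2.const_mul (-(η / 4))).mono ?_
      rw [abs_neg, abs_of_pos (by positivity)]
      nlinarith
    have hos := norm_oscillatory_integral_le_of_isBddLip hℓ0 b1 b2
      (ψ := fun x => 2 * phase η q r x) (μ := fun x => 2 * (frequency q r x / η))
      (fun x => (hφ x).const_mul 2) (by fun_prop) hx
    have e1 : ∀ t, (((η / 2 * (q₁ t * (q t)⁻¹ * (frequency q r t)⁻¹) : ℝ) : ℂ) + Complex.I *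
        ((-(η / 4) * (r t / η * ((q t)⁻¹ * (q t)⁻¹) * (frequency q r t)⁻¹) : ℝ) : ℂ)) *
        ((2 * (frequency q r t / η) : ℝ) : ℂ) *
        Complex.exp (Complex.I * ((2 * phase η q r t : ℝ) : ℂ)) = b t := by
      intro t
      have hf0 : frequency q r t ≠ 0 :=
        (lt_of_lt_of_le (by positivity) (hlow t)).ne'
      have e2 : Complex.exp (Complex.I * ((2 * phase η q r t : ℝ) : ℂ)) = e t * e t := by
        rw [he]
        simp only
        rw [← Complex.exp_add]
        congr 1
        push_cast
        ring
      rw [e2, hbdef]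
      simp only
      congr 1
      have hfc : (frequency q r t : ℂ) ≠ 0 := by exact_mod_cast hf0
      have hηc : (η : ℂ) ≠ 0 := by exact_mod_cast hη.ne'
      have hqc : (q t : ℂ) ≠ 0 := by exact_mod_cast (hqp t).ne'
      push_cast
      field_simp
      ring
    simp only [e1] at hos
    refine hos.trans (le_of_eq ?_)
    rw [hk₀]
    ring
  have hgi : IntervalIntegrable g volume 0 ℓ := by
    have h1 : IntervalIntegrable (fun x => h x * (1 / (η * q x))) volume 0 ℓ :=
      hh.mul_continuousOn (Continuous.continuousOn (continuous_const.div (continuous_const.mul hcq)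
        fun x => (mul_pos hη (hqp x)).ne'))
    have h2 : IntervalIntegrable (fun x => ((h x / (η * q x) : ℝ) : ℂ)) volume 0 ℓ := by
      simp only [mul_one_div] at h1
      exact ⟨h1.1.ofReal, h1.2.ofReal⟩
    exact ((h2.const_mul Complex.I).neg).continuousOn_mul hce.continuousOn
  have hgΓ : ∀ x ∈ Icc 0 ℓ, ‖∫ t in (0 : ℝ)..x, g t‖ ≤ Γ / η := by
    intro x hx
    have e1 : ∀ t, g t = -(Complex.I / η) * (e t * ((h t / q t : ℝ) : ℂ)) := by
      intro t
      rw [hg]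
      have hηc : (η : ℂ) ≠ 0 := by exact_mod_cast hη.ne'
      have hqc : (q t : ℂ) ≠ 0 := by exact_mod_cast (hqp t).ne'
      push_cast
      field_simp
    simp only [e1]
    rw [intervalIntegral.integral_const_mul, norm_mul, norm_neg, norm_div, Complex.norm_I,
      Complex.norm_real, Real.norm_eq_abs, abs_of_pos hη, one_div, ← div_eq_inv_mul]
    gcongr
    exact hΓ x hx
  have hgB : ∫ t in (0 : ℝ)..ℓ, ‖g t‖ ≤ A₁ / η * ∫ t in (0 : ℝ)..ℓ, |h t| := by
    rw [← intervalIntegral.integral_const_mul]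
    refine intervalIntegral.integral_mono_on hℓ0 hgi.norm (hh.abs.const_mul _) fun t _ => ?_
    rw [hg]
    simp only [norm_mul, norm_neg, Complex.norm_I, one_mul, he1, Complex.norm_real,
      Real.norm_eq_abs, abs_div, abs_of_pos (mul_pos hη (hqp t))]
    have h1 := hqi.bound t
    rw [abs_of_pos (inv_pos.2 (hqp t))] at h1
    calc |h t| / (η * q t) = (q t)⁻¹ / η * |h t| := by
          have := (hqp t).ne'
          field_simp
      _ ≤ A₁ / η * |h t| := by gcongr
  have hphase0 : phase η q r 0 = 0 := by simp [phase]
  have hyper : y ℓ = e ℓ * y 0 := by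
    have e0 : e 0 = 1 := by simp [he, hphase0]
    simp only [hy, hz, e0, H.periodic, ← hper, ← hper₁, one_mul]
  obtain ⟨x₀, hx₀, hmax⟩ := isCompact_Icc.exists_isMaxOn (nonempty_Icc.2 hℓ0)
    (hYp.continuousOn hℓ0).norm
  have hsm : (1 + 1 / c) * (η * k₀ * (1 + 2 * A₁ * ℓ)) ≤ 1 / 2 := by
    have h1 : η ≤ 1 / (2 * D) := hηlt.le.trans (min_le_right _ _)
    rw [le_div_iff₀ (by positivity)] at h1
    have : (1 + 1 / c) * (η * k₀ * (1 + 2 * A₁ * ℓ)) = η * D := by rw [hD]; ring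
    linarith
  have hest := norm_le_of_oscillating_system hℓ0 hc (by positivity) hYp (fun _ => rfl) hK
    (by simp) hKb hbA hgi hgΓ hgB hres hyper (fun x hx => hmax hx) hsm ⟨x₀, hx₀, rfl⟩
  have hI0 : 0 ≤ ∫ t in (0 : ℝ)..ℓ, |h t| :=
    intervalIntegral.integral_nonneg hℓ0 fun t _ => abs_nonneg _
  have hΓ0 : 0 ≤ Γ := (norm_nonneg _).trans (hΓ 0 ⟨le_rfl, hℓ0⟩)
  set X := Γ / η + ∫ t in (0 : ℝ)..ℓ, |h t| with hX
  have hX0 : 0 ≤ X := by positivity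
  have hest' : ‖y x₀‖ ≤ C₀ * X := by
    refine hest.trans ?_
    have e1 : η * k₀ * (A₁ / η * ∫ t in (0 : ℝ)..ℓ, |h t|)
        = k₀ * A₁ * ∫ t in (0 : ℝ)..ℓ, |h t| := by field_simp
    rw [e1, hC₀, mul_assoc (2 * (1 + 1 / c)), hX]
    refine mul_le_mul_of_nonneg_left ?_ (by positivity)
    have : 0 ≤ k₀ * A₁ * (Γ / η) := by positivity
    nlinarith
  intro x hx
  have hyx : ‖z x‖ ≤ C₀ * X := by
    have h1 : ‖y x‖ ≤ ‖y x₀‖ := hmax hx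
    rw [hy] at h1
    simp only [norm_mul, he1, one_mul] at h1
    refine h1.trans ?_
    have := hest'
    rw [hy] at this
    simpa only [norm_mul, he1, one_mul] using this
  have hre : |q x * v x| ≤ C₀ * X := by
    refine le_trans ?_ ((Complex.abs_re_le_norm (z x)).trans hyx)
    simp [hz]
  have him : |η * (v₁ x * (q x)⁻¹)| ≤ C₀ * X := by
    refine le_trans ?_ ((Complex.abs_im_le_norm (z x)).trans hyx)
    simp [hz]
  constructor
  · rw [abs_mul, abs_of_pos (hqp x)] at hre
    have h1 : m * |v x| ≤ C₀ * X :=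
      (mul_le_mul_of_nonneg_right (H.lower x) (abs_nonneg _)).trans hre
    have h2 : |v x| ≤ C₀ * X / m := by rw [le_div_iff₀ hm]; linarith
    refine h2.trans ?_
    have : 0 ≤ C₀ * |A| * X := by positivity
    calc C₀ * X / m ≤ C₀ * X / m + C₀ * |A| * X := by linarith
      _ = C₀ * (1 / m + |A|) * X := by ring
  · have h1 : η * |v₁ x| = |η * (v₁ x * (q x)⁻¹)| * q x := by
      rw [abs_mul, abs_mul, abs_of_pos hη, abs_of_pos (inv_pos.2 (hqp x))]
      have := (hqp x).ne'
      field_simp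
    rw [h1]
    have h2 : q x ≤ |A| := (le_abs_self _).trans ((H.bound x).trans (le_abs_self _))
    calc |η * (v₁ x * (q x)⁻¹)| * q x ≤ C₀ * X * |A| :=
          mul_le_mul him h2 (hqp x).le (by positivity)
      _ ≤ C₀ * X * |A| + C₀ * X / m := by
          have : 0 ≤ C₀ * X / m := by positivity
          linarith
      _ = C₀ * (1 / m + |A|) * X := by ring

end BoundaryLayers

namespace BoundaryLayers

/-! ### Existence for the periodic problem -/

theorem integral_exp_mul_le {L s : ℝ} (hL : 0 < L) :
    ∫ t in (0 : ℝ)..s, Real.exp (L * t) ≤ Real.exp (L * s) / L := by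
  have h : ∀ t ∈ uIcc 0 s, HasDerivAt (fun t => Real.exp (L * t) / L) (Real.exp (L * t)) t := by
    intro t _
    have := (((hasDerivAt_id t).const_mul L).exp).div_const L
    simpa [hL.ne'] using this
  rw [intervalIntegral.integral_eq_sub_of_hasDerivAt h
    (Continuous.intervalIntegrable (by fun_prop) _ _)]
  have : 0 < Real.exp (L * 0) / L := by positivity
  linarith

/-- The initial value problem for `-v'' = ρ v + h` has a solution on `[0, ℓ]`. -/
theorem exists_initial_value_solution {ℓ : ℝ} (hℓ : 0 ≤ ℓ) {ρ h : ℝ → ℝ} (hρ : Continuous ρ)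
    (hh : IntervalIntegrable h volume 0 ℓ) (a b : ℝ) :
    ∃ v v₁ : ℝ → ℝ, IsPrim ℓ v v₁ ∧ IsPrim ℓ v₁ (fun t => -(ρ t * v t + h t)) ∧
      Continuous v ∧ v 0 = a ∧ v₁ 0 = b := by
  obtain ⟨M₀, hM₀⟩ := isCompact_Icc.exists_bound_of_continuousOn (s := Icc 0 ℓ) hρ.continuousOn
  set M : ℝ := |M₀| + 1 with hM
  have hMp : 0 < M := by positivity
  have hρM : ∀ t ∈ Icc 0 ℓ, |ρ t| ≤ M := fun t ht =>
    ((hM₀ t ht).trans (le_abs_self _)).trans (by linarith)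
  -- The fixed point is sought for e^{-Lx}v: each of the two integrations gains a factor 1/L, so the
  -- Lipschitz constant is M/L², at most 1/2, however long the interval is.
  set L : ℝ := 2 * M + 1 with hL
  have hLp : 0 < L := by positivity
  set w : C(Icc 0 ℓ, ℝ) → ℝ → ℝ := fun u t => Real.exp (L * t) * IccExtend hℓ u t with hw
  have hwc : ∀ u, Continuous (w u) := fun u => by
    have : Continuous (IccExtend hℓ u) := u.continuous.Icc_extend'
    fun_prop
  have hIntegrable : ∀ u, IntervalIntegrable (fun t => -(ρ t * w u t + h t)) volume 0 ℓ := fun u =>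
    (((hρ.mul (hwc u)).intervalIntegrable 0 ℓ).add hh).neg
  set v₁ : C(Icc 0 ℓ, ℝ) → ℝ → ℝ := fun u x => b + ∫ t in (0 : ℝ)..x, -(ρ t * w u t + h t) with hv₁
  have hv₁p : ∀ u, IsPrim ℓ (v₁ u) (fun t => -(ρ t * w u t + h t)) := fun u =>
    ⟨hIntegrable u, fun x _ => by simp [hv₁]⟩
  have hv₁i : ∀ u, IntervalIntegrable (v₁ u) volume 0 ℓ := fun u =>
    ContinuousOn.intervalIntegrable (by rw [uIcc_of_le hℓ]; exact (hv₁p u).continuousOn hℓ)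
  set v : C(Icc 0 ℓ, ℝ) → ℝ → ℝ := fun u x => a + ∫ t in (0 : ℝ)..x, v₁ u t with hv
  have hvp : ∀ u, IsPrim ℓ (v u) (v₁ u) := fun u => ⟨hv₁i u, fun x _ => by simp [hv]⟩
  set T : C(Icc 0 ℓ, ℝ) → C(Icc 0 ℓ, ℝ) := fun u =>
    ⟨fun x => Real.exp (-(L * x)) * v u x, by
      have h1 : ContinuousOn (fun x => Real.exp (-(L * x)) * v u x) (Icc 0 ℓ) :=
        (Continuous.continuousOn (by fun_prop)).mul ((hvp u).continuousOn hℓ)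
      exact continuousOn_iff_continuous_domRestrict.1 h1⟩ with hT
  have hdiff₁ : ∀ u₁ u₂, ∀ x ∈ Icc 0 ℓ,
      |v₁ u₁ x - v₁ u₂ x| ≤ M * dist u₁ u₂ / L * Real.exp (L * x) := by
    intro u₁ u₂ x hx
    have hs : ∀ u, IntervalIntegrable (fun t => -(ρ t * w u t + h t)) volume 0 x := fun u =>
      (hv₁p u).integrable_of_mem hx
    have e : v₁ u₁ x - v₁ u₂ x = ∫ t in (0 : ℝ)..x, (ρ t * (w u₂ t - w u₁ t)) := by
      simp only [hv₁]
      rw [add_sub_add_left_eq_sub, ← intervalIntegral.integral_sub (hs _) (hs _)]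
      congr 1
      ext t
      ring
    rw [e]
    have h1 : ‖∫ t in (0 : ℝ)..x, (ρ t * (w u₂ t - w u₁ t))‖
        ≤ ∫ t in (0 : ℝ)..x, M * dist u₁ u₂ * Real.exp (L * t) := by
      refine intervalIntegral.norm_integral_le_of_norm_le hx.1 ?_
        (Continuous.intervalIntegrable (by fun_prop) _ _)
      refine Eventually.of_forall fun t ht => ?_
      have htm : t ∈ Icc 0 ℓ := ⟨ht.1.le, ht.2.trans hx.2⟩
      have hd : |IccExtend hℓ u₂ t - IccExtend hℓ u₁ t| ≤ dist u₁ u₂ := by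
        rw [IccExtend_of_mem _ _ htm, IccExtend_of_mem _ _ htm, abs_sub_comm]
        exact ContinuousMap.dist_apply_le_dist (f := u₁) (g := u₂) ⟨t, htm⟩
      rw [hw]
      simp only
      rw [← mul_sub, Real.norm_eq_abs, abs_mul, abs_mul, Real.abs_exp]
      calc |ρ t| * (Real.exp (L * t) * |IccExtend hℓ u₂ t - IccExtend hℓ u₁ t|)
          ≤ M * (Real.exp (L * t) * dist u₁ u₂) := by
            gcongr
            exact hρM t htm
        _ = M * dist u₁ u₂ * Real.exp (L * t) := by ring
    refine h1.trans ?_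
    rw [intervalIntegral.integral_const_mul]
    calc M * dist u₁ u₂ * ∫ t in (0 : ℝ)..x, Real.exp (L * t)
        ≤ M * dist u₁ u₂ * (Real.exp (L * x) / L) := by
          gcongr
          exact integral_exp_mul_le hLp
      _ = _ := by ring
  have hdiff : ∀ u₁ u₂, ∀ x ∈ Icc 0 ℓ,
      |v u₁ x - v u₂ x| ≤ M * dist u₁ u₂ / L / L * Real.exp (L * x) := by
    intro u₁ u₂ x hx
    have e : v u₁ x - v u₂ x = ∫ t in (0 : ℝ)..x, (v₁ u₁ t - v₁ u₂ t) := by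
      simp only [hv]
      rw [add_sub_add_left_eq_sub, ← intervalIntegral.integral_sub
        ((hvp _).integrable_of_mem hx) ((hvp _).integrable_of_mem hx)]
    rw [e]
    have h1 : ‖∫ t in (0 : ℝ)..x, (v₁ u₁ t - v₁ u₂ t)‖
        ≤ ∫ t in (0 : ℝ)..x, M * dist u₁ u₂ / L * Real.exp (L * t) := by
      refine intervalIntegral.norm_integral_le_of_norm_le hx.1 ?_
        (Continuous.intervalIntegrable (by fun_prop) _ _)
      exact Eventually.of_forall fun t ht => hdiff₁ u₁ u₂ t ⟨ht.1.le, ht.2.trans hx.2⟩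
    refine h1.trans ?_
    rw [intervalIntegral.integral_const_mul]
    calc M * dist u₁ u₂ / L * ∫ t in (0 : ℝ)..x, Real.exp (L * t)
        ≤ M * dist u₁ u₂ / L * (Real.exp (L * x) / L) := by
          gcongr
          exact integral_exp_mul_le hLp
      _ = _ := by ring
  have hcontr : ContractingWith (1 / 2) T := by
    refine ⟨by norm_num, LipschitzWith.of_dist_le_mul fun u₁ u₂ => ?_⟩
    rw [ContinuousMap.dist_le (by positivity)]
    intro x
    have h1 := hdiff u₁ u₂ x x.2
    rw [Real.dist_eq]
    change |Real.exp (-(L * x)) * v u₁ x - Real.exp (-(L * x)) * v u₂ x| ≤ _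
    rw [← mul_sub, abs_mul, Real.abs_exp]
    calc Real.exp (-(L * x)) * |v u₁ x - v u₂ x|
        ≤ Real.exp (-(L * x)) * (M * dist u₁ u₂ / L / L * Real.exp (L * x)) := by gcongr
      _ = M / L / L * dist u₁ u₂ * (Real.exp (-(L * x)) * Real.exp (L * x)) := by ring
      _ = M / L / L * dist u₁ u₂ := by rw [← Real.exp_add]; simp
      _ ≤ ((1 / 2 : NNReal) : ℝ) * dist u₁ u₂ := by
          gcongr
          push_cast
          rw [div_div, div_le_div_iff₀ (by positivity) (by norm_num), hL]
          nlinarith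
  set u := hcontr.fixedPoint T with hu
  have hfix : T u = u := hcontr.fixedPoint_isFixedPt
  have hwv : EqOn (w u) (v u) (Icc 0 ℓ) := by
    intro x hx
    have h1 : IccExtend hℓ u x = Real.exp (-(L * x)) * v u x := by
      conv_lhs => rw [← hfix]
      rw [IccExtend_of_mem _ _ hx]
      rfl
    simp only [hw]
    rw [h1, ← mul_assoc, ← Real.exp_add]
    simp
  -- `w u` agrees with `v u` on [0, ℓ] and, unlike it, is continuous on the whole line by
  -- construction.
  refine ⟨w u, v₁ u, (hvp u).congr hℓ hwv (by simp), hv₁p u, hwc u, ?_, by simp [hv₁]⟩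
  rw [hwv ⟨le_rfl, hℓ⟩]
  simp [hv]

/-- If the homogeneous periodic problem has only the zero solution, then the inhomogeneous problem
is solvable. -/
theorem exists_periodic_solution_of_uniqueness {ℓ : ℝ} (hℓ : 0 ≤ ℓ) {ρ h : ℝ → ℝ}
    (hρ : Continuous ρ) (hh : IntervalIntegrable h volume 0 ℓ)
    (huniq : ∀ v v₁ : ℝ → ℝ, IsPrim ℓ v v₁ → IsPrim ℓ v₁ (fun t => -(ρ t * v t)) → v 0 = v ℓ →
      v₁ 0 = v₁ ℓ → v 0 = 0 ∧ v₁ 0 = 0) :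
    ∃ v v₁ : ℝ → ℝ, IsPrim ℓ v v₁ ∧ IsPrim ℓ v₁ (fun t => -(ρ t * v t + h t)) ∧
      Continuous v ∧ v 0 = v ℓ ∧ v₁ 0 = v₁ ℓ := by
  have h0 : IntervalIntegrable (fun _ : ℝ => (0 : ℝ)) volume 0 ℓ := by simp
  obtain ⟨p, p₁, hp, hp₁, hpc, p0, p10⟩ := exists_initial_value_solution hℓ hρ h0 1 0
  obtain ⟨q, q₁, hq, hq₁, hqc, q0, q10⟩ := exists_initial_value_solution hℓ hρ h0 0 1
  obtain ⟨s, s₁, hs, hs₁, hsc, s0, s10⟩ := exists_initial_value_solution hℓ hρ hh 0 0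
  -- `L` sends the initial data of a homogeneous solution to the jump of (v, v') across the period.
  -- Uniqueness is injectivity of `L`, and in dimension two this is surjectivity, so the jump of the
  -- particular solution can be compensated.
  let L : ℝ × ℝ →ₗ[ℝ] ℝ × ℝ :=
    { toFun := fun a => (a.1 * (p ℓ - 1) + a.2 * q ℓ, a.1 * p₁ ℓ + a.2 * (q₁ ℓ - 1))
      map_add' := fun a b => by ext <;> simp <;> ring
      map_smul' := fun c a => by ext <;> simp <;> ring }
  have hinj : Function.Injective L := by
    refine (injective_iff_map_eq_zero L).2 fun a ha => ?_
    have e1 : a.1 * (p ℓ - 1) + a.2 * q ℓ = 0 := congrArg Prod.fst ha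
    have e2 : a.1 * p₁ ℓ + a.2 * (q₁ ℓ - 1) = 0 := congrArg Prod.snd ha
    have := huniq (fun x => a.1 * p x + a.2 * q x) (fun x => a.1 * p₁ x + a.2 * q₁ x)
      ((hp.const_mul a.1).add (hq.const_mul a.2))
      (((hp₁.const_mul a.1).add (hq₁.const_mul a.2)).congr hℓ (fun _ _ => rfl)
        (Eventually.of_forall fun t _ => by ring))
      (by simp only [p0, q0]; linarith) (by simp only [p10, q10]; linarith)
    simp only [p0, q0, p10, q10] at this
    ext
    · simpa using this.1
    · simpa using this.2
  obtain ⟨a, ha⟩ := (LinearMap.injective_iff_surjective.1 hinj) (-s ℓ, -s₁ ℓ)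
  have e1 : a.1 * (p ℓ - 1) + a.2 * q ℓ = -s ℓ := congrArg Prod.fst ha
  have e2 : a.1 * p₁ ℓ + a.2 * (q₁ ℓ - 1) = -s₁ ℓ := congrArg Prod.snd ha
  refine ⟨fun x => a.1 * p x + a.2 * q x + s x, fun x => a.1 * p₁ x + a.2 * q₁ x + s₁ x,
    ((hp.const_mul a.1).add (hq.const_mul a.2)).add hs,
    (((hp₁.const_mul a.1).add (hq₁.const_mul a.2)).add hs₁).congr hℓ (fun _ _ => rfl)
        (Eventually.of_forall fun t _ => by ring), by fun_prop, ?_, ?_⟩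
  · simp only [p0, q0, s0]; linarith
  · simp only [p10, q10, s10]; linarith

end BoundaryLayers

/-! ### Regular right-hand sides -/

namespace BoundaryLayers

/-- Estimate of the solution for a right-hand side of class `W^{2,1}`: no negative power of `η`
is lost. -/
theorem exists_wkb_estimate_smooth {ℓ m A c : ℝ} (hℓ : 0 < ℓ) (hm : 0 < m) (hc : 0 < c) :
    ∃ C η₁ : ℝ, 0 < C ∧ 0 < η₁ ∧ ∀ (η : ℝ) (q q₁ q₂ r : ℝ → ℝ), 0 < η → η < η₁ →
      IsWKBData ℓ m A η q q₁ q₂ r →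
      c ≤ ‖Complex.exp (Complex.I * phase η q r ℓ) - 1‖ →
      ∀ (v v₁ v₂ h h₁ h₂ : ℝ → ℝ) (M : ℝ), IsPrim ℓ v v₁ → IsPrim ℓ v₁ v₂ → v 0 = v ℓ →
      v₁ 0 = v₁ ℓ → IsPrim ℓ h h₁ → IsPrim ℓ h₁ h₂ → h 0 = h ℓ → h₁ 0 = h₁ ℓ →
      (∀ᵐ t, t ∈ Ioc 0 ℓ → -η ^ 2 * v₂ t - (q t ^ 4 + r t) * v t = h t) →
      (∀ x ∈ Icc 0 ℓ, |h x| ≤ M) → (∀ x ∈ Icc 0 ℓ, |h₁ x| ≤ M) →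
      ∫ t in (0 : ℝ)..ℓ, |h₂ t| ≤ M →
      ∀ x ∈ Icc 0 ℓ, |v x| ≤ C * M ∧ |v₁ x| ≤ C * M := by
  obtain ⟨A₁, η₁, hA₁, hη₁, hb⟩ := exists_wkb_bounds (A := A) hm
  obtain ⟨C, η₂, hC, hη₂, hest⟩ := exists_wkb_estimate (A := A) hℓ hm hc
  obtain ⟨A₂, hA₂, hpoly⟩ : ∃ A₂ : ℝ, 0 < A₂ ∧ ∀ p a b : ℝ, |p| ≤ A₁ → |a| ≤ |A| → |b| ≤ |A| →
      |p ^ 4| ≤ A₂ ∧ |-4 * a * p ^ 5| ≤ A₂ ∧ |-4 * b * p ^ 5 + 20 * a ^ 2 * p ^ 6| ≤ A₂ := by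
    refine ⟨1 + A₁ ^ 4 + 4 * |A| * A₁ ^ 5 + 20 * |A| ^ 2 * A₁ ^ 6, by positivity, ?_⟩
    intro p a b hp ha hb
    have e1 : |p ^ 4| ≤ A₁ ^ 4 := by rw [abs_pow]; gcongr
    have e2 : ∀ a, |a| ≤ |A| → |-4 * a * p ^ 5| ≤ 4 * |A| * A₁ ^ 5 := by
      intro a ha
      rw [abs_mul, abs_mul, abs_pow, abs_neg, abs_of_pos (by norm_num : (0 : ℝ) < 4)]
      gcongr
    have e3 : |20 * a ^ 2 * p ^ 6| ≤ 20 * |A| ^ 2 * A₁ ^ 6 := by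
      rw [abs_mul, abs_mul, abs_pow, abs_pow, abs_of_pos (by norm_num : (0 : ℝ) < 20)]
      gcongr
    have p1 : 0 ≤ A₁ ^ 4 := by positivity
    have p2 : 0 ≤ 4 * |A| * A₁ ^ 5 := by positivity
    have p3 : 0 ≤ 20 * |A| ^ 2 * A₁ ^ 6 := by positivity
    refine ⟨by linarith, by linarith [e2 a ha], ?_⟩
    refine (abs_add_le _ _).trans ?_
    linarith [e2 b hb]
  obtain ⟨A₃, hA₃⟩ : ∃ A₃, ∀ f g : ℝ → ℝ, IsBddLip A₁ f → IsBddLip A₁ g →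
      IsBddLip A₃ (fun x => f x * (g x * (g x * g x))) :=
    ⟨_, fun f g hf hg => hf.mul (hg.mul (hg.mul hg))⟩
  set Γ₀ : ℝ := 2 * |A₃| + 2 * |A₃| * ℓ + A₁ * (A₂ + 3 * A₂ * ℓ) with hΓ₀
  have hΓ₀p : 0 ≤ Γ₀ := by positivity
  set R₀ : ℝ := |A| * A₂ * ℓ + (A₂ + 3 * A₂ * ℓ) with hR₀
  have hR₀p : 0 ≤ R₀ := by positivity
  refine ⟨C * (Γ₀ + R₀) + 2 * A₂, min (min η₁ η₂) 1, by positivity, by positivity, ?_⟩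
  intro η q q₁ q₂ r hη hηlt H hres v v₁ v₂ h h₁ h₂ M hv hv₁ hper hper₁ hh hh₁ hhper hhper₁ heq
    hM hM₁ hM₂
  have hη1 : η < 1 := hηlt.trans_le (min_le_right _ _)
  obtain ⟨hlow, hfr, -, hqi, -, -, -, hr2⟩ := hb ℓ η q q₁ q₂ r hη
    (hηlt.trans_le ((min_le_left _ _).trans (min_le_left _ _))) H
  have hℓ0 := hℓ.le
  have hM0 : 0 ≤ M := (abs_nonneg _).trans (hM 0 ⟨le_rfl, hℓ0⟩)
  have hqp : ∀ x, 0 < q x := fun x => hm.trans_le (H.lower x)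
  have hcq : Continuous q := continuous_iff_continuousAt.2 fun x => (H.hasDerivAt x).continuousAt
  have hcq₁ : Continuous q₁ :=
    continuous_iff_continuousAt.2 fun x => (H.hasDerivAt_deriv x).continuousAt
  have hcq₂ := H.continuous_deriv
  have hci : Continuous fun x => (q x)⁻¹ := hqi.continuous
  have hcr : Continuous r := by
    have e : r = fun x => r x / η * η := by ext x; rw [div_mul_cancel₀ _ hη.ne']
    rw [e]
    exact H.remainder.continuous.mul continuous_const
  set p : ℝ → ℝ := fun x => (q x)⁻¹ ^ 4 with hp
  set p₁ : ℝ → ℝ := fun x => -4 * q₁ x * (q x)⁻¹ ^ 5 with hp₁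
  set p₂ : ℝ → ℝ := fun x => -4 * q₂ x * (q x)⁻¹ ^ 5 + 20 * q₁ x ^ 2 * (q x)⁻¹ ^ 6 with hp₂
  have hdi : ∀ x, HasDerivAt (fun x => (q x)⁻¹) (-q₁ x * (q x)⁻¹ ^ 2) x := by
    intro x
    refine ((H.hasDerivAt x).fun_inv (hqp x).ne').congr_deriv ?_
    rw [div_eq_mul_inv, inv_pow]
  have hP : IsPrim ℓ p p₁ := by
    refine IsPrim.of_hasDerivAt hℓ0 (fun x _ => ?_) (Continuous.continuousOn (by fun_prop))
    refine ((hdi x).fun_pow 4).congr_deriv ?_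
    simp only [hp₁]
    push_cast
    ring
  have hP₁ : IsPrim ℓ p₁ p₂ := by
    refine IsPrim.of_hasDerivAt hℓ0 (fun x _ => ?_) (Continuous.continuousOn (by fun_prop))
    refine (((H.hasDerivAt_deriv x).const_mul (-4)).fun_mul ((hdi x).fun_pow 5)).congr_deriv ?_
    simp only [hp₂]
    push_cast
    ring
  have hpb : ∀ x, |p x| ≤ A₂ ∧ |p₁ x| ≤ A₂ ∧ |p₂ x| ≤ A₂ := fun x =>
    hpoly _ _ _ (hqi.bound x) ((H.bound_deriv x).trans (le_abs_self _))
      ((H.bound_deriv_two x).trans (le_abs_self _))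
  -- To leading order -q⁴v = h, that is v ≈ -h/q⁴. The non-oscillating part is removed by passing to
  -- W = v + ph with p = q⁻⁴, still periodic because h and q are.
  have hW := hv.add (hh.mul hP hℓ0)
  have hW₁ := hv₁.add ((hh₁.mul hP hℓ0).add (hh.mul hP₁ hℓ0))
  set G : ℝ → ℝ := fun x => h₂ x * p x + h₁ x * p₁ x + (h₁ x * p₁ x + h x * p₂ x) with hG
  have hGi : IntervalIntegrable G volume 0 ℓ :=
    ((hh₁.mul hP hℓ0).add (hh.mul hP₁ hℓ0)).integrable
  have hch : ContinuousOn h (uIcc 0 ℓ) := by rw [uIcc_of_le hℓ0]; exact hh.continuousOn hℓ0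
  have hcp : Continuous p := by fun_prop
  -- Right-hand side of the equation for W: the term h cancels against q⁴ph, leaving rph of order η
  -- and η²(ph)''.
  set R : ℝ → ℝ := fun x => -(r x * p x * h x) - η ^ 2 * G x with hR
  have hrph : ContinuousOn (fun x => r x * p x * h x) (uIcc 0 ℓ) :=
    ((hcr.mul hcp).continuousOn).mul hch
  have hRi : IntervalIntegrable R volume 0 ℓ :=
    (hrph.intervalIntegrable.neg).sub (hGi.const_mul _)
  have hWeq : ∀ᵐ t, t ∈ Ioc 0 ℓ → -η ^ 2 * (v₂ t + G t)
      - (q t ^ 4 + r t) * (v t + h t * p t) = R t := by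
    filter_upwards [heq] with t ht hm
    have e := ht hm
    have hqp4 : q t ^ 4 * p t = 1 := by
      simp only [hp]; rw [← mul_pow, mul_inv_cancel₀ (hqp t).ne', one_pow]
    simp only [hR]
    linear_combination e - h t * hqp4
  have hGabs : ∫ t in (0 : ℝ)..ℓ, |G t| ≤ (A₂ + 3 * A₂ * ℓ) * M := by
    have h1 : ∫ t in (0 : ℝ)..ℓ, |G t| ≤ ∫ t in (0 : ℝ)..ℓ, (A₂ * |h₂ t| + 3 * A₂ * M) := by
      refine intervalIntegral.integral_mono_on hℓ0 hGi.abs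
        ((hh₁.integrable.abs.const_mul _).add (by simp)) fun t ht => ?_
      obtain ⟨b0, b1, b2⟩ := hpb t
      have e0 : |h₂ t * p t| ≤ A₂ * |h₂ t| := by
        rw [abs_mul, mul_comm]; gcongr
      have e1 : |h₁ t * p₁ t| ≤ M * A₂ := by
        rw [abs_mul]; exact mul_le_mul (hM₁ t ht) b1 (abs_nonneg _) hM0
      have e2 : |h t * p₂ t| ≤ M * A₂ := by
        rw [abs_mul]; exact mul_le_mul (hM t ht) b2 (abs_nonneg _) hM0
      have t1 := abs_add_le (h₂ t * p t + h₁ t * p₁ t) (h₁ t * p₁ t + h t * p₂ t)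
      have t2 := abs_add_le (h₂ t * p t) (h₁ t * p₁ t)
      have t3 := abs_add_le (h₁ t * p₁ t) (h t * p₂ t)
      simp only [hG]
      linarith
    rw [intervalIntegral.integral_add (hh₁.integrable.abs.const_mul _) (by simp),
      intervalIntegral.integral_const_mul] at h1
    simp only [intervalIntegral.integral_const, sub_zero, smul_eq_mul] at h1
    have : A₂ * ∫ t in (0 : ℝ)..ℓ, |h₂ t| ≤ A₂ * M := by gcongr
    linarith
  have hrb : ∀ x, |r x| ≤ |A| * η := by
    intro x
    have := (H.remainder.bound x).trans (le_abs_self A)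
    rwa [abs_div, abs_of_pos hη, div_le_iff₀ hη] at this
  have hRabs : ∫ t in (0 : ℝ)..ℓ, |R t| ≤ R₀ * η * M := by
    have h1 : ∫ t in (0 : ℝ)..ℓ, |R t| ≤ ∫ t in (0 : ℝ)..ℓ, (|A| * η * A₂ * M + η ^ 2 * |G t|) := by
      refine intervalIntegral.integral_mono_on hℓ0 hRi.abs
        ((by simp : IntervalIntegrable (fun _ : ℝ => |A| * η * A₂ * M) volume 0 ℓ).add
          (hGi.abs.const_mul _)) fun t ht => ?_
      have e0 : |r t * p t * h t| ≤ |A| * η * A₂ * M := by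
        rw [abs_mul, abs_mul]
        have := hrb t
        have := (hpb t).1
        have := hM t ht
        gcongr
      simp only [hR]
      have t1 := abs_sub (-(r t * p t * h t)) (η ^ 2 * G t)
      rw [abs_neg, abs_mul (η ^ 2), abs_of_nonneg (sq_nonneg η)] at t1
      linarith
    rw [intervalIntegral.integral_add (by simp) (hGi.abs.const_mul _),
      intervalIntegral.integral_const, intervalIntegral.integral_const_mul, sub_zero,
      smul_eq_mul] at h1
    have e1 : η ^ 2 * ∫ t in (0 : ℝ)..ℓ, |G t| ≤ η ^ 2 * ((A₂ + 3 * A₂ * ℓ) * M) := by gcongr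
    have e2 : η ^ 2 * ((A₂ + 3 * A₂ * ℓ) * M) ≤ η * ((A₂ + 3 * A₂ * ℓ) * M) := by
      have : η ^ 2 ≤ η := by nlinarith
      gcongr
    calc _ ≤ _ := h1
      _ ≤ ℓ * (|A| * η * A₂ * M) + η * ((A₂ + 3 * A₂ * ℓ) * M) := by linarith
      _ = R₀ * η * M := by rw [hR₀]; ring
  have hφ := fun x => hasDerivAt_phase (η := η) hfr.continuous x
  have hcφ : Continuous (phase η q r) :=
    continuous_iff_continuousAt.2 fun x => (hφ x).continuousAt
  have hcf := hfr.continuous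
  set e : ℝ → ℂ := fun x => Complex.exp (Complex.I * phase η q r x) with he
  have hce : Continuous e := by fun_prop
  have he1 : ∀ t, ‖e t‖ = 1 := fun t => by
    rw [he]; simp only [mul_comm Complex.I]; exact Complex.norm_exp_ofReal_mul_I _
  -- Chosen so that rph/q = η² a h φ'. One factor η comes from r and the other from dividing by φ';
  -- since r/η is Lipschitz, integration by parts is allowed and the oscillatory integral of R is
  -- O(η²), although R itself is only O(η).
  set a : ℝ → ℝ := fun x => r x / η * ((q x)⁻¹ * (q x)⁻¹) * (frequency q r x)⁻¹ *
    ((q x)⁻¹ * ((q x)⁻¹ * (q x)⁻¹)) with ha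
  have hab : IsBddLip |A₃| a := (hA₃ _ _ hr2 hqi).mono (le_abs_self _)
  obtain ⟨a', ha', hab'⟩ := hab.exists_isPrim hℓ0
  have hF := ((ha'.mul hh hℓ0).ofReal).const_mul ((η ^ 2 : ℝ) : ℂ)
  have hΓ : ∀ x ∈ Icc 0 ℓ,
      ‖∫ t in (0 : ℝ)..x, e t * ((R t / q t : ℝ) : ℂ)‖ ≤ Γ₀ * η ^ 2 * M := by
    intro x hx
    have hsx : uIcc 0 x ⊆ uIcc 0 ℓ := by
      rw [uIcc_of_le hx.1, uIcc_of_le hℓ0]; exact Icc_subset_Icc_right hx.2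
    have h1 : ‖∫ t in (0 : ℝ)..x, ((η ^ 2 : ℝ) : ℂ) * ((a t * h t : ℝ) : ℂ)
        * ((frequency q r t / η : ℝ) : ℂ) * e t‖ ≤ 2 * (η ^ 2 * (|A₃| * M)) +
          η ^ 2 * (2 * |A₃| * M) * ℓ := by
      refine norm_oscillatory_integral_le hℓ0 hF (fun x hx => ?_) ?_ hφ (by fun_prop) hx
      · rw [norm_mul, Complex.norm_real, Complex.norm_real, Real.norm_eq_abs, Real.norm_eq_abs,
          abs_of_nonneg (sq_nonneg η), abs_mul]
        have := hab.bound x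
        have := hM x hx
        gcongr
      · refine intervalIntegral_norm_le_of_ae hℓ0 ?_
        filter_upwards [hab'] with t ht hmem
        have htI : t ∈ Icc 0 ℓ := ⟨hmem.1.le, hmem.2⟩
        rw [norm_mul, Complex.norm_real, Complex.norm_real, Real.norm_eq_abs, Real.norm_eq_abs,
          abs_of_nonneg (sq_nonneg η)]
        have e1 : |a' t * h t| ≤ |A₃| * M := by
          rw [abs_mul]; exact mul_le_mul (ht hmem) (hM t htI) (abs_nonneg _) (abs_nonneg _)
        have e2 : |a t * h₁ t| ≤ |A₃| * M := by
          rw [abs_mul]; exact mul_le_mul (hab.bound t) (hM₁ t htI) (abs_nonneg _) (abs_nonneg _)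
        have e3 := abs_add_le (a' t * h t) (a t * h₁ t)
        have : |a' t * h t + a t * h₁ t| ≤ 2 * |A₃| * M := by linarith
        gcongr
    have i1 : IntervalIntegrable (fun t => ((η ^ 2 : ℝ) : ℂ) * ((a t * h t : ℝ) : ℂ)
        * ((frequency q r t / η : ℝ) : ℂ) * e t) volume 0 x := by
      refine ContinuousOn.intervalIntegrable ?_
      have c1 : ContinuousOn (fun t => a t * h t) (uIcc 0 x) :=
        (hab.continuous.continuousOn).mul (hch.mono hsx)
      have c2 : ContinuousOn (fun t => ((a t * h t : ℝ) : ℂ)) (uIcc 0 x) :=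
        Complex.continuous_ofReal.comp_continuousOn c1
      exact ((continuousOn_const.mul c2).mul (Continuous.continuousOn (by fun_prop))).mul
        hce.continuousOn
    have i0 : IntervalIntegrable (fun t => η ^ 2 * (G t * (q t)⁻¹)) volume 0 x :=
      ((hGi.mono_set hsx).mul_continuousOn hci.continuousOn).const_mul _
    have i2 : IntervalIntegrable (fun t => ((η ^ 2 * (G t * (q t)⁻¹) : ℝ) : ℂ) * e t)
        volume 0 x :=
      IntervalIntegrable.mul_continuousOn ⟨i0.1.ofReal, i0.2.ofReal⟩ hce.continuousOn
    have h2 : ‖∫ t in (0 : ℝ)..x, ((η ^ 2 * (G t * (q t)⁻¹) : ℝ) : ℂ) * e t‖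
        ≤ η ^ 2 * (A₁ * ((A₂ + 3 * A₂ * ℓ) * M)) := by
      have h3 : ‖∫ t in (0 : ℝ)..x, ((η ^ 2 * (G t * (q t)⁻¹) : ℝ) : ℂ) * e t‖
          ≤ ∫ t in (0 : ℝ)..x, η ^ 2 * A₁ * |G t| := by
        refine intervalIntegral.norm_integral_le_of_norm_le hx.1
          (Eventually.of_forall fun t ht => ?_) ((hGi.mono_set hsx).abs.const_mul _)
        rw [norm_mul, he1, mul_one, Complex.norm_real, Real.norm_eq_abs, abs_mul,
          abs_of_nonneg (sq_nonneg η), abs_mul, mul_assoc, mul_comm |G t|]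
        have := hqi.bound t
        gcongr
      have h4 : ∫ t in (0 : ℝ)..x, |G t| ≤ ∫ t in (0 : ℝ)..ℓ, |G t| :=
        intervalIntegral.integral_mono_interval le_rfl hx.1 hx.2
          (Eventually.of_forall fun _ => abs_nonneg _) hGi.abs
      rw [intervalIntegral.integral_const_mul] at h3
      refine h3.trans ?_
      rw [mul_assoc]
      gcongr
      exact h4.trans hGabs
    have e1 : ∀ t, e t * ((R t / q t : ℝ) : ℂ) = -(((η ^ 2 : ℝ) : ℂ) * ((a t * h t : ℝ) : ℂ)
        * ((frequency q r t / η : ℝ) : ℂ) * e t + ((η ^ 2 * (G t * (q t)⁻¹) : ℝ) : ℂ) * e t) := by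
      intro t
      have hf0 : frequency q r t ≠ 0 :=
        (lt_of_lt_of_le (by positivity) (hlow t)).ne'
      have hq0 := (hqp t).ne'
      have hη0 := hη.ne'
      have e2 : R t / q t = -(η ^ 2 * (a t * h t) * (frequency q r t / η)
          + η ^ 2 * (G t * (q t)⁻¹)) := by
        simp only [hR, ha, hp]
        field_simp
        ring
      rw [e2]
      push_cast
      ring
    simp only [e1]
    rw [intervalIntegral.integral_neg, norm_neg, intervalIntegral.integral_add i1 i2]
    refine (norm_add_le _ _).trans ((add_le_add h1 h2).trans (le_of_eq ?_))
    rw [hΓ₀]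
    ring
  have hfin := hest η q q₁ q₂ r hη (hηlt.trans_le ((min_le_left _ _).trans (min_le_right _ _))) H
    hres _ _ _ R _ hW hW₁ (by simp only [hp, H.periodic, hper, hhper])
    (by simp only [hp, hp₁, H.periodic, H.periodic_deriv, hper₁, hhper, hhper₁]) hRi hWeq hΓ
  have hX : Γ₀ * η ^ 2 * M / η + ∫ t in (0 : ℝ)..ℓ, |R t| ≤ (Γ₀ + R₀) * M * η := by
    have : Γ₀ * η ^ 2 * M / η = Γ₀ * M * η := by field_simp
    rw [this]
    linarith
  intro x hx
  obtain ⟨f1, f2⟩ := hfin x hx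
  have hCX := mul_le_mul_of_nonneg_left hX hC.le
  have g0 : |h x * p x| ≤ A₂ * M := by
    rw [abs_mul, mul_comm]
    exact mul_le_mul (hpb x).1 (hM x hx) (abs_nonneg _) hA₂.le
  have g1 : |h₁ x * p x| ≤ A₂ * M := by
    rw [abs_mul, mul_comm]
    exact mul_le_mul (hpb x).1 (hM₁ x hx) (abs_nonneg _) hA₂.le
  have g2 : |h x * p₁ x| ≤ A₂ * M := by
    rw [abs_mul, mul_comm]
    exact mul_le_mul (hpb x).2.1 (hM x hx) (abs_nonneg _) hA₂.le
  constructor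
  · have e1 : |v x| ≤ |v x + h x * p x| + |h x * p x| := by
      simpa using abs_sub (v x + h x * p x) (h x * p x)
    have e2 : C * ((Γ₀ + R₀) * M * η) ≤ C * ((Γ₀ + R₀) * M * 1) := by gcongr
    have e3 : 0 ≤ A₂ * M := by positivity
    linarith
  -- The general estimate controls η W', and its right side is here O(η); cancelling η bounds W'
  -- itself.
  · have e1 : |v₁ x| ≤ |v₁ x + (h₁ x * p x + h x * p₁ x)| + |h₁ x * p x + h x * p₁ x| := by
      simpa using abs_sub (v₁ x + (h₁ x * p x + h x * p₁ x)) (h₁ x * p x + h x * p₁ x)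
    have e2 := abs_add_le (h₁ x * p x) (h x * p₁ x)
    have e3 : |v₁ x + (h₁ x * p x + h x * p₁ x)| ≤ C * ((Γ₀ + R₀) * M) := by
      have := f2.trans hCX
      have h5 : η * |v₁ x + (h₁ x * p x + h x * p₁ x)| ≤ η * (C * ((Γ₀ + R₀) * M)) := by linarith
      exact le_of_mul_le_mul_left h5 hη
    linarith

end BoundaryLayers

namespace BoundaryLayers

/-! ### Norms on `(0, ℓ)` -/

instance (ℓ : ℝ) : IsFiniteMeasure (intervalMeasure ℓ) := by
  unfold intervalMeasure; infer_instance

theorem intervalMeasure_univ (ℓ : ℝ) : intervalMeasure ℓ univ = ENNReal.ofReal ℓ := by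
  simp [intervalMeasure]

theorem ae_intervalMeasure_iff {ℓ : ℝ} {p : ℝ → Prop} :
    (∀ᵐ t ∂(intervalMeasure ℓ), p t) ↔ ∀ᵐ t, t ∈ Ioc 0 ℓ → p t := by
  rw [intervalMeasure, restrict_Ioo_eq_restrict_Ioc, ae_restrict_iff' measurableSet_Ioc]

theorem intervalIntegrable_of_memLp {ℓ : ℝ} (hℓ : 0 ≤ ℓ) {h : ℝ → ℝ}
    (hh : MemLp h 2 (intervalMeasure ℓ)) : IntervalIntegrable h volume 0 ℓ := by
  have := hh.integrable (by norm_num)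
  rw [intervalMeasure, restrict_Ioo_eq_restrict_Ioc] at this
  exact (intervalIntegrable_iff_integrableOn_Ioc_of_le hℓ).2 this

theorem integral_abs_le_normL2 {ℓ : ℝ} (hℓ : 0 ≤ ℓ) {h : ℝ → ℝ}
    (hh : MemLp h 2 (intervalMeasure ℓ)) :
    ∫ t in (0 : ℝ)..ℓ, |h t| ≤ √ℓ * normL2 ℓ h := by
  have h1 : ∫ t in (0 : ℝ)..ℓ, |h t| = (eLpNorm h 1 (intervalMeasure ℓ)).toReal := by
    rw [eLpNorm_one_eq_lintegral_enorm, intervalIntegral.integral_of_le hℓ,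
      ← restrict_Ioo_eq_restrict_Ioc]
    exact integral_norm_eq_lintegral_enorm hh.1
  have h2 := eLpNorm_le_eLpNorm_mul_rpow_measure_univ (μ := intervalMeasure ℓ)
    (p := 1) (q := 2) (by norm_num) hh.1
  rw [h1, normL2, mul_comm]
  refine (ENNReal.toReal_mono (ENNReal.mul_ne_top hh.2.ne ?_) h2).trans (le_of_eq ?_)
  · exact ENNReal.rpow_ne_top_of_nonneg (by norm_num) (measure_ne_top _ _)
  · rw [ENNReal.toReal_mul, intervalMeasure_univ, ← ENNReal.toReal_rpow,
      ENNReal.toReal_ofReal hℓ, Real.sqrt_eq_rpow]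
    norm_num

theorem normL2_le_of_bound {ℓ M : ℝ} (hℓ : 0 ≤ ℓ) {f : ℝ → ℝ}
    (h : ∀ t ∈ Icc 0 ℓ, |f t| ≤ M) : normL2 ℓ f ≤ √ℓ * M := by
  have hM : 0 ≤ M := (abs_nonneg _).trans (h 0 ⟨le_rfl, hℓ⟩)
  have h1 : ∀ᵐ t ∂(intervalMeasure ℓ), ‖f t‖ ≤ M := ae_intervalMeasure_iff.2
    (Eventually.of_forall fun t ht => h t ⟨ht.1.le, ht.2⟩)
  have h2 := eLpNorm_le_of_ae_bound (p := 2) h1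
  rw [intervalMeasure_univ] at h2
  refine (ENNReal.toReal_mono (ENNReal.mul_ne_top ?_ ENNReal.ofReal_ne_top) h2).trans (le_of_eq ?_)
  · exact ENNReal.rpow_ne_top_of_nonneg (by norm_num) ENNReal.ofReal_ne_top
  · rw [ENNReal.toReal_mul, ← ENNReal.toReal_rpow, ENNReal.toReal_ofReal hℓ,
      ENNReal.toReal_ofReal hM, Real.sqrt_eq_rpow]
    norm_num

theorem normLinf_le_of_bound {ℓ M : ℝ} (hℓ : 0 ≤ ℓ) {f : ℝ → ℝ}
    (h : ∀ t ∈ Icc 0 ℓ, |f t| ≤ M) : normLinf ℓ f ≤ M := by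
  have hM : 0 ≤ M := (abs_nonneg _).trans (h 0 ⟨le_rfl, hℓ⟩)
  have h1 : ∀ᵐ t ∂(intervalMeasure ℓ), ‖f t‖ ≤ M := ae_intervalMeasure_iff.2
    (Eventually.of_forall fun t ht => h t ⟨ht.1.le, ht.2⟩)
  have h2 := eLpNorm_le_of_ae_bound (p := ⊤) h1
  refine (ENNReal.toReal_mono (by simp) h2).trans ?_
  simp [hM]

theorem normL2_nonneg (ℓ : ℝ) (f : ℝ → ℝ) : 0 ≤ normL2 ℓ f := ENNReal.toReal_nonneg

theorem memLp_of_continuousOn {ℓ : ℝ} {f : ℝ → ℝ} (hf : ContinuousOn f (Icc 0 ℓ)) :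
    MemLp f 2 (intervalMeasure ℓ) := by
  obtain ⟨C, hC⟩ := isCompact_Icc.exists_bound_of_continuousOn hf
  refine MemLp.of_bound ?_ C (ae_intervalMeasure_iff.2
    (Eventually.of_forall fun t ht => hC t ⟨ht.1.le, ht.2⟩))
  rw [intervalMeasure]
  exact (hf.mono Ioo_subset_Icc_self).aestronglyMeasurable measurableSet_Ioo

theorem IsH2.isPrim_deriv {ℓ : ℝ} {v v₁ v₂ : ℝ → ℝ} (h : IsH2 ℓ v v₁ v₂) (hℓ : 0 ≤ ℓ) :
    IsPrim ℓ v₁ v₂ :=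
  ⟨intervalIntegrable_of_memLp hℓ h.memLp, h.first⟩

theorem IsH2.isPrim {ℓ : ℝ} {v v₁ v₂ : ℝ → ℝ} (h : IsH2 ℓ v v₁ v₂) (hℓ : 0 ≤ ℓ) :
    IsPrim ℓ v v₁ :=
  ⟨ContinuousOn.intervalIntegrable
    (by rw [uIcc_of_le hℓ]; exact (h.isPrim_deriv hℓ).continuousOn hℓ), h.zeroth⟩

/-- A one-dimensional Sobolev inequality. -/
theorem IsPrim.abs_le {ℓ : ℝ} (hℓ : 0 < ℓ) {f f' : ℝ → ℝ} (hf : IsPrim ℓ f f') {x : ℝ}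
    (hx : x ∈ Icc 0 ℓ) :
    |f x| ≤ (∫ t in (0 : ℝ)..ℓ, |f t|) / ℓ + 2 * ∫ t in (0 : ℝ)..ℓ, |f' t| := by
  -- Comparing |f x| with every |f t| and averaging over t.
  have h1 : ∀ t ∈ Icc 0 ℓ, |f x| - 2 * (∫ t in (0 : ℝ)..ℓ, |f' t|) ≤ |f t| := by
    intro t ht
    have e1 := hf.norm_sub_le hx
    have e2 := hf.norm_sub_le ht
    simp only [Real.norm_eq_abs] at e1 e2
    have e3 : |f x| ≤ |f x - f 0| + |f t - f 0| + |f t| := by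
      have : f x = (f x - f 0) - (f t - f 0) + f t := by ring
      conv_lhs => rw [this]
      exact (abs_add_le _ _).trans (add_le_add (abs_sub _ _) le_rfl)
    linarith
  have hc : ContinuousOn f (uIcc 0 ℓ) := by rw [uIcc_of_le hℓ.le]; exact hf.continuousOn hℓ.le
  have h2 := intervalIntegral.integral_mono_on (μ := volume) hℓ.le intervalIntegrable_const hc.abs.intervalIntegrable h1
  rw [intervalIntegral.integral_const, sub_zero, smul_eq_mul] at h2
  have h3 : |f x| - 2 * (∫ t in (0 : ℝ)..ℓ, |f' t|) ≤ (∫ t in (0 : ℝ)..ℓ, |f t|) / ℓ := by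
    rw [le_div_iff₀ hℓ]; linarith
  linarith

theorem normH2_bounds (ℓ : ℝ) (h h₁ h₂ : ℝ → ℝ) :
    normL2 ℓ h ≤ normH2 ℓ h h₁ h₂ ∧ normL2 ℓ h₁ ≤ normH2 ℓ h h₁ h₂ ∧
      normL2 ℓ h₂ ≤ normH2 ℓ h h₁ h₂ := by
  have a := sq_nonneg (normL2 ℓ h)
  have b := sq_nonneg (normL2 ℓ h₁)
  have c := sq_nonneg (normL2 ℓ h₂)
  refine ⟨?_, ?_, ?_⟩ <;> exact Real.le_sqrt_of_sq_le (by linarith)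

/-! ### The scalar periodic problem -/

set_option maxHeartbeats 1000000 in
/-- Unique solvability and estimates for one scalar equation, away from resonance. -/
theorem exists_scalar_estimate {ℓ m A c : ℝ} (hℓ : 0 < ℓ) (hm : 0 < m) (hc : 0 < c)
    (hκ : 0 < gammaZero) :
    ∃ C s₁ : ℝ, 0 < C ∧ 0 < s₁ ∧ ∀ (s : ℝ) (q q₁ q₂ r ρ : ℝ → ℝ), 0 < s → s < s₁ →
      IsWKBData ℓ m A (s * √gammaZero) q q₁ q₂ r → (∀ x, ρ x = q x ^ 4 + r x) →
      c ≤ ‖Complex.exp (Complex.I * phase (s * √gammaZero) q r ℓ) - 1‖ →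
      ∀ h : ℝ → ℝ, MemLp h 2 (intervalMeasure ℓ) →
      (∃ v v₁ v₂, IsPeriodicSolution ℓ (s ^ 2) ρ h v v₁ v₂) ∧
      (∀ v v₁ v₂ w w₁ w₂, IsPeriodicSolution ℓ (s ^ 2) ρ h v v₁ v₂ →
        IsPeriodicSolution ℓ (s ^ 2) ρ h w w₁ w₂ → EqOn v w (Icc 0 ℓ)) ∧
      (∀ v v₁ v₂, IsPeriodicSolution ℓ (s ^ 2) ρ h v v₁ v₂ →
        s ^ 2 * normL2 ℓ v₂ + s * normL2 ℓ v₁ + normLinf ℓ v ≤ C * (1 / s) * normL2 ℓ h ∧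
        ∀ h₁ h₂, IsPeriodicH2 ℓ h h₁ h₂ →
          s ^ 2 * normL2 ℓ v₂ + normL2 ℓ v₁ + normLinf ℓ v ≤ C * normH2 ℓ h h₁ h₂) := by
  obtain ⟨C₁, η₁, hC₁, hη₁, hest⟩ := exists_wkb_estimate (A := A) hℓ hm hc
  obtain ⟨C₂, η₂, hC₂, hη₂, hests⟩ := exists_wkb_estimate_smooth (A := A) hℓ hm hc
  set κ := √gammaZero with hκdef
  have hκ0 : 0 < κ := Real.sqrt_pos.2 hκ
  have hκ2 : κ ^ 2 = gammaZero := Real.sq_sqrt hκ.le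
  have hℓ0 := hℓ.le
  set L := √ℓ with hL
  have hL0 : 0 < L := Real.sqrt_pos.2 hℓ
  -- pointwise bound of the solution in terms of the `L²` norm
  set D₁ : ℝ := C₁ * (1 / m + κ) * L / κ with hD₁
  have hD₁0 : 0 < D₁ := by positivity
  -- Sobolev constant
  set S : ℝ := L / ℓ + 2 * L with hS
  have hS0 : 0 < S := by positivity
  set D₂ : ℝ := C₂ * S with hD₂
  have hD₂0 : 0 < D₂ := by positivity
  set a : ℝ := |A| ^ 4 + |A| * κ with ha
  have ha0 : 0 ≤ a := by positivity
  -- The first three terms serve the L² estimate, the bracket the H² estimate; in each, the summands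
  -- bound v'', v' and v.
  refine ⟨(L * (a * D₁) + 1) / gammaZero + L * D₁ / κ + D₁
      + ((L * (a * D₂) + 1) / gammaZero + L * D₂ + D₂), min 1 (min (η₁ / κ) (η₂ / κ)),
    by positivity, by positivity, ?_⟩
  intro s q q₁ q₂ r ρ hs hslt H hρ hres
  have hs1 : s < 1 := hslt.trans_le (min_le_left _ _)
  have hη : 0 < s * κ := by positivity
  have hη1 : s * κ < η₁ := by
    rw [← lt_div_iff₀ hκ0]
    exact hslt.trans_le ((min_le_right _ _).trans (min_le_left _ _))
  have hη2 : s * κ < η₂ := by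
    rw [← lt_div_iff₀ hκ0]
    exact hslt.trans_le ((min_le_right _ _).trans (min_le_right _ _))
  have hηsq : (s * κ) ^ 2 = s ^ 2 * gammaZero := by rw [mul_pow, hκ2]
  have hqp : ∀ x, 0 < q x := fun x => hm.trans_le (H.lower x)
  have hcq : Continuous q := continuous_iff_continuousAt.2 fun x => (H.hasDerivAt x).continuousAt
  have hcr : Continuous r := by
    have e : r = fun x => r x / (s * κ) * (s * κ) := by
      ext x; rw [div_mul_cancel₀ _ hη.ne']
    rw [e]
    exact H.remainder.continuous.mul continuous_const
  have hcρ : Continuous ρ := by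
    have : ρ = fun x => q x ^ 4 + r x := funext hρ
    rw [this]; fun_prop
  have hρb : ∀ x, |ρ x| ≤ a := by
    intro x
    have e1 : |r x| ≤ |A| * κ := by
      have := (H.remainder.bound x).trans (le_abs_self A)
      rw [abs_div, abs_of_pos hη, div_le_iff₀ hη] at this
      refine this.trans ?_
      have : s * κ ≤ 1 * κ := by gcongr
      gcongr
      linarith
    have e2 : |q x ^ 4| ≤ |A| ^ 4 := by
      rw [abs_pow]
      have := (H.bound x).trans (le_abs_self A)
      gcongr
    rw [hρ]
    exact (abs_add_le _ _).trans (add_le_add e2 e1)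
  -- the basic pointwise estimate
  have hpt : ∀ v v₁ v₂ h : ℝ → ℝ, IsPrim ℓ v v₁ → IsPrim ℓ v₁ v₂ → v 0 = v ℓ → v₁ 0 = v₁ ℓ →
      IntervalIntegrable h volume 0 ℓ →
      (∀ᵐ t, t ∈ Ioc 0 ℓ → -(s * κ) ^ 2 * v₂ t - ρ t * v t = h t) → ∀ x ∈ Icc 0 ℓ,
      |v x| ≤ C₁ * (1 / m + κ) / (s * κ) * (∫ t in (0 : ℝ)..ℓ, |h t|) ∧
      s * κ * |v₁ x| ≤ C₁ * (1 / m + κ) / (s * κ) * (∫ t in (0 : ℝ)..ℓ, |h t|) := by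
    intro v v₁ v₂ h hv hv₁ hper hper₁ hh heq x hx
    have hI0 : 0 ≤ ∫ t in (0 : ℝ)..ℓ, |h t| :=
      intervalIntegral.integral_nonneg hℓ0 fun t _ => abs_nonneg _
    -- For merely square integrable h no oscillation is exploited; the resulting Γ/η is where the
    -- factor 1/s is lost.
    have hΓ : ∀ x ∈ Icc 0 ℓ, ‖∫ t in (0 : ℝ)..x,
        Complex.exp (Complex.I * phase (s * κ) q r t) * ((h t / q t : ℝ) : ℂ)‖
          ≤ 1 / m * ∫ t in (0 : ℝ)..ℓ, |h t| := by
      intro x hx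
      have hsx : uIcc 0 x ⊆ uIcc 0 ℓ := by
        rw [uIcc_of_le hx.1, uIcc_of_le hℓ0]; exact Icc_subset_Icc_right hx.2
      have h1 : ‖∫ t in (0 : ℝ)..x,
          Complex.exp (Complex.I * phase (s * κ) q r t) * ((h t / q t : ℝ) : ℂ)‖
            ≤ ∫ t in (0 : ℝ)..x, 1 / m * |h t| := by
        refine intervalIntegral.norm_integral_le_of_norm_le hx.1
          (Eventually.of_forall fun t _ => ?_) ((hh.mono_set hsx).abs.const_mul _)
        rw [norm_mul, mul_comm Complex.I, Complex.norm_exp_ofReal_mul_I, one_mul,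
          Complex.norm_real, Real.norm_eq_abs, abs_div, abs_of_pos (hqp t), div_eq_inv_mul, one_div]
        have := H.lower t
        gcongr
      rw [intervalIntegral.integral_const_mul] at h1
      refine h1.trans ?_
      gcongr
      exact intervalIntegral.integral_mono_interval le_rfl hx.1 hx.2
          (Eventually.of_forall fun _ => abs_nonneg _) hh.abs
    have h1 := hest (s * κ) q q₁ q₂ r hη hη1 H hres v v₁ v₂ h _ hv hv₁ hper hper₁ hh
      (by filter_upwards [heq] with t ht hm; rw [← hρ]; exact ht hm) hΓ x hx
    have h2 : C₁ * (1 / m * (∫ t in (0 : ℝ)..ℓ, |h t|) / (s * κ) + ∫ t in (0 : ℝ)..ℓ, |h t|)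
        ≤ C₁ * (1 / m + κ) / (s * κ) * (∫ t in (0 : ℝ)..ℓ, |h t|) := by
      have e : C₁ * (1 / m + κ) / (s * κ) * (∫ t in (0 : ℝ)..ℓ, |h t|)
          = C₁ * (1 / m * (∫ t in (0 : ℝ)..ℓ, |h t|) / (s * κ)
            + 1 / s * ∫ t in (0 : ℝ)..ℓ, |h t|) := by
        field_simp
      rw [e]
      have : 1 ≤ 1 / s := by rw [le_div_iff₀ hs]; linarith
      gcongr
      nlinarith
    exact ⟨h1.1.trans h2, h1.2.trans h2⟩
  have hsol : ∀ h v v₁ v₂ : ℝ → ℝ, IsPeriodicSolution ℓ (s ^ 2) ρ h v v₁ v₂ →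
      ∀ᵐ t, t ∈ Ioc 0 ℓ → -(s * κ) ^ 2 * v₂ t - ρ t * v t = h t := by
    intro h v v₁ v₂ hv
    filter_upwards [ae_intervalMeasure_iff.1 hv.equation] with t ht hm
    rw [← ht hm, hηsq]
    ring
  have hzero : ∀ v v₁ v₂ : ℝ → ℝ, IsPrim ℓ v v₁ → IsPrim ℓ v₁ v₂ → v 0 = v ℓ → v₁ 0 = v₁ ℓ →
      (∀ᵐ t, t ∈ Ioc 0 ℓ → -(s * κ) ^ 2 * v₂ t - ρ t * v t = 0) → ∀ x ∈ Icc 0 ℓ,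
      v x = 0 ∧ v₁ x = 0 := by
    intro v v₁ v₂ hv hv₁ hper hper₁ heq x hx
    have := hpt v v₁ v₂ (fun _ => 0) hv hv₁ hper hper₁ (by simp) heq x hx
    simp only [abs_zero, intervalIntegral.integral_zero, mul_zero] at this
    refine ⟨abs_nonpos_iff.1 this.1, abs_nonpos_iff.1 ?_⟩
    by_contra hcon
    rw [not_le] at hcon
    have := mul_pos hη hcon
    linarith
  intro h hh
  have hhi := intervalIntegrable_of_memLp hℓ0 hh
  refine ⟨?_, ?_, ?_⟩
  · -- existence
    obtain ⟨v, v₁, hv, hv₁, hvc, hper, hper₁⟩ := exists_periodic_solution_of_uniqueness hℓ0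
      (ρ := fun t => ρ t / (s * κ) ^ 2) (h := fun t => h t / (s * κ) ^ 2) (hcρ.div_const _)
      (hhi.div_const _) (by
        intro v v₁ hv hv₁ hper hper₁
        refine hzero v v₁ _ hv hv₁ hper hper₁ (Eventually.of_forall fun t _ => ?_) 0 ⟨le_rfl, hℓ0⟩
        have := hη.ne'
        field_simp
        ring)
    refine ⟨v, v₁, _, ⟨⟨⟨?_, hv₁.eq, hv.eq⟩, hper, hper₁⟩, ?_⟩⟩
    · have h1 : MemLp (fun t => ρ t / (s * κ) ^ 2 * v t) 2 (intervalMeasure ℓ) :=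
        memLp_of_continuousOn (Continuous.continuousOn (by fun_prop))
      have h2 : MemLp (fun t => h t / (s * κ) ^ 2) 2 (intervalMeasure ℓ) := by
        simpa [div_eq_inv_mul] using hh.const_mul (((s * κ) ^ 2)⁻¹)
      exact (h1.add h2).neg
    · refine Eventually.of_forall fun t => ?_
      have := hη.ne'
      have e : -s ^ 2 * gammaZero = -(s * κ) ^ 2 := by rw [hηsq]; ring
      rw [e]
      field_simp
      ring
  · -- uniqueness
    intro v v₁ v₂ w w₁ w₂ hv hw x hx
    have hv' := hv.isPeriodicH2
    have hw' := hw.isPeriodicH2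
    have := hzero _ _ _ ((hv'.isH2.isPrim hℓ0).sub (hw'.isH2.isPrim hℓ0))
      ((hv'.isH2.isPrim_deriv hℓ0).sub (hw'.isH2.isPrim_deriv hℓ0))
      (by rw [hv'.periodic, hw'.periodic]) (by rw [hv'.periodic_deriv, hw'.periodic_deriv])
      (by
        filter_upwards [hsol _ _ _ _ hv, hsol _ _ _ _ hw] with t h1 h2 hm
        linear_combination h1 hm - h2 hm) x hx
    exact sub_eq_zero.1 this.1
  · intro v v₁ v₂ hv
    have hv' := hv.isPeriodicH2
    have hpv := hv'.isH2.isPrim hℓ0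
    have hpv₁ := hv'.isH2.isPrim_deriv hℓ0
    have heqv := hsol _ _ _ _ hv
    have hN0 := normL2_nonneg ℓ h
    -- the equation controls the second derivative
    have hsecond : ∀ M, (∀ x ∈ Icc 0 ℓ, |v x| ≤ M) →
        s ^ 2 * normL2 ℓ v₂ ≤ (L * (a * M) + normL2 ℓ h) / gammaZero := by
      intro M hM
      have hM0 : 0 ≤ M := (abs_nonneg _).trans (hM 0 ⟨le_rfl, hℓ0⟩)
      have hρv : MemLp (fun t => ρ t * v t) 2 (intervalMeasure ℓ) :=
        memLp_of_continuousOn (hcρ.continuousOn.mul (hpv.continuousOn hℓ0))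
      have e1 : (fun t => (s * κ) ^ 2 * v₂ t) =ᵐ[intervalMeasure ℓ]
          -((fun t => ρ t * v t) + h) := by
        refine ae_intervalMeasure_iff.2 ?_
        filter_upwards [heqv] with t ht hm
        have := ht hm
        simp only [Pi.neg_apply, Pi.add_apply]
        linarith
      have e2 : (s * κ) ^ 2 * normL2 ℓ v₂ = normL2 ℓ ((fun t => ρ t * v t) + h) := by
        rw [normL2, normL2, ← eLpNorm_neg (f := (fun t => ρ t * v t) + h), ← eLpNorm_congr_ae e1]
        have : (fun t => (s * κ) ^ 2 * v₂ t) = (s * κ) ^ 2 • v₂ := by ext t; simp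
        rw [this, eLpNorm_const_smul, ENNReal.toReal_mul]
        simp [abs_of_pos hs, abs_of_pos hκ0]
      have e3 : normL2 ℓ ((fun t => ρ t * v t) + h) ≤ normL2 ℓ (fun t => ρ t * v t) + normL2 ℓ h := by
        rw [normL2, normL2, normL2, ← ENNReal.toReal_add hρv.2.ne hh.2.ne]
        exact ENNReal.toReal_mono (ENNReal.add_ne_top.2 ⟨hρv.2.ne, hh.2.ne⟩)
          (eLpNorm_add_le hρv.1 hh.1 (by norm_num))
      have e4 : normL2 ℓ (fun t => ρ t * v t) ≤ L * (a * M) := by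
        refine normL2_le_of_bound hℓ0 fun t ht => ?_
        rw [abs_mul]
        exact mul_le_mul (hρb t) (hM t ht) (abs_nonneg _) ha0
      rw [le_div_iff₀ hκ]
      rw [hηsq] at e2
      linarith
    refine ⟨?_, ?_⟩
    · have hb : ∀ x ∈ Icc 0 ℓ, |v x| ≤ D₁ * (1 / s) * normL2 ℓ h ∧
          |v₁ x| ≤ D₁ * (1 / s) * normL2 ℓ h / (s * κ) := by
        intro x hx
        obtain ⟨f1, f2⟩ := hpt v v₁ v₂ h hpv hpv₁ hv'.periodic hv'.periodic_deriv hhi heqv x hx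
        have f3 : C₁ * (1 / m + κ) / (s * κ) * (∫ t in (0 : ℝ)..ℓ, |h t|)
            ≤ D₁ * (1 / s) * normL2 ℓ h := by
          have e : D₁ * (1 / s) * normL2 ℓ h
              = C₁ * (1 / m + κ) / (s * κ) * (L * normL2 ℓ h) := by
            rw [hD₁]; field_simp
          rw [e]
          have := integral_abs_le_normL2 hℓ0 hh
          gcongr
        refine ⟨f1.trans f3, ?_⟩
        rw [le_div_iff₀ hη]
        linarith
      have g1 := hsecond _ fun x hx => (hb x hx).1
      have g2 := normL2_le_of_bound hℓ0 fun x hx => (hb x hx).2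
      have g3 := normLinf_le_of_bound hℓ0 fun x hx => (hb x hx).1
      have g4 : normL2 ℓ h ≤ 1 / s * normL2 ℓ h := by
        have : 1 ≤ 1 / s := by rw [le_div_iff₀ hs]; linarith
        nlinarith
      have g5 : s * normL2 ℓ v₁ ≤ L * D₁ / κ * (1 / s) * normL2 ℓ h := by
        have : s * (L * (D₁ * (1 / s) * normL2 ℓ h / (s * κ)))
            = L * D₁ / κ * (1 / s) * normL2 ℓ h := by
          field_simp
        rw [← this]
        gcongr
      have g6 : (L * (a * (D₁ * (1 / s) * normL2 ℓ h)) + normL2 ℓ h) / gammaZero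
          ≤ (L * (a * D₁) + 1) / gammaZero * (1 / s) * normL2 ℓ h := by
        have : (L * (a * D₁) + 1) / gammaZero * (1 / s) * normL2 ℓ h
          = (L * (a * (D₁ * (1 / s) * normL2 ℓ h)) + 1 / s * normL2 ℓ h) / gammaZero := by ring
        rw [this]
        gcongr
      have g7 : 0 ≤ ((L * (a * D₂) + 1) / gammaZero + L * D₂ + D₂) * (1 / s) * normL2 ℓ h := by
        positivity
      linarith
    · intro h₁ h₂ hH
      obtain ⟨n0, n1, n2⟩ := normH2_bounds ℓ h h₁ h₂
      set X := normH2 ℓ h h₁ h₂ with hX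
      have hX0 : 0 ≤ X := hN0.trans n0
      have ph := hH.isH2.isPrim hℓ0
      have ph₁ := hH.isH2.isPrim_deriv hℓ0
      have i0 := integral_abs_le_normL2 hℓ0 hh
      have i1 := integral_abs_le_normL2 hℓ0 (memLp_of_continuousOn (ph₁.continuousOn hℓ0))
      have i2 := integral_abs_le_normL2 hℓ0 hH.isH2.memLp
      have j0 : ∫ t in (0 : ℝ)..ℓ, |h t| ≤ L * X := i0.trans (by gcongr)
      have j1 : ∫ t in (0 : ℝ)..ℓ, |h₁ t| ≤ L * X := i1.trans (by gcongr)
      have j2 : ∫ t in (0 : ℝ)..ℓ, |h₂ t| ≤ L * X := i2.trans (by gcongr)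
      have hSX : L * X / ℓ + 2 * (L * X) = S * X := by rw [hS]; ring
      have b0 : ∀ x ∈ Icc 0 ℓ, |h x| ≤ S * X := by
        intro x hx
        refine (ph.abs_le hℓ hx).trans ?_
        rw [← hSX]
        gcongr
      have b1 : ∀ x ∈ Icc 0 ℓ, |h₁ x| ≤ S * X := by
        intro x hx
        refine (ph₁.abs_le hℓ hx).trans ?_
        rw [← hSX]
        gcongr
      have b2 : ∫ t in (0 : ℝ)..ℓ, |h₂ t| ≤ S * X := by
        refine j2.trans ?_
        rw [hS]
        have : 0 ≤ L / ℓ + L := by positivity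
        nlinarith
      have hb := hests (s * κ) q q₁ q₂ r hη hη2 H hres v v₁ v₂ h h₁ h₂ (S * X) hpv hpv₁
        hv'.periodic hv'.periodic_deriv ph ph₁ hH.periodic hH.periodic_deriv
        (by filter_upwards [heqv] with t ht hm; rw [← hρ]; exact ht hm) b0 b1 b2
      rw [← mul_assoc, ← hD₂] at hb
      have g1 := hsecond _ fun x hx => (hb x hx).1
      have g2 := normL2_le_of_bound hℓ0 fun x hx => (hb x hx).2
      have g3 := normLinf_le_of_bound hℓ0 fun x hx => (hb x hx).1
      have g6 : (L * (a * (D₂ * X)) + normL2 ℓ h) / gammaZero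
          ≤ (L * (a * D₂) + 1) / gammaZero * X := by
        have : (L * (a * D₂) + 1) / gammaZero * X = (L * (a * (D₂ * X)) + X) / gammaZero := by ring
        rw [this]
        gcongr
      have g7 : 0 ≤ ((L * (a * D₁) + 1) / gammaZero + L * D₁ / κ + D₁) * X := by positivity
      linarith

end BoundaryLayers

namespace BoundaryLayers

/-! ### Avoiding resonances -/

/-- Jordan's inequality for |e^{id} - 1| = 2|sin(d/2)|. -/
theorem norm_exp_sub_one_ge {d : ℝ} (h0 : 0 ≤ d) (hπ : d ≤ Real.pi) :
    2 / Real.pi * d ≤ ‖Complex.exp (Complex.I * d) - 1‖ := by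
  rw [Complex.norm_exp_I_mul_ofReal_sub_one, Real.norm_eq_abs]
  have := Real.mul_le_sin (x := d / 2) (by linarith) (by linarith)
  refine le_trans ?_ (le_abs_self _)
  linarith

set_option maxHeartbeats 400000 in
/-- If the phases `J_n(s) / s` have amplitudes `J_n` bounded, bounded below and locally Lipschitz,
then for arbitrarily small `s` all of them stay away from `2πℤ`. -/
theorem exists_nonresonant {N : ℕ} {J : Fin N → ℝ → ℝ} {j₀ j₁ L s₁ : ℝ} (hj₀ : 0 < j₀)
    (hL : 0 ≤ L) (hs₁ : 0 < s₁)
    (hlow : ∀ n s, 0 < s → s < s₁ → j₀ ≤ J n s) (hup : ∀ n s, 0 < s → s < s₁ → J n s ≤ j₁)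
    (hlip : ∀ n s s', 0 < s → s < s₁ → 0 < s' → s' < s₁ → s ≤ 2 * s' → s' ≤ 2 * s →
      |J n s - J n s'| ≤ L * |s - s'|) :
    ∃ c > 0, ∀ s₂ > 0, ∃ s, 0 < s ∧ s < s₂ ∧
      ∀ n, c ≤ ‖Complex.exp (Complex.I * ((J n s / s : ℝ) : ℂ)) - 1‖ := by
  have hπ := Real.pi_pos
  -- Over the whole grid 1/s moves by at most (N + 1)t and the phase at rate at most |j₁| + j₀, so
  -- with t = π/P phase differences never exceed π.
  set P : ℝ := (|j₁| + j₀) * (N + 1) with hP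
  have hPp : 0 < P := by positivity
  set t : ℝ := Real.pi / P with ht
  have htp : 0 < t := by positivity
  -- Half of the lower bound (2/π)(j₀/2)t for |e^{id} - 1| when d lies between (j₀/2)t and π; the
  -- triangle inequality consumes the factor two.
  refine ⟨1 / Real.pi * (j₀ / 2 * t), by positivity, fun s₂ hs₂ => ?_⟩
  -- Beyond `M` the scales 1/l are below s₁ and s₂, the Lipschitz error L/l is at most j₀/2, and any
  -- two grid points are comparable up to a factor 2.
  set M : ℝ := 1 / s₁ + 1 / s₂ + 2 * L / j₀ + (N + 1) * t with hM
  have hMp : 0 < M := by positivity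
  set l : Fin (N + 1) → ℝ := fun i => M + 1 + i * t with hl
  have hlM : ∀ i, M < l i := fun i => by
    have : 0 ≤ (i : ℝ) * t := by positivity
    simp only [hl]; linarith
  have hlp : ∀ i, 0 < l i := fun i => hMp.trans (hlM i)
  have hs₁' : ∀ i, 1 / l i < s₁ := fun i => by
    rw [div_lt_iff₀ (hlp i), ← div_lt_iff₀' hs₁]
    refine lt_trans ?_ (hlM i)
    have : 0 < 1 / s₂ := by positivity
    have : 0 ≤ 2 * L / j₀ := by positivity
    have : 0 < (N + 1) * t := by positivity
    linarith
  have hs₂' : ∀ i, 1 / l i < s₂ := fun i => by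
    rw [div_lt_iff₀ (hlp i), ← div_lt_iff₀' hs₂]
    refine lt_trans ?_ (hlM i)
    have : 0 < 1 / s₁ := by positivity
    have : 0 ≤ 2 * L / j₀ := by positivity
    have : 0 < (N + 1) * t := by positivity
    linarith
  by_contra hcon
  push Not at hcon
  have hbad : ∀ i, ∃ n, ‖Complex.exp (Complex.I * ((J n (1 / l i) / (1 / l i) : ℝ) : ℂ)) - 1‖
      < 1 / Real.pi * (j₀ / 2 * t) := fun i => hcon (1 / l i) (by have := hlp i; positivity) (hs₂' i)
  choose f hf using hbad
  -- Pigeonhole: N + 1 bad grid points and only N indices.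
  obtain ⟨i, i', hne, hfe⟩ : ∃ i i', i ≠ i' ∧ f i = f i' := by
    by_contra hinj
    push Not at hinj
    have : Function.Injective f := fun a b hab => by
      by_contra h; exact hinj a b h hab
    have := Fintype.card_le_of_injective f this
    simp at this
  wlog hlt : i < i' generalizing i i'
  · exact this i' i hne.symm hfe.symm (lt_of_le_of_ne (not_lt.1 hlt) hne.symm)
  set n := f i with hn
  set x := J n (1 / l i) / (1 / l i) with hx
  set x' := J n (1 / l i') / (1 / l i') with hx'
  have b1 : ‖Complex.exp (Complex.I * x) - 1‖ < 1 / Real.pi * (j₀ / 2 * t) := hf i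
  have b2 := hf i'
  rw [← hfe, ← hx'] at b2
  have hdl : l i' - l i = ((i' : ℕ) - (i : ℕ) : ℝ) * t := by simp only [hl]; ring
  have hii : (1 : ℝ) ≤ (i' : ℕ) - (i : ℕ) := by
    have : (i : ℕ) + 1 ≤ (i' : ℕ) := hlt
    have : ((i : ℕ) : ℝ) + 1 ≤ ((i' : ℕ) : ℝ) := by exact_mod_cast this
    linarith
  have hii' : ((i' : ℕ) - (i : ℕ) : ℝ) ≤ N + 1 := by
    have h1 : (i' : ℕ) ≤ N + 1 := i'.2.le
    have h2 : ((i' : ℕ) : ℝ) ≤ N + 1 := by exact_mod_cast h1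
    have h3 : (0 : ℝ) ≤ (i : ℕ) := Nat.cast_nonneg _
    linarith
  have hd1 : t ≤ l i' - l i := by rw [hdl]; nlinarith
  have hd2 : l i' - l i ≤ (N + 1) * t := by rw [hdl]; gcongr
  have hl1 := hlp i
  have hl2 := hlp i'
  have hlle : l i ≤ l i' := by linarith
  have hl2i : l i' ≤ 2 * l i := by
    have h1 : (N + 1) * t ≤ M := by
      have : 0 < 1 / s₁ := by positivity
      have : 0 < 1 / s₂ := by positivity
      have : 0 ≤ 2 * L / j₀ := by positivity
      linarith
    have := hlM i
    linarith
  have hJ := hlip n (1 / l i') (1 / l i) (by positivity) (hs₁' i') (by positivity) (hs₁' i)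
    (by
      have := one_div_le_one_div_of_le hl1 hlle
      have : 0 < 1 / l i := by positivity
      linarith)
    (by
      rw [div_le_iff₀ hl1, mul_one_div, div_mul_eq_mul_div, le_div_iff₀ hl2]
      linarith)
  have hab : |1 / l i' - 1 / l i| = (l i' - l i) / (l i * l i') := by
    rw [abs_sub_comm, abs_of_nonneg (sub_nonneg.2 (one_div_le_one_div_of_le hl1 hlle))]
    field_simp
  rw [hab] at hJ
  -- The phase is l J(1/l). The first term grows at least like j₀(l' - l), the second is at most
  -- (j₀/2)(l' - l) by the Lipschitz bound on J.
  have hxx : x' - x = (l i' - l i) * J n (1 / l i') + l i * (J n (1 / l i') - J n (1 / l i)) := by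
    rw [hx, hx']
    field_simp
    ring
  have hsecond : |l i * (J n (1 / l i') - J n (1 / l i))| ≤ j₀ / 2 * (l i' - l i) := by
    rw [abs_mul, abs_of_pos hl1]
    have h1 : l i * |J n (1 / l i') - J n (1 / l i)| ≤ l i * (L * ((l i' - l i) / (l i * l i'))) := by
      gcongr
    have h2 : l i * (L * ((l i' - l i) / (l i * l i'))) = L / l i' * (l i' - l i) := by
      field_simp
    rw [h2] at h1
    refine h1.trans ?_
    have h3 : 2 * L / j₀ ≤ l i' := by
      refine le_trans ?_ (hlM i').le
      have : 0 < 1 / s₁ := by positivity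
      have : 0 < 1 / s₂ := by positivity
      have : 0 < (N + 1) * t := by positivity
      linarith
    have h4 : L / l i' ≤ j₀ / 2 := by
      rw [div_le_iff₀ hj₀] at h3
      rw [div_le_iff₀ hl2]
      linarith
    have : 0 ≤ l i' - l i := by linarith
    gcongr
  have hdnn : 0 ≤ l i' - l i := by linarith
  have hJ1 := hlow n (1 / l i') (by positivity) (hs₁' i')
  have hJ2 := hup n (1 / l i') (by positivity) (hs₁' i')
  have hge : j₀ / 2 * t ≤ x' - x := by
    have h1 := (abs_le.1 hsecond).1
    have h2 := mul_le_mul_of_nonneg_left hJ1 hdnn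
    have h3 := mul_le_mul_of_nonneg_left hd1 (by positivity : 0 ≤ j₀ / 2)
    rw [hxx]
    linarith
  have hle : x' - x ≤ Real.pi := by
    have h1 := (abs_le.1 hsecond).2
    have h2 : J n (1 / l i') ≤ |j₁| := hJ2.trans (le_abs_self _)
    have h3 : x' - x ≤ (|j₁| + j₀) * (l i' - l i) := by
      have h4 := mul_le_mul_of_nonneg_left h2 hdnn
      have h5 : 0 ≤ j₀ / 2 * (l i' - l i) := by positivity
      rw [hxx]
      linarith
    refine h3.trans ?_
    calc (|j₁| + j₀) * (l i' - l i) ≤ (|j₁| + j₀) * ((N + 1) * t) := by gcongr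
      _ = P * t := by rw [hP]; ring
      _ = Real.pi := by rw [ht]; field_simp
  have h0 : 0 < j₀ / 2 * t := by positivity
  have h1 := norm_exp_sub_one_ge (d := x' - x) (by linarith) hle
  have h2 : ‖Complex.exp (Complex.I * ((x' - x : ℝ) : ℂ)) - 1‖
      = ‖Complex.exp (Complex.I * x') - Complex.exp (Complex.I * x)‖ := by
    have e : Complex.exp (Complex.I * x') - Complex.exp (Complex.I * x)
        = Complex.exp (Complex.I * x) * (Complex.exp (Complex.I * ((x' - x : ℝ) : ℂ)) - 1) := by
      rw [mul_sub, mul_one, ← Complex.exp_add]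
      congr 2
      push_cast
      ring
    rw [e, norm_mul, mul_comm Complex.I (x : ℂ), Complex.norm_exp_ofReal_mul_I, one_mul]
  have h3 : ‖Complex.exp (Complex.I * x') - Complex.exp (Complex.I * x)‖
      ≤ ‖Complex.exp (Complex.I * x') - 1‖ + ‖Complex.exp (Complex.I * x) - 1‖ := by
    have e : Complex.exp (Complex.I * x') - Complex.exp (Complex.I * x)
        = (Complex.exp (Complex.I * x') - 1) - (Complex.exp (Complex.I * x) - 1) := by ring
    rw [e]
    exact norm_sub_le _ _
  have h4 : 2 / Real.pi * (j₀ / 2 * t) ≤ 2 / Real.pi * (x' - x) := by gcongr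
  have h5 : 2 / Real.pi * (j₀ / 2 * t) = 2 * (1 / Real.pi * (j₀ / 2 * t)) := by ring
  linarith

end BoundaryLayers

namespace BoundaryLayers

/-! ### Eigenvalues near a matrix with simple spectrum -/

/-- A strictly decreasing list of `N` roots of the characteristic polynomial is the list of
eigenvalues in decreasing order. -/
theorem sortedEigenvalue_eq {N : ℕ} {M : Matrix (Fin N) (Fin N) ℝ} {x : Fin N → ℝ}
    (hx : StrictAnti x) (hroot : ∀ n, M.charpoly.IsRoot (x n)) (n : Fin N) :
    sortedEigenvalue M n = x n := by
  have hne : M.charpoly ≠ 0 := M.charpoly_monic.ne_zero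
  have hnd : (Finset.univ.val.map x).Nodup := Finset.univ.nodup.map hx.injective
  have hle : Finset.univ.val.map x ≤ M.charpoly.roots := by
    refine (Multiset.le_iff_subset hnd).2 fun y hy => ?_
    obtain ⟨k, -, rfl⟩ := Multiset.mem_map.1 hy
    exact (Polynomial.mem_roots hne).2 (hroot k)
  have heq : Finset.univ.val.map x = M.charpoly.roots := by
    refine Multiset.eq_of_le_of_card_le hle ?_
    refine (Polynomial.card_roots' _).trans ?_
    rw [Matrix.charpoly_natDegree_eq_dim]
    simp
  have hsort : M.charpoly.roots.sort (· ≥ ·) = List.ofFn x := by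
    rw [← heq, Fin.univ_val_map, Multiset.coe_sort]
    apply List.mergeSort_of_pairwise
    simp_rw [decide_eq_true_eq, ← List.sortedGE_iff_pairwise]
    exact hx.antitone.sortedGE_ofFn
  rw [sortedEigenvalue, hsort]
  simp [List.getD_eq_getElem?_getD]

/-- The characteristic polynomial as a function of the matrix and of the spectral parameter. -/
noncomputable def charFun (N : ℕ) (p : (Fin N → Fin N → ℝ) × ℝ) : ℝ :=
  (Matrix.of fun i j => p.2 * (1 : Matrix (Fin N) (Fin N) ℝ) i j - p.1 i j).det

theorem charFun_eq_eval {N : ℕ} (X : Fin N → Fin N → ℝ) (x : ℝ) :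
    charFun N (X, x) = (Matrix.of X).charpoly.eval x := by
  rw [Matrix.eval_charpoly, charFun]
  congr 1
  ext i j
  simp [Matrix.scalar_apply, Matrix.diagonal_apply, Matrix.one_apply]

theorem contDiff_charFun (N : ℕ) : ContDiff ℝ 2 (charFun N) := by
  unfold charFun
  simp only [Matrix.det_apply, Matrix.of_apply]
  fun_prop

/-- A simple root of the characteristic polynomial extends to a `C²` function of the matrix. -/
theorem exists_eigenvalue_function {N : ℕ} (T : Fin N → Fin N → ℝ) {x : ℝ}
    (hx : (Matrix.of T).charpoly.IsRoot x)
    (hx' : (Matrix.of T).charpoly.derivative.eval x ≠ 0) :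
    ∃ φ : (Fin N → Fin N → ℝ) → ℝ, φ T = x ∧ ContDiffAt ℝ 2 φ T ∧
      ∀ᶠ X in 𝓝 T, (Matrix.of X).charpoly.IsRoot (φ X) := by
  have hc : ContDiffAt ℝ 2 (charFun N) (T, x) := (contDiff_charFun N).contDiffAt
  have hfd : HasFDerivAt (charFun N) (fderiv ℝ (charFun N) (T, x)) (T, x) :=
    (hc.differentiableAt (by norm_num)).hasFDerivAt
  set d := (Matrix.of T).charpoly.derivative.eval x with hd
  have h1 : HasDerivAt (fun y => charFun N (T, y))
      ((fderiv ℝ (charFun N) (T, x) ∘L .inr ℝ _ ℝ) 1) x := by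
    exact hfd.comp_hasDerivAt x ((hasDerivAt_const x T).prodMk (hasDerivAt_id x))
  have h2 : HasDerivAt (fun y => charFun N (T, y)) d x := by
    simp only [charFun_eq_eval]
    exact (Matrix.of T).charpoly.hasDerivAt x
  have hval : (fderiv ℝ (charFun N) (T, x) ∘L .inr ℝ _ ℝ) 1 = d := h1.unique h2
  -- Simplicity of the root is invertibility of the partial derivative in the spectral parameter,
  -- the hypothesis of the implicit function theorem.
  have hinv : (fderiv ℝ (charFun N) (T, x) ∘L .inr ℝ _ ℝ).IsInvertible := by
    refine ⟨ContinuousLinearEquiv.unitsEquivAut ℝ (Units.mk0 d hx'), ?_⟩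
    ext
    rw [hval]
    simp
  have h20 : (2 : WithTop ℕ∞) ≠ 0 := by norm_num
  refine ⟨hc.implicitFunction h20 hinv, hc.implicitFunction_apply_self h20 hinv,
    hc.contDiffAt_implicitFunction h20 hinv, ?_⟩
  filter_upwards [hc.eventually_apply_implicitFunction h20 hinv] with X hX
  rw [charFun_eq_eval, charFun_eq_eval, hx.eq_zero] at hX
  exact hX

/-- The linearization error of a `C²` function is Lipschitz with a small constant. -/
theorem exists_linearization_bound {E : Type*} [NormedAddCommGroup E] [NormedSpace ℝ E]
    {φ : E → ℝ} {x₀ : E} (h : ContDiffAt ℝ 2 φ x₀) :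
    ∃ C R : ℝ, 0 < C ∧ 0 < R ∧ ∀ δ, 0 ≤ δ → δ < R → ∀ X Y, ‖X - x₀‖ ≤ δ → ‖Y - x₀‖ ≤ δ →
      |φ X - φ Y - fderiv ℝ φ x₀ (X - Y)| ≤ C * δ * ‖X - Y‖ := by
  -- The derivative deviates from its value at x₀ by at most C‖X - x₀‖; the mean value inequality on
  -- a ball of radius δ then gives the constant Cδ.
  have h1 : ContDiffAt ℝ 1 (fderiv ℝ φ) x₀ := h.fderiv_right (by norm_num)
  have h2 := (h1.differentiableAt (by norm_num)).hasFDerivAt.isBigO_sub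
  obtain ⟨C, hC, hb⟩ := h2.exists_pos
  rw [Asymptotics.isBigOWith_iff] at hb
  have h3 : ∀ᶠ X in 𝓝 x₀, DifferentiableAt ℝ φ X := by
    filter_upwards [h.eventually (by simp)] with X hX
    exact hX.differentiableAt (by norm_num)
  obtain ⟨R, hR, hball⟩ := Metric.eventually_nhds_iff_ball.1 (hb.and h3)
  refine ⟨C, R, hC, hR, fun δ hδ hδR X Y hX hY => ?_⟩
  have hmem : ∀ Z, Z ∈ Metric.closedBall x₀ δ → Z ∈ Metric.ball x₀ R := fun Z hZ =>
    Metric.closedBall_subset_ball hδR hZ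
  have := Convex.norm_image_sub_le_of_norm_hasFDerivWithin_le' (s := Metric.closedBall x₀ δ)
    (f := φ) (f' := fderiv ℝ φ) (φ := fderiv ℝ φ x₀) (C := C * δ)
    (fun Z hZ => (hball Z (hmem Z hZ)).2.hasFDerivAt.hasFDerivWithinAt)
    (fun Z hZ => by
      refine (hball Z (hmem Z hZ)).1.trans ?_
      have : ‖Z - x₀‖ ≤ δ := by rwa [Metric.mem_closedBall, dist_eq_norm] at hZ
      gcongr)
    (convex_closedBall x₀ δ) (x := Y) (y := X) (by rwa [Metric.mem_closedBall, dist_eq_norm])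
    (by rwa [Metric.mem_closedBall, dist_eq_norm])
  exact this

/-! ### The limit matrix -/

/-- The tridiagonal matrix with sub- and superdiagonal entries `-c` and `-d`, and a reflecting
first row. -/
def triMatrix (N : ℕ) (c d : ℕ → ℝ) : Matrix (Fin N) (Fin N) ℝ :=
  Matrix.of fun i j =>
    if i = j then (if (i : ℕ) = 0 then 2 else 1) * c (i + 1) + d (i + 1)
    else if (i : ℕ) = j + 1 then -c (i + 1)
    else if (j : ℕ) = i + 1 then -d (i + 1)
    else 0

/-- The limit, up to a factor, of the matrices of the linearized systems. -/
noncomputable def limitMatrix (N : ℕ) : Matrix (Fin N) (Fin N) ℝ :=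
  triMatrix N (fun j => (N : ℝ) - j + 1) (fun j => (N : ℝ) - j)

/-- The limit coefficients satisfy d j = c (j + 1), both being N - j, so sub- and superdiagonal
agree. -/
theorem limitMatrix_isHermitian (N : ℕ) : (limitMatrix N).IsHermitian := by
  ext i j
  simp only [Matrix.conjTranspose_apply, limitMatrix, triMatrix, Matrix.of_apply, star_trivial]
  by_cases hij : i = j
  · simp [hij]
  · have hji : ¬ j = i := fun h => hij h.symm
    simp only [hij, hji, if_false]
    by_cases h1 : (j : ℕ) = i + 1
    · have h2 : ¬ (i : ℕ) = j + 1 := by omega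
      simp only [h1, if_true]
      have h3 : ¬ (i : ℕ) = i + 1 + 1 := by omega
      simp only [h3, if_false]
      push_cast
      ring
    · by_cases h2 : (i : ℕ) = j + 1
      · have h3 : ¬ (j : ℕ) = j + 1 + 1 := by omega
        simp only [h2, if_true, h3, if_false]
        push_cast
        ring
      · simp [h1, h2]

/-- The eigenvalue equation of the limit matrix as a three-term recursion. -/
theorem limitMatrix_recursion {N : ℕ} {x : ℝ} {u : Fin N → ℝ}
    (h : (limitMatrix N).mulVec u = x • u) (U : ℕ → ℝ) (hU : ∀ i : Fin N, U i = u i)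
    {k : ℕ} (hk : k < N) :
    ((if k = 0 then 2 else 1) * ((N : ℝ) - k) + ((N : ℝ) - k - 1)) * U k
      - (if k = 0 then 0 else ((N : ℝ) - k) * U (k - 1)) - ((N : ℝ) - k - 1) * U (k + 1)
      = x * U k := by
  have h1 := congrFun h ⟨k, hk⟩
  simp only [Matrix.mulVec, dotProduct, limitMatrix, triMatrix, Matrix.of_apply, Pi.smul_apply,
    smul_eq_mul] at h1
  rw [← hU ⟨k, hk⟩] at h1
  simp only at h1
  rw [← h1]
  -- The row sum as three Kronecker terms over ℕ. For k = 0 the truncated k - 1 is again 0, so the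
  -- subdiagonal term must be switched off explicitly.
  set g : ℕ → ℝ := fun j : ℕ => (if k = j then
        ((if k = 0 then 2 else 1) * ((N : ℝ) - k) + ((N : ℝ) - k - 1)) * U k else 0)
        + (if k - 1 = j then (if k = 0 then 0 else -(((N : ℝ) - k) * U (k - 1))) else 0)
        + (if k + 1 = j then -(((N : ℝ) - k - 1) * U (k + 1)) else 0) with hg
  have e : ∀ j : Fin N, (if (⟨k, hk⟩ : Fin N) = j then
      (if k = 0 then 2 else 1) * ((N : ℝ) - ((k + 1 : ℕ) : ℝ) + 1) + ((N : ℝ) - ((k + 1 : ℕ) : ℝ))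
      else if k = (j : ℕ) + 1 then -((N : ℝ) - ((k + 1 : ℕ) : ℝ) + 1)
      else if (j : ℕ) = k + 1 then -((N : ℝ) - ((k + 1 : ℕ) : ℝ)) else 0) * u j
      = g (j : ℕ) := by
    intro j
    have hj := hU j
    simp only [Fin.ext_iff, hg]
    push_cast
    by_cases a1 : k = (j : ℕ)
    · have b1 : ¬ k + 1 = (j : ℕ) := by omega
      by_cases a2 : k = 0
      · have b2 : k - 1 = (j : ℕ) := by omega
        rw [if_pos a1, if_pos a1, if_pos b2, if_neg b1, if_pos a2, if_pos a2, ← hj, ← a1]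
        ring
      · have b2 : ¬ k - 1 = (j : ℕ) := by omega
        rw [if_pos a1, if_pos a1, if_neg b2, if_neg b1, if_neg a2, ← hj, ← a1]
        ring
    · rw [if_neg a1, if_neg a1]
      by_cases a2 : k = (j : ℕ) + 1
      · have b2 : k - 1 = (j : ℕ) := by omega
        have b1 : ¬ k + 1 = (j : ℕ) := by omega
        have b3 : ¬ k = 0 := by omega
        rw [if_pos a2, if_pos b2, if_neg b1, if_neg b3, ← hj, ← b2]
        ring
      · rw [if_neg a2]
        have b2 : (if k - 1 = (j : ℕ) then (if k = 0 then (0 : ℝ)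
            else -(((N : ℝ) - k) * U (k - 1))) else 0) = 0 := by
          by_cases b : k - 1 = (j : ℕ)
          · have : k = 0 := by omega
            simp [this]
          · simp [b]
        rw [b2]
        by_cases a3 : (j : ℕ) = k + 1
        · rw [if_pos a3, if_pos a3.symm, ← hj, ← a3]
          ring
        · rw [if_neg a3, if_neg (fun h => a3 h.symm)]
          ring
  rw [Finset.sum_congr rfl fun j _ => e j, Fin.sum_univ_eq_sum_range g N]
  simp only [hg]
  rw [Finset.sum_add_distrib, Finset.sum_add_distrib, Finset.sum_ite_eq, Finset.sum_ite_eq,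
    Finset.sum_ite_eq]
  have m1 : k ∈ Finset.range N := Finset.mem_range.2 hk
  have m2 : k - 1 ∈ Finset.range N := Finset.mem_range.2 (by omega)
  rw [if_pos m1, if_pos m2]
  by_cases m3 : k + 1 < N
  · rw [if_pos (Finset.mem_range.2 m3)]
    split_ifs <;> ring
  -- In the last row N - k - 1 = 0, so the value `U N` outside the vector does not matter.
  · rw [if_neg (show ¬ k + 1 ∈ Finset.range N by rw [Finset.mem_range]; exact m3)]
    have : (N : ℝ) = k + 1 := by
      have : N = k + 1 := by omega
      exact_mod_cast this
    rw [this]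
    split_ifs <;> ring

end BoundaryLayers

/-! ### Simplicity and positivity of the limit spectrum -/

namespace BoundaryLayers

/-- Extension by zero of a vector indexed by `Fin N`. -/
noncomputable def extendZero {N : ℕ} (u : Fin N → ℝ) (k : ℕ) : ℝ :=
  if h : k < N then u ⟨k, h⟩ else 0

theorem extendZero_coe {N : ℕ} (u : Fin N → ℝ) (i : Fin N) : extendZero u i = u i := by
  simp [extendZero]

/-- An eigenvector of the limit matrix is determined by its first component. -/
theorem eq_zero_of_limitMatrix_eigenvector {N : ℕ} {x : ℝ} {u : Fin N → ℝ}
    (h : (limitMatrix N).mulVec u = x • u) (h0 : extendZero u 0 = 0) : u = 0 := by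
  have hrec := fun {k} (hk : k < N) => limitMatrix_recursion h (extendZero u) (extendZero_coe u) hk
  have hall : ∀ k, ∀ i ≤ k, i < N → extendZero u i = 0 := by
    intro k
    induction k with
    | zero => intro i hi _; rw [Nat.le_zero.1 hi]; exact h0
    | succ k ih =>
      intro i hi hiN
      rcases Nat.lt_or_ge i (k + 1) with hlt | hge
      · exact ih i (Nat.lt_succ_iff.1 hlt) hiN
      · have hik : i = k + 1 := le_antisymm hi hge
        subst hik
        have hk : k < N := by omega
        have r := hrec hk
        have z0 := ih k le_rfl hk
        have z1 : k ≠ 0 → extendZero u (k - 1) = 0 := fun _ => ih (k - 1) (by omega) (by omega)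
        rw [z0] at r
        -- Before the last row the superdiagonal coefficient is nonzero, so the recursion determines
        -- the next component from the previous ones.
        have hpos : (0 : ℝ) < (N : ℝ) - k - 1 := by
          have : ((k + 1 : ℕ) : ℝ) < N := by exact_mod_cast hiN
          push_cast at this
          linarith
        by_cases hk0 : k = 0
        · rw [if_pos hk0, if_pos hk0] at r
          have : ((N : ℝ) - k - 1) * extendZero u (k + 1) = 0 := by linarith
          exact (mul_eq_zero.1 this).resolve_left hpos.ne'
        · rw [if_neg hk0, if_neg hk0, z1 hk0] at r
          have : ((N : ℝ) - k - 1) * extendZero u (k + 1) = 0 := by linarith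
          exact (mul_eq_zero.1 this).resolve_left hpos.ne'
  ext i
  rw [← extendZero_coe u i]
  exact hall i i le_rfl i.2

/-- An eigenvector of the limit matrix with positive first component has a positive eigenvalue. -/
theorem limitMatrix_eigenvalue_pos_of_pos {N : ℕ} {x : ℝ} {u : Fin N → ℝ} (hN : 0 < N)
    (h : (limitMatrix N).mulVec u = x • u) (h0 : 0 < extendZero u 0) : 0 < x := by
  have hrec := fun {k} (hk : k < N) => limitMatrix_recursion h (extendZero u) (extendZero_coe u) hk
  by_contra hx
  rw [not_lt] at hx
  set U := extendZero u with hU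
  -- If x ≤ 0, the discrete flux (N - k - 1)(U_{k+1} - U_k) increases by -xU_k ≥ 0 at each step; it
  -- is positive at k = 0 owing to the reflecting first row and keeps U positive. At k = N - 1 the
  -- flux is zero, a contradiction.
  have hstep : ∀ k, k < N → 0 < U k ∧ 0 < ((N : ℝ) - k - 1) * (U (k + 1) - U k) := by
    intro k
    induction k with
    | zero =>
      intro hk
      have r := hrec hk
      simp only [if_true] at r
      have hNp : (0 : ℝ) < N := by exact_mod_cast hN
      refine ⟨h0, ?_⟩
      push_cast at r ⊢
      have e1 : 0 < (N : ℝ) * U 0 := mul_pos hNp h0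
      have e2 : x * U 0 ≤ 0 := mul_nonpos_of_nonpos_of_nonneg hx h0.le
      linarith
    | succ k ih =>
      intro hk
      obtain ⟨p1, p2⟩ := ih (by omega)
      have hpos : (0 : ℝ) < (N : ℝ) - k - 1 := by
        have : ((k + 1 : ℕ) : ℝ) < N := by exact_mod_cast hk
        push_cast at this
        linarith
      have p3 : 0 < U (k + 1) - U k := (pos_iff_pos_of_mul_pos p2).1 hpos
      have p4 : 0 < U (k + 1) := by linarith
      refine ⟨p4, ?_⟩
      have r := hrec hk
      rw [if_neg (Nat.succ_ne_zero k), if_neg (Nat.succ_ne_zero k), Nat.add_sub_cancel] at r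
      have e2 : x * U (k + 1) ≤ 0 := mul_nonpos_of_nonpos_of_nonneg hx p4.le
      push_cast at r ⊢
      linarith
  have hlast := (hstep (N - 1) (by omega)).2
  have : ((N - 1 : ℕ) : ℝ) = N - 1 := by
    rw [Nat.cast_sub hN]; simp
  rw [this] at hlast
  simp at hlast

theorem limitMatrix_eigenvalue_pos {N : ℕ} {x : ℝ} {u : Fin N → ℝ} (hu : u ≠ 0)
    (h : (limitMatrix N).mulVec u = x • u) : 0 < x := by
  have hN : 0 < N := by
    rcases Nat.eq_zero_or_pos N with rfl | hN
    · exact absurd (Subsingleton.elim u 0) hu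
    · exact hN
  rcases lt_trichotomy (extendZero u 0) 0 with hneg | hz | hpos
  · refine limitMatrix_eigenvalue_pos_of_pos (u := -u) hN ?_ ?_
    · rw [Matrix.mulVec_neg, h, smul_neg]
    · simp only [extendZero, hN, dif_pos, Pi.neg_apply] at hneg ⊢
      linarith
  · exact absurd (eq_zero_of_limitMatrix_eigenvector h hz) hu
  · exact limitMatrix_eigenvalue_pos_of_pos hN h hpos

/-- The eigenvalues of the limit matrix are simple and positive. -/
theorem exists_limitMatrix_eigenvalues (N : ℕ) :
    ∃ τ : Fin N → ℝ, StrictAnti τ ∧ ∀ n, 0 < τ n ∧ (limitMatrix N).charpoly.IsRoot (τ n) ∧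
      (limitMatrix N).charpoly.derivative.eval (τ n) ≠ 0 := by
  have hT := limitMatrix_isHermitian N
  set e := hT.eigenvalues with he
  set b : Fin N → Fin N → ℝ := fun i => ⇑(hT.eigenvectorBasis i) with hb
  have hev : ∀ i, (limitMatrix N).mulVec (b i) = e i • b i := fun i => hT.mulVec_eigenvectorBasis i
  have hb0 : ∀ i, b i ≠ 0 := by
    intro i hi
    refine hT.eigenvectorBasis.toBasis.ne_zero i ?_
    ext j
    simpa using congrFun hi j
  have hinj : Function.Injective e := by
    intro i j hij
    by_contra hne
    set α := extendZero (b i) 0 with hα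
    set β := extendZero (b j) 0 with hβ
    -- Two eigenvectors with the same eigenvalue have a combination with vanishing first component,
    -- which must be zero, against orthonormality.
    have hcomb : (limitMatrix N).mulVec (β • b i - α • b j) = e i • (β • b i - α • b j) := by
      rw [Matrix.mulVec_sub, Matrix.mulVec_smul, Matrix.mulVec_smul, hev i, hev j, ← hij, smul_sub,
        smul_comm β, smul_comm α]
    have hN : 0 < N := i.pos
    have hz : extendZero (β • b i - α • b j) 0 = 0 := by
      rw [hα, hβ]
      simp only [extendZero, hN, dif_pos, Pi.sub_apply, Pi.smul_apply, smul_eq_mul]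
      ring
    have hzero := eq_zero_of_limitMatrix_eigenvector hcomb hz
    have hβ0 : β ≠ 0 := fun h => hb0 j (eq_zero_of_limitMatrix_eigenvector (hev j) h)
    have hli := hT.eigenvectorBasis.toBasis.linearIndependent
    have h2 : β • hT.eigenvectorBasis i = α • hT.eigenvectorBasis j := by
      ext k
      have := congrFun hzero k
      simpa [hb, sub_eq_zero] using this
    have h3 := congrArg (fun v => inner ℝ (hT.eigenvectorBasis i) v) h2
    simp only [inner_smul_right, hT.eigenvectorBasis.inner_eq_ite, if_true, if_neg hne] at h3
    exact hβ0 (by simpa using h3)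
  set S := Finset.univ.image e with hS
  have hcard : S.card = N := by
    rw [hS, Finset.card_image_of_injective _ hinj]; simp
  -- `Fin.rev` turns the increasing enumeration of the spectrum into a decreasing one.
  set τ : Fin N → ℝ := fun n => S.orderEmbOfFin hcard (Fin.rev n) with hτ
  have hroots : (limitMatrix N).charpoly.roots = Finset.univ.val.map e := by
    simpa using hT.roots_charpoly_eq_eigenvalues
  have hne : (limitMatrix N).charpoly ≠ 0 := (limitMatrix N).charpoly_monic.ne_zero
  refine ⟨τ, fun a c hac => ?_, fun n => ?_⟩
  · exact (S.orderEmbOfFin hcard).strictMono (Fin.rev_lt_rev.2 hac)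
  · have hmem : τ n ∈ S := S.orderEmbOfFin_mem hcard _
    obtain ⟨i, -, hi⟩ := Finset.mem_image.1 hmem
    rw [← hi]
    have hroot : (limitMatrix N).charpoly.IsRoot (e i) := by
      refine (Polynomial.mem_roots hne).1 ?_
      rw [hroots]
      exact Multiset.mem_map_of_mem _ (Finset.mem_univ i)
    refine ⟨limitMatrix_eigenvalue_pos (hb0 i) (hev i), hroot, fun hder => ?_⟩
    -- A common zero with the derivative would be a multiple root, whereas the distinct eigenvalues
    -- exhaust the roots.
    have h1 := (Polynomial.one_lt_rootMultiplicity_iff_isRoot hne).2 ⟨hroot, hder⟩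
    rw [← Polynomial.count_roots, hroots] at h1
    have h2 : (Finset.univ.val.map e).Nodup := Finset.univ.nodup.map hinj
    have := Multiset.nodup_iff_count_le_one.1 h2 (e i)
    omega

/-- The entries of the limit matrix. -/
noncomputable def limitEntries (N : ℕ) (i j : Fin N) : ℝ := limitMatrix N i j

/-- Positive multiples of matrices near the limit matrix have eigenvalues which are, up to the
factor, linear functions with a quadratically small error. -/
theorem exists_eigenvalue_expansion (N : ℕ) :
    ∃ (τ : Fin N → ℝ) (φ : Fin N → (Fin N → Fin N → ℝ) → ℝ)
      (L : Fin N → (Fin N → Fin N → ℝ) →L[ℝ] ℝ) (C R : ℝ), 0 < C ∧ 0 < R ∧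
      (∀ n, 0 < τ n ∧ φ n (limitEntries N) = τ n) ∧
      (∀ X : Fin N → Fin N → ℝ, ‖X - limitEntries N‖ < R → ∀ a : ℝ, 0 < a →
        ∀ M : Matrix (Fin N) (Fin N) ℝ, (∀ i j, M i j = a * X i j) →
        ∀ n, sortedEigenvalue M n = a * φ n X) ∧
      ∀ n δ, 0 ≤ δ → δ < R → ∀ X Y : Fin N → Fin N → ℝ,
        ‖X - limitEntries N‖ ≤ δ →
        ‖Y - limitEntries N‖ ≤ δ →
        |φ n X - φ n Y - L n (X - Y)| ≤ C * δ * ‖X - Y‖ := by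
  obtain ⟨τ, hτ, hτ'⟩ := exists_limitMatrix_eigenvalues N
  set T : Fin N → Fin N → ℝ := limitEntries N with hT
  have hex : ∀ n, ∃ φ : (Fin N → Fin N → ℝ) → ℝ, φ T = τ n ∧ ContDiffAt ℝ 2 φ T ∧
      ∀ᶠ X in 𝓝 T, (Matrix.of X).charpoly.IsRoot (φ X) := fun n =>
    exists_eigenvalue_function T (hτ' n).2.1 (hτ' n).2.2
  choose φ h1 h2 h3 using hex
  choose C R hC hR h4 using fun n => exists_linearization_bound (h2 n)
  -- The strict ordering of the eigenvalues at T persists nearby. This is what identifies the n-th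
  -- branch with the n-th sorted eigenvalue.
  have hanti : ∀ᶠ X in 𝓝 T, StrictAnti fun n => φ n X := by
    have : ∀ i j : Fin N, ∀ᶠ X in 𝓝 T, i < j → φ j X < φ i X := by
      intro i j
      by_cases hij : i < j
      · have hlt : φ j T < φ i T := by rw [h1, h1]; exact hτ hij
        filter_upwards [(h2 j).continuousAt.eventually_lt (h2 i).continuousAt hlt] with X hX _
        exact hX
      · exact Eventually.of_forall fun X h => absurd h hij
    filter_upwards [eventually_all.2 fun i => eventually_all.2 (this i)] with X hX i j hij
    exact hX i j hij
  obtain ⟨R₀, hR₀, hball⟩ := Metric.eventually_nhds_iff_ball.1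
    (hanti.and (eventually_all.2 h3))
  obtain ⟨R₁, hR₁, hR₁'⟩ : ∃ R₁ > 0, ∀ n, R₁ ≤ R n := by
    rcases isEmpty_or_nonempty (Fin N) with hN | hN
    · exact ⟨1, one_pos, fun n => (hN.false n).elim⟩
    · obtain ⟨k, hk⟩ := Finite.exists_min R
      exact ⟨R k, hR k, hk⟩
  refine ⟨τ, φ, fun n => fderiv ℝ (φ n) T, 1 + ∑ n, C n, min R₀ R₁, ?_, by positivity,
    fun n => ⟨(hτ' n).1, h1 n⟩, ?_, ?_⟩
  · have := Finset.sum_nonneg fun n (_ : n ∈ Finset.univ) => (hC n).le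
    linarith
  · intro X hX a ha M hM n
    have hXb : X ∈ Metric.ball T R₀ := by
      rw [Metric.mem_ball, dist_eq_norm]; exact hX.trans_le (min_le_left _ _)
    obtain ⟨k1, k2⟩ := hball X hXb
    have hMX : M = a • Matrix.of X := by ext i j; simp [hM]
    refine sortedEigenvalue_eq (x := fun n => a * φ n X)
      (fun i j hij => mul_lt_mul_of_pos_left (k1 hij) ha) (fun n => ?_) n
    have := k2 n
    rw [Polynomial.IsRoot, Matrix.eval_charpoly] at this ⊢
    have e : Matrix.scalar (Fin N) (a * φ n X) - M
        = a • (Matrix.scalar (Fin N) (φ n X) - Matrix.of X) := by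
      rw [hMX, smul_sub]
      congr 1
      ext i j
      simp [Matrix.diagonal_apply]
    rw [e, Matrix.det_smul, this, mul_zero]
  · intro n δ hδ hδR X Y hX hY
    refine (h4 n δ hδ (hδR.trans_le ((min_le_right _ _).trans (hR₁' n))) X Y hX hY).trans ?_
    have : C n ≤ 1 + ∑ n, C n := by
      have := Finset.single_le_sum (f := C) (fun i _ => (hC i).le) (Finset.mem_univ n)
      linarith
    gcongr

end BoundaryLayers

namespace BoundaryLayers

/-! ### Exponential weights built from the heteroclinic profile -/

theorem deriv_heteroclinic (x : ℝ) :
    deriv heteroclinic x = 1 / (√2 * Real.cosh (x / √2) ^ 2) := by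
  have hfun : heteroclinic = fun x => Real.sinh (x / √2) / Real.cosh (x / √2) := by
    funext y
    exact Real.tanh_eq_sinh_div_cosh _
  have hc : Real.cosh (x / √2) ≠ 0 := (Real.cosh_pos _).ne'
  have h0 : HasDerivAt (fun y : ℝ => y / √2) (1 / √2) x := (hasDerivAt_id x).div_const _
  have h := (h0.sinh).div (h0.cosh) hc
  rw [hfun, show deriv (fun x => Real.sinh (x / √2) / Real.cosh (x / √2)) x = _ from h.deriv]
  have h2 : √2 ≠ 0 := by positivity
  field_simp
  linarith [Real.cosh_sq_sub_sinh_sq (x / √2)]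

/-- The weight `H_x² e^{c x}`. -/
noncomputable def weight (c x : ℝ) : ℝ := deriv heteroclinic x ^ 2 * Real.exp (c * x)

theorem weight_pos (c x : ℝ) : 0 < weight c x := by
  have hc := Real.cosh_pos (x / √2)
  rw [weight, deriv_heteroclinic]
  positivity

theorem continuous_weight (c : ℝ) : Continuous (weight c) := by
  have hd : deriv heteroclinic = fun x => 1 / (√2 * Real.cosh (x / √2) ^ 2) :=
    funext deriv_heteroclinic
  unfold weight
  rw [hd]
  refine Continuous.mul (Continuous.pow (Continuous.div continuous_const ?_ fun x => ?_) 2) ?_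
  · exact continuous_const.mul ((Real.continuous_cosh.comp (continuous_id.div_const _)).pow 2)
  · have hc := Real.cosh_pos (x / √2)
    positivity
  · fun_prop

theorem weight_neg (c x : ℝ) : weight c (-x) = weight (-c) x := by
  rw [weight, weight, deriv_heteroclinic, deriv_heteroclinic, neg_div, Real.cosh_neg, neg_mul,
    mul_neg]

/-- H_x² decays like e^{-2√2|x|}, so an exponential factor of rate at most √2 leaves a decay of rate
√2. -/
theorem weight_le {c : ℝ} (hc : |c| ≤ √2) (x : ℝ) : weight c x ≤ 8 * Real.exp (-√2 * |x|) := by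
  have h2 : (0 : ℝ) < √2 := by positivity
  have hs : √2 * √2 = 2 := Real.mul_self_sqrt (by norm_num)
  have hcosh : Real.exp (|x| / √2) / 2 ≤ Real.cosh (x / √2) := by
    rw [← Real.cosh_abs, abs_div, abs_of_pos h2, Real.cosh_eq]
    linarith [Real.exp_pos (-(|x| / √2))]
  have hE := Real.exp_pos (|x| / √2)
  have hd : deriv heteroclinic x ^ 2 ≤ 8 * Real.exp (-(2 * √2) * |x|) := by
    have h1 : (Real.exp (|x| / √2) / 2) ^ 4 ≤ Real.cosh (x / √2) ^ 4 := by gcongr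
    have h3 : Real.exp (-(2 * √2) * |x|) = (Real.exp (|x| / √2) ^ 4)⁻¹ := by
      rw [← Real.exp_nat_mul, ← Real.exp_neg]
      congr 1
      field_simp
      push_cast
      rw [Real.sq_sqrt (by norm_num)]
      ring
    have h4 : deriv heteroclinic x ^ 2 = (2 * Real.cosh (x / √2) ^ 4)⁻¹ := by
      rw [deriv_heteroclinic, one_div, inv_pow, mul_pow, sq √2, hs, ← pow_mul]
    rw [h3, h4, ← div_eq_mul_inv, inv_le_comm₀ (by positivity) (by positivity), inv_div]
    rw [div_pow] at h1
    linarith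
  have hexp : Real.exp (c * x) ≤ Real.exp (√2 * |x|) := by
    refine Real.exp_le_exp.2 ((le_abs_self _).trans ?_)
    rw [abs_mul]
    gcongr
  calc weight c x ≤ (8 * Real.exp (-(2 * √2) * |x|)) * Real.exp (√2 * |x|) := by
        unfold weight; gcongr
    _ = 8 * Real.exp (-√2 * |x|) := by
        rw [mul_assoc, ← Real.exp_add]; ring_nf

theorem weight_le_exp {c : ℝ} (hc : |c| ≤ √2) (x : ℝ) : weight c x ≤ 8 * Real.exp (√2 * x) := by
  refine (weight_le hc x).trans ?_
  rw [neg_mul, ← mul_neg]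
  gcongr
  exact neg_abs_le x

theorem integrable_weight {c : ℝ} (hc : |c| ≤ √2) : Integrable (weight c) := by
  have h2 : (0 : ℝ) < √2 := by positivity
  have key : ∀ c : ℝ, |c| ≤ √2 → IntegrableOn (weight c) (Iic 0) := fun c hc => by
    refine ((integrableOn_exp_mul_Iic h2 0).const_mul 8).mono'
      (continuous_weight c).aestronglyMeasurable (ae_of_all _ fun x => ?_)
    rw [Real.norm_of_nonneg (weight_pos c x).le]
    exact weight_le_exp hc x
  rw [← integrableOn_univ, ← Iic_union_Ici (a := (0 : ℝ))]
  refine (key c hc).union ?_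
  have h := key (-c) (by rwa [abs_neg])
  have := (Measure.measurePreserving_neg (volume : Measure ℝ)).integrableOn_comp_preimage
    (Homeomorph.neg ℝ).measurableEmbedding (f := weight c) (s := Ici 0)
  rw [← this]
  have e : Neg.neg ⁻¹' (Ici (0 : ℝ)) = Iic 0 := by ext; simp
  rw [e]
  exact h.congr_fun (fun x _ => by simp [weight_neg]) measurableSet_Iic

theorem integral_weight_pos {c : ℝ} (hc : |c| ≤ √2) : 0 < ∫ x, weight c x := by
  refine (integral_pos_iff_support_of_nonneg (fun x => (weight_pos c x).le)
    (integrable_weight hc)).2 ?_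
  have : Function.support (weight c) = univ := by
    ext x; simp [(weight_pos c x).ne']
  rw [this]
  simp

theorem gammaZero_pos : 0 < gammaZero := by
  have h := integral_weight_pos (c := 0) (by simp)
  simpa [weight, gammaZero] using h

/-- The common limit of the coefficients `γ_{1,j}` and `γ_{2,j}`. -/
noncomputable def gammaLimit : ℝ := ∫ x, weight (√2) x

theorem gammaLimit_pos : 0 < gammaLimit :=
  integral_weight_pos (abs_of_nonneg (Real.sqrt_nonneg 2)).le

theorem integral_weight_neg_sqrt_two : ∫ x, weight (-√2) x = gammaLimit := by
  rw [gammaLimit, ← integral_neg_eq_self (weight √2)]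
  simp [weight_neg]

/-! ### Tails of the weights cut by a smooth step -/

/-- A step from `0` to `1` across `[-δ, δ]`, Lipschitz with constant `Λ`. -/
structure IsStep (δ Λ : ℝ) (ϑ : ℝ → ℝ) : Prop where
  mem_Icc : ∀ u, ϑ u ∈ Icc (0 : ℝ) 1
  eq_zero : ∀ u, u ≤ -δ → ϑ u = 0
  eq_one : ∀ u, δ ≤ u → ϑ u = 1
  lip : ∀ u v, |ϑ u - ϑ v| ≤ Λ * |u - v|

/-- The reflected step `u ↦ 1 - ϑ (-u)`. -/
def reflectStep (ϑ : ℝ → ℝ) (u : ℝ) : ℝ := 1 - ϑ (-u)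

namespace IsStep

variable {δ Λ : ℝ} {ϑ : ℝ → ℝ}

theorem reflect (h : IsStep δ Λ ϑ) : IsStep δ Λ (reflectStep ϑ) where
  mem_Icc u := by have := h.mem_Icc (-u); simp only [reflectStep, Set.mem_Icc] at *; grind
  eq_zero u hu := by simp [reflectStep, h.eq_one (-u) (by linarith)]
  eq_one u hu := by simp [reflectStep, h.eq_zero (-u) (by linarith)]
  lip u v := by
    have := h.lip (-u) (-v)
    rw [← abs_neg (u - v), ← abs_neg (reflectStep ϑ u - _)]
    convert this using 2 <;> simp [reflectStep]
    ring_nf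

theorem lip_nonneg (h : IsStep δ Λ ϑ) : 0 ≤ Λ := by
  have := (abs_nonneg _).trans (h.lip 1 0)
  simpa using this

theorem continuous (h : IsStep δ Λ ϑ) : Continuous ϑ :=
  (LipschitzWith.of_dist_le_mul (K := Λ.toNNReal) fun x y => by
    rw [Real.coe_toNNReal _ h.lip_nonneg]; exact h.lip x y).continuous

/-- The derivative vanishes outside the compact interval [-δ, δ], where it is bounded. -/
theorem exists_of_contDiff (hs : ContDiff ℝ 1 ϑ) (hI : ∀ u, ϑ u ∈ Icc (0 : ℝ) 1)
    (h0 : ∀ u, u ≤ -δ → ϑ u = 0) (h1 : ∀ u, δ ≤ u → ϑ u = 1) : ∃ Λ, IsStep δ Λ ϑ := by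
  have hc : Continuous (deriv ϑ) := hs.continuous_deriv le_rfl
  obtain ⟨M, hM⟩ := (isCompact_Icc (a := -δ) (b := δ)).exists_bound_of_continuousOn hc.continuousOn
  refine ⟨max M 0, hI, h0, h1, fun u v => ?_⟩
  have hb : ∀ x, ‖deriv ϑ x‖ ≤ max M 0 := fun x => by
    by_cases hx : x ∈ Icc (-δ) δ
    · exact (hM x hx).trans (le_max_left _ _)
    · have : deriv ϑ x = 0 := by
        rw [Set.mem_Icc, not_and_or, not_le, not_le] at hx
        rcases hx with hx | hx
        · have : ϑ =ᶠ[𝓝 x] fun _ => 0 := by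
            filter_upwards [Iio_mem_nhds hx] with y hy using h0 y (le_of_lt hy)
          rw [this.deriv_eq, deriv_const]
        · have : ϑ =ᶠ[𝓝 x] fun _ => 1 := by
            filter_upwards [Ioi_mem_nhds hx] with y hy using h1 y (le_of_lt hy)
          rw [this.deriv_eq, deriv_const]
      rw [this, norm_zero]
      exact le_max_right _ _
  have := Convex.norm_image_sub_le_of_norm_deriv_le (f := ϑ) (s := univ) (C := max M 0)
    (fun x _ => (hs.differentiable one_ne_zero).differentiableAt) (fun x _ => hb x) convex_univ
    (mem_univ v) (mem_univ u)
  simpa [Real.norm_eq_abs] using this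

/-- Changing b alone would cost a factor |u'|, which is unbounded. But once |u'| ≥ Bδ both arguments
lie where the step is constant, so only |u'| ≤ Bδ counts. -/
theorem abs_comp_div_sub_le {m B : ℝ} (h : IsStep δ Λ ϑ) (hδ : 0 ≤ δ) (hm : 0 < m)
    {b b' u u' : ℝ} (hb : m ≤ b) (hb' : m ≤ b') (hB : b ≤ B) (hB' : b' ≤ B) :
    |ϑ (u / b) - ϑ (u' / b')| ≤ Λ * (m⁻¹ + B * δ * (m⁻¹ * m⁻¹)) * (|b - b'| + |u - u'|) := by
  have hΛ := h.lip_nonneg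
  have hb0 : 0 < b := hm.trans_le hb
  have hb0' : 0 < b' := hm.trans_le hb'
  have hB0 : 0 < B := hb0.trans_le hB
  have hi : b⁻¹ ≤ m⁻¹ := inv_anti₀ hm hb
  have hi' : b'⁻¹ ≤ m⁻¹ := inv_anti₀ hm hb'
  have hm' : 0 < m⁻¹ := inv_pos.2 hm
  have h1 : |ϑ (u / b) - ϑ (u' / b)| ≤ Λ * (m⁻¹ * |u - u'|) := by
    refine (h.lip _ _).trans ?_
    rw [← sub_div, abs_div, abs_of_pos hb0, div_eq_inv_mul]
    gcongr
  have h2 : |ϑ (u' / b) - ϑ (u' / b')| ≤ Λ * (B * δ * (m⁻¹ * m⁻¹) * |b - b'|) := by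
    have hnn : 0 ≤ Λ * (B * δ * (m⁻¹ * m⁻¹) * |b - b'|) := by positivity
    have far : ∀ {c}, 0 < c → c ≤ B → B * δ ≤ u' → δ ≤ u' / c := fun hc hcB hu => by
      rw [le_div_iff₀ hc]; nlinarith
    have far' : ∀ {c}, 0 < c → c ≤ B → u' ≤ -(B * δ) → u' / c ≤ -δ := fun hc hcB hu => by
      rw [div_le_iff₀ hc]; nlinarith
    rcases le_total (B * δ) u' with hu | hu
    · rw [h.eq_one _ (far hb0 hB hu), h.eq_one _ (far hb0' hB' hu)]
      simpa using hnn
    rcases le_total u' (-(B * δ)) with hu' | hu'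
    · rw [h.eq_zero _ (far' hb0 hB hu'), h.eq_zero _ (far' hb0' hB' hu')]
      simpa using hnn
    refine (h.lip _ _).trans ?_
    have e : u' / b - u' / b' = u' * (b⁻¹ * b'⁻¹) * (b' - b) := by field_simp
    rw [e, abs_mul, abs_mul, abs_of_pos (mul_pos (inv_pos.2 hb0) (inv_pos.2 hb0')),
      abs_sub_comm b' b]
    have : |u'| ≤ B * δ := abs_le.2 ⟨hu', hu⟩
    gcongr
  have h3 := abs_sub_le (ϑ (u / b)) (ϑ (u' / b)) (ϑ (u' / b'))
  have h4 : 0 ≤ Λ * (m⁻¹ * |b - b'|) := by positivity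
  have h5 : 0 ≤ Λ * (B * δ * (m⁻¹ * m⁻¹) * |u - u'|) := by positivity
  linarith

end IsStep

/-- The part of the weight `H_x² e^{c x}` removed by the step at `x = -Y`. -/
noncomputable def tail (ϑ : ℝ → ℝ) (c b Y : ℝ) : ℝ := ∫ x, (1 - ϑ ((x + Y) / b)) * weight c x

theorem IsStep.integrable_tail {δ Λ c b Y : ℝ} {ϑ : ℝ → ℝ} (h : IsStep δ Λ ϑ) (hc : |c| ≤ √2) :
    Integrable fun x => (1 - ϑ ((x + Y) / b)) * weight c x := by
  refine (integrable_weight hc).bdd_mul (c := 1) ?_ (ae_of_all _ fun x => ?_)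
  · exact (continuous_const.sub (h.continuous.comp
      ((continuous_id.add continuous_const).div_const b))).aestronglyMeasurable
  · have := h.mem_Icc ((x + Y) / b)
    rw [Real.norm_eq_abs, abs_le]
    simp only [Set.mem_Icc] at this
    constructor <;> linarith

/-- The integrand lives on x ≤ x₀, where the weight is at most 8e^{√2x}. -/
theorem abs_integral_mul_weight_le {c M x₀ : ℝ} {g : ℝ → ℝ} (hc : |c| ≤ √2) (hM : 0 ≤ M)
    (hg : ∀ x, |g x| ≤ M) (h0 : ∀ x, x₀ < x → g x = 0) :
    |∫ x, g x * weight c x| ≤ 8 * M * Real.exp (√2 * x₀) := by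
  have h2 : (0 : ℝ) < √2 := by positivity
  have hIntegrable := (integrableOn_exp_mul_Iic h2 x₀).const_mul (8 * M)
  have hle : ∀ᵐ x, ‖g x * weight c x‖ ≤
      (Iic x₀).indicator (fun x => 8 * M * Real.exp (√2 * x)) x := by
    refine ae_of_all _ fun x => ?_
    by_cases hx : x ≤ x₀
    · rw [indicator_of_mem (by exact hx), norm_mul, Real.norm_of_nonneg (weight_pos c x).le,
        Real.norm_eq_abs]
      calc |g x| * weight c x ≤ M * (8 * Real.exp (√2 * x)) :=
            mul_le_mul (hg x) (weight_le_exp hc x) (weight_pos c x).le hM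
        _ = _ := by ring
    · rw [h0 x (not_le.1 hx), zero_mul, norm_zero]
      exact indicator_nonneg (fun y _ => by positivity) x
  have h := norm_integral_le_of_norm_le ((integrable_indicator_iff measurableSet_Iic).2 hIntegrable) hle
  rw [integral_indicator measurableSet_Iic, integral_const_mul, integral_exp_mul_Iic h2,
    Real.norm_eq_abs] at h
  refine h.trans ?_
  gcongr
  refine div_le_self (Real.exp_pos _).le ?_
  rw [Real.one_le_sqrt]
  norm_num

theorem IsStep.abs_tail_le {δ Λ c b B Y : ℝ} {ϑ : ℝ → ℝ} (h : IsStep δ Λ ϑ) (hδ : 0 ≤ δ)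
    (hc : |c| ≤ √2) (hb : 0 < b) (hB : b ≤ B) :
    |tail ϑ c b Y| ≤ 8 * Real.exp (√2 * (B * δ)) * Real.exp (-√2 * Y) := by
  have := abs_integral_mul_weight_le (c := c) (M := 1) (x₀ := B * δ - Y)
    (g := fun x => 1 - ϑ ((x + Y) / b)) hc zero_le_one (fun x => ?_) fun x hx => ?_
  · rw [mul_assoc, ← Real.exp_add]
    rw [mul_one] at this
    rwa [show √2 * (B * δ) + -√2 * Y = √2 * (B * δ - Y) by ring]
  · have := h.mem_Icc ((x + Y) / b)
    simp only [Set.mem_Icc] at this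
    rw [abs_le]
    constructor <;> linarith
  · rw [h.eq_one _ ?_, sub_self]
    rw [le_div_iff₀ hb]
    nlinarith

/-- Not only the tail but also its dependence on b and Y is exponentially small in Y: the two
integrands differ only for x ≤ Bδ + Y₀ - Y. The bound Y₀ on the displacement of Y fixes this common
support. -/
theorem IsStep.exists_tail_sub_le {δ Λ c m B Y₀ : ℝ} {ϑ : ℝ → ℝ} (h : IsStep δ Λ ϑ) (hδ : 0 ≤ δ)
    (hc : |c| ≤ √2) (hm : 0 < m) (hmB : m ≤ B) :
    ∃ C, 0 ≤ C ∧ ∀ b b' Y Y', m ≤ b → m ≤ b' → b ≤ B → b' ≤ B → |Y - Y'| ≤ Y₀ →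
      |tail ϑ c b Y - tail ϑ c b' Y'| ≤ C * Real.exp (-√2 * Y) * (|b - b'| + |Y - Y'|) := by
  have hΛ := h.lip_nonneg
  have hB0 : 0 < B := hm.trans_le hmB
  set M := Λ * (m⁻¹ + B * δ * (m⁻¹ * m⁻¹)) with hMdef
  have hM : 0 ≤ M := by positivity
  refine ⟨8 * M * Real.exp (√2 * (B * δ + Y₀)), by positivity,
    fun b b' Y Y' hb hb' hbB hbB' hY => ?_⟩
  have hb0 := hm.trans_le hb
  have hb0' := hm.trans_le hb'
  have hY2 := abs_le.1 hY
  have key := abs_integral_mul_weight_le (c := c) (M := M * (|b - b'| + |Y - Y'|))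
    (x₀ := B * δ + Y₀ - Y)
    (g := fun x => ϑ ((x + Y') / b') - ϑ ((x + Y) / b)) hc (by positivity) (fun x => ?_)
    fun x hx => ?_
  · have e : tail ϑ c b Y - tail ϑ c b' Y' =
        ∫ x, (ϑ ((x + Y') / b') - ϑ ((x + Y) / b)) * weight c x := by
      rw [tail, tail, ← integral_sub (h.integrable_tail hc) (h.integrable_tail hc)]
      exact integral_congr_ae (ae_of_all _ fun x => by ring)
    rw [e]
    refine key.trans (le_of_eq ?_)
    have : Real.exp (√2 * (B * δ + Y₀ - Y)) =
        Real.exp (√2 * (B * δ + Y₀)) * Real.exp (-√2 * Y) := by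
      rw [← Real.exp_add]; ring_nf
    rw [this]
    ring
  · rw [abs_sub_comm]
    have := h.abs_comp_div_sub_le hδ hm hb hb' hbB hbB' (u := x + Y) (u' := x + Y')
    rwa [add_sub_add_left_eq_sub] at this
  · have hY0 : 0 ≤ Y₀ := (abs_nonneg _).trans hY
    rw [h.eq_one ((x + Y') / b') ?_, h.eq_one ((x + Y) / b) ?_, sub_self]
    · rw [le_div_iff₀ hb0]; nlinarith
    · rw [le_div_iff₀ hb0']; nlinarith

end BoundaryLayers

namespace BoundaryLayers

/-! ### Families depending on a small scale and an angle

A point `p : ℝ × ℝ` consists of the scale `p.1 = √ε` and the angle `p.2 = θ`. -/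

/-- Two points whose scales are in `(0, s₁)` and comparable. -/
structure Near (s₁ : ℝ) (p q : ℝ × ℝ) : Prop where
  left_pos : 0 < p.1
  left_lt : p.1 < s₁
  right_pos : 0 < q.1
  right_lt : q.1 < s₁
  left_le : p.1 ≤ 2 * q.1
  right_le : q.1 ≤ 2 * p.1

namespace Near

variable {s₁ s₂ : ℝ} {p q : ℝ × ℝ}

theorem symm (h : Near s₁ p q) : Near s₁ q p :=
  ⟨h.right_pos, h.right_lt, h.left_pos, h.left_lt, h.right_le, h.left_le⟩

theorem refl (h0 : 0 < p.1) (h1 : p.1 < s₁) : Near s₁ p p :=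
  ⟨h0, h1, h0, h1, by linarith, by linarith⟩

theorem mono (h : Near s₂ p q) (hs : s₂ ≤ s₁) : Near s₁ p q :=
  ⟨h.left_pos, h.left_lt.trans_le hs, h.right_pos, h.right_lt.trans_le hs, h.left_le, h.right_le⟩

end Near

/-- Bounded families, Lipschitz with respect to the scale and the distance `d`. -/
def IsReg (s₁ : ℝ) (d : ℝ × ℝ → ℝ × ℝ → ℝ) (F : ℝ × ℝ → ℝ) : Prop :=
  ∃ C, 0 ≤ C ∧ ∀ p q, Near s₁ p q → |F p| ≤ C ∧ |F p - F q| ≤ C * (|p.1 - q.1| + d p q)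

/-- Families of the order of the scale, whose Lipschitz constant with respect to `d` is of that
order too. -/
def IsSmall (s₁ : ℝ) (d : ℝ × ℝ → ℝ × ℝ → ℝ) (F : ℝ × ℝ → ℝ) : Prop :=
  ∃ C, 0 ≤ C ∧ ∀ p q, Near s₁ p q →
    |F p| ≤ C * p.1 ∧ |F p - F q| ≤ C * (|p.1 - q.1| + p.1 * d p q)

theorem abs_mul_sub_mul_le (x y x' y' : ℝ) :
    |x * y - x' * y'| ≤ |x - x'| * |y| + |x'| * |y - y'| := by
  rw [← abs_mul, ← abs_mul]
  refine (le_of_eq ?_).trans (abs_add_le _ _)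
  ring_nf

section

variable {s₁ s₂ : ℝ} {d d' : ℝ × ℝ → ℝ × ℝ → ℝ} {F G : ℝ × ℝ → ℝ}

namespace IsReg

theorem const (hd : ∀ p q, 0 ≤ d p q) (c : ℝ) : IsReg s₁ d fun _ => c :=
  ⟨|c|, abs_nonneg c, fun p q _ => ⟨le_rfl, by
    rw [sub_self, abs_zero]
    have := hd p q
    positivity⟩⟩

theorem mono (hF : IsReg s₁ d F) (hs : s₂ ≤ s₁) : IsReg s₂ d F :=
  let ⟨C, hC, h⟩ := hF
  ⟨C, hC, fun p q hpq => h p q (hpq.mono hs)⟩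

theorem congr (hF : IsReg s₁ d F) (hG : ∀ p : ℝ × ℝ, 0 < p.1 → p.1 < s₁ → G p = F p) :
    IsReg s₁ d G := by
  obtain ⟨C, hC, h⟩ := hF
  refine ⟨C, hC, fun p q hpq => ?_⟩
  rw [hG p hpq.left_pos hpq.left_lt, hG q hpq.right_pos hpq.right_lt]
  exact h p q hpq

theorem mono_dist {B : ℝ} (hF : IsReg s₁ d F) (hB : 0 ≤ B)
    (hdd : ∀ p q, Near s₁ p q → d p q ≤ B * (|p.1 - q.1| + d' p q)) (hd' : ∀ p q, 0 ≤ d' p q) :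
    IsReg s₁ d' F := by
  obtain ⟨C, hC, h⟩ := hF
  refine ⟨C * (1 + B), by positivity, fun p q hpq => ⟨(h p q hpq).1.trans ?_,
    (h p q hpq).2.trans ?_⟩⟩
  · nlinarith
  · rw [mul_assoc]
    refine mul_le_mul_of_nonneg_left ?_ hC
    linarith [hdd p q hpq, hd' p q]

theorem add (hF : IsReg s₁ d F) (hG : IsReg s₁ d G) : IsReg s₁ d fun p => F p + G p := by
  obtain ⟨C, hC, h⟩ := hF
  obtain ⟨C', hC', h'⟩ := hG
  refine ⟨C + C', by positivity, fun p q hpq => ⟨?_, ?_⟩⟩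
  · exact (abs_add_le _ _).trans (add_le_add (h p q hpq).1 (h' p q hpq).1)
  · rw [add_sub_add_comm, add_mul]
    exact (abs_add_le _ _).trans (add_le_add (h p q hpq).2 (h' p q hpq).2)

theorem mul (hF : IsReg s₁ d F) (hG : IsReg s₁ d G) : IsReg s₁ d fun p => F p * G p := by
  obtain ⟨C, hC, h⟩ := hF
  obtain ⟨C', hC', h'⟩ := hG
  refine ⟨2 * (C * C'), by positivity, fun p q hpq => ⟨?_, ?_⟩⟩
  · rw [abs_mul]
    have := mul_le_mul (h p q hpq).1 (h' p q hpq).1 (abs_nonneg _) hC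
    have : 0 ≤ C * C' := by positivity
    linarith
  · refine (abs_mul_sub_mul_le _ _ _ _).trans ?_
    have h1 := mul_le_mul (h p q hpq).2 (h' p q hpq).1 (abs_nonneg _)
      ((abs_nonneg _).trans (h p q hpq).2)
    have h2 := mul_le_mul (h q p hpq.symm).1 (h' p q hpq).2 (abs_nonneg _) hC
    linarith

theorem neg (hF : IsReg s₁ d F) : IsReg s₁ d fun p => -F p := by
  obtain ⟨C, hC, h⟩ := hF
  refine ⟨C, hC, fun p q hpq => ⟨by rw [abs_neg]; exact (h p q hpq).1, ?_⟩⟩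
  rw [neg_sub_neg, abs_sub_comm]
  exact (h p q hpq).2

theorem sub (hF : IsReg s₁ d F) (hG : IsReg s₁ d G) : IsReg s₁ d fun p => F p - G p := by
  simpa only [sub_eq_add_neg] using hF.add hG.neg

theorem const_mul (hd : ∀ p q, 0 ≤ d p q) (hF : IsReg s₁ d F) (c : ℝ) :
    IsReg s₁ d fun p => c * F p := (const hd c).mul hF

/-- A Lipschitz bound is required only on a set containing the values, which covers exp, log,
inverse and square root. -/
theorem comp (hF : IsReg s₁ d F) {g : ℝ → ℝ} {S : Set ℝ} {L x₀ : ℝ} (hL : 0 ≤ L) (hx₀ : x₀ ∈ S)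
    (hg : ∀ x ∈ S, ∀ y ∈ S, |g x - g y| ≤ L * |x - y|)
    (hS : ∀ p : ℝ × ℝ, 0 < p.1 → p.1 < s₁ → F p ∈ S) (hd : ∀ p q, 0 ≤ d p q) :
    IsReg s₁ d fun p => g (F p) := by
  obtain ⟨C, hC, h⟩ := hF
  refine ⟨|g x₀| + L * (C + |x₀|) + L * C, by positivity, fun p q hpq => ⟨?_, ?_⟩⟩
  · have h1 := hg (F p) (hS p hpq.left_pos hpq.left_lt) x₀ hx₀
    have h2 : |F p - x₀| ≤ C + |x₀| := (abs_sub _ _).trans (by linarith [(h p q hpq).1])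
    have h3 := abs_sub_abs_le_abs_sub (g (F p)) (g x₀)
    have h4 := mul_le_mul_of_nonneg_left h2 hL
    have h5 := mul_nonneg hL hC
    linarith
  · refine (hg _ (hS p hpq.left_pos hpq.left_lt) _ (hS q hpq.right_pos hpq.right_lt)).trans ?_
    have h1 := mul_le_mul_of_nonneg_left (h p q hpq).2 hL
    have h2 : 0 ≤ (|g x₀| + L * (C + |x₀|)) * (|p.1 - q.1| + d p q) := by
      have := hd p q
      positivity
    linarith

theorem exp (hF : IsReg s₁ d F) (hd : ∀ p q, 0 ≤ d p q) :
    IsReg s₁ d fun p => Real.exp (F p) := by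
  obtain ⟨C, hC, h⟩ := id hF
  have key : ∀ x y, x ≤ C → Real.exp x - Real.exp y ≤ Real.exp C * |x - y| := fun x y hx => by
    have h1 : 1 - Real.exp (y - x) ≤ |x - y| := by
      linarith [Real.add_one_le_exp (y - x), le_abs_self (x - y)]
    have h2 : Real.exp x - Real.exp y = Real.exp x * (1 - Real.exp (y - x)) := by
      rw [mul_sub, mul_one, ← Real.exp_add]; ring_nf
    rw [h2]
    exact (mul_le_mul_of_nonneg_left h1 (Real.exp_pos x).le).trans (by gcongr)
  refine hF.comp (g := Real.exp) (S := Iic C) (x₀ := C) (Real.exp_pos C).le (by simp)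
    (fun x hx y hy => abs_sub_le_iff.2 ⟨key x y hx, ?_⟩) (fun p h0 h1 => ?_) hd
  · rw [abs_sub_comm]; exact key y x hy
  · exact (le_abs_self _).trans (h p p (Near.refl h0 h1)).1

theorem log {m : ℝ} (hm : 0 < m) (hF : IsReg s₁ d F)
    (hmF : ∀ p : ℝ × ℝ, 0 < p.1 → p.1 < s₁ → m ≤ F p) (hd : ∀ p q, 0 ≤ d p q) :
    IsReg s₁ d fun p => Real.log (F p) := by
  have key : ∀ x y, m ≤ x → m ≤ y → Real.log x - Real.log y ≤ m⁻¹ * |x - y| := fun x y hx hy => by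
    have hx0 := hm.trans_le hx
    have hy0 := hm.trans_le hy
    rw [← Real.log_div hx0.ne' hy0.ne']
    calc Real.log (x / y) ≤ x / y - 1 := Real.log_le_sub_one_of_pos (by positivity)
      _ = y⁻¹ * (x - y) := by field_simp
      _ ≤ y⁻¹ * |x - y| := mul_le_mul_of_nonneg_left (le_abs_self _) (inv_pos.2 hy0).le
      _ ≤ m⁻¹ * |x - y| := mul_le_mul_of_nonneg_right (inv_anti₀ hm hy) (abs_nonneg _)
  refine hF.comp (g := Real.log) (S := Ici m) (x₀ := m) (inv_pos.2 hm).le (by simp)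
    (fun x hx y hy => abs_sub_le_iff.2 ⟨key x y hx hy, ?_⟩) hmF hd
  rw [abs_sub_comm]
  exact key y x hy hx

theorem inv {m : ℝ} (hm : 0 < m) (hF : IsReg s₁ d F)
    (hmF : ∀ p : ℝ × ℝ, 0 < p.1 → p.1 < s₁ → m ≤ F p) (hd : ∀ p q, 0 ≤ d p q) :
    IsReg s₁ d fun p => (F p)⁻¹ := by
  refine hF.comp (g := fun x => x⁻¹) (S := Ici m) (L := m⁻¹ * m⁻¹) (x₀ := m) (by positivity)
    (by simp) (fun x hx y hy => ?_) hmF hd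
  have hx0 : 0 < x := hm.trans_le hx
  have hy0 : 0 < y := hm.trans_le hy
  have e : x⁻¹ - y⁻¹ = (y - x) * (x⁻¹ * y⁻¹) := by field_simp
  rw [e, abs_mul, abs_of_pos (mul_pos (inv_pos.2 hx0) (inv_pos.2 hy0)), abs_sub_comm, mul_comm]
  gcongr
  · exact hx
  · exact hy

theorem sqrt {m : ℝ} (hm : 0 < m) (hF : IsReg s₁ d F)
    (hmF : ∀ p : ℝ × ℝ, 0 < p.1 → p.1 < s₁ → m ≤ F p) (hd : ∀ p q, 0 ≤ d p q) :
    IsReg s₁ d fun p => √(F p) := by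
  refine hF.comp (g := fun x => √x) (S := Ici m) (L := (√m)⁻¹) (x₀ := m) (by positivity)
    (by simp) (fun x hx y hy => ?_) hmF hd
  have hx0 : 0 < x := hm.trans_le hx
  have hy0 : 0 < y := hm.trans_le hy
  have hsx : √m ≤ √x := Real.sqrt_le_sqrt hx
  have hsm : 0 < √m := Real.sqrt_pos.2 hm
  have hsy : 0 ≤ √y := Real.sqrt_nonneg y
  have e : x - y = (√x + √y) * (√x - √y) := by
    linarith [Real.mul_self_sqrt hx0.le, Real.mul_self_sqrt hy0.le]
  rw [e, abs_mul, abs_of_pos (by positivity : 0 < √x + √y), ← mul_assoc]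
  refine le_mul_of_one_le_left (abs_nonneg _) ?_
  rw [inv_mul_eq_div, one_le_div hsm]
  linarith

theorem sum {ι : Type*} (I : Finset ι) {F : ι → ℝ × ℝ → ℝ} (hd : ∀ p q, 0 ≤ d p q)
    (hF : ∀ i ∈ I, IsReg s₁ d (F i)) : IsReg s₁ d fun p => ∑ i ∈ I, F i p := by
  classical
  induction I using Finset.induction_on with
  | empty => simpa using const hd 0
  | insert i I hi ih =>
    simp only [Finset.sum_insert hi]
    exact (hF i (by simp)).add (ih fun j hj => hF j (by simp [hj]))

end IsReg

namespace IsSmall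

theorem zero : IsSmall s₁ d fun _ => 0 :=
  ⟨0, le_rfl, fun p q _ => by simp⟩

theorem mono (hF : IsSmall s₁ d F) (hs : s₂ ≤ s₁) : IsSmall s₂ d F :=
  let ⟨C, hC, h⟩ := hF
  ⟨C, hC, fun p q hpq => h p q (hpq.mono hs)⟩

theorem congr (hF : IsSmall s₁ d F) (hG : ∀ p : ℝ × ℝ, 0 < p.1 → p.1 < s₁ → G p = F p) :
    IsSmall s₁ d G := by
  obtain ⟨C, hC, h⟩ := hF
  refine ⟨C, hC, fun p q hpq => ?_⟩
  rw [hG p hpq.left_pos hpq.left_lt, hG q hpq.right_pos hpq.right_lt]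
  exact h p q hpq

/-- Serves to replace `gapDist` by `angleDist` once the gaps are known to be Lipschitz. The
additional term p.1·|p.1 - q.1| is harmless because scales are at most 1. -/
theorem mono_dist {B : ℝ} (hF : IsSmall s₁ d F) (hB : 0 ≤ B) (hs₁ : s₁ ≤ 1)
    (hdd : ∀ p q, Near s₁ p q → d p q ≤ B * (|p.1 - q.1| + d' p q)) (hd' : ∀ p q, 0 ≤ d' p q) :
    IsSmall s₁ d' F := by
  obtain ⟨C, hC, h⟩ := hF
  refine ⟨C * (1 + B), by positivity, fun p q hpq => ⟨(h p q hpq).1.trans ?_,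
    (h p q hpq).2.trans ?_⟩⟩
  · have := hpq.left_pos
    gcongr
    nlinarith
  · rw [mul_assoc]
    refine mul_le_mul_of_nonneg_left ?_ hC
    have h1 := mul_le_mul_of_nonneg_left (hdd p q hpq) hpq.left_pos.le
    have h2 : p.1 * |p.1 - q.1| ≤ 1 * |p.1 - q.1| := by
      gcongr
      linarith [hpq.left_lt]
    have h3 := mul_nonneg hpq.left_pos.le (hd' p q)
    have h4 := mul_le_mul_of_nonneg_left h2 hB
    linarith

theorem add (hF : IsSmall s₁ d F) (hG : IsSmall s₁ d G) : IsSmall s₁ d fun p => F p + G p := by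
  obtain ⟨C, hC, h⟩ := hF
  obtain ⟨C', hC', h'⟩ := hG
  refine ⟨C + C', by positivity, fun p q hpq => ⟨?_, ?_⟩⟩
  · rw [add_mul]
    exact (abs_add_le _ _).trans (add_le_add (h p q hpq).1 (h' p q hpq).1)
  · rw [add_sub_add_comm, add_mul]
    exact (abs_add_le _ _).trans (add_le_add (h p q hpq).2 (h' p q hpq).2)

theorem neg (hF : IsSmall s₁ d F) : IsSmall s₁ d fun p => -F p := by
  obtain ⟨C, hC, h⟩ := hF
  refine ⟨C, hC, fun p q hpq => ⟨by rw [abs_neg]; exact (h p q hpq).1, ?_⟩⟩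
  rw [neg_sub_neg, abs_sub_comm]
  exact (h p q hpq).2

theorem sub (hF : IsSmall s₁ d F) (hG : IsSmall s₁ d G) : IsSmall s₁ d fun p => F p - G p := by
  simpa only [sub_eq_add_neg] using hF.add hG.neg

theorem mul_reg (hF : IsSmall s₁ d F) (hG : IsReg s₁ d G) (hs₁ : s₁ ≤ 1)
    (hd : ∀ p q, 0 ≤ d p q) : IsSmall s₁ d fun p => F p * G p := by
  obtain ⟨C, hC, h⟩ := hF
  obtain ⟨C', hC', h'⟩ := hG
  have hCC : 0 ≤ C * C' := by positivity
  refine ⟨3 * (C * C'), by positivity, fun p q hpq => ⟨?_, ?_⟩⟩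
  · rw [abs_mul]
    have h1 := mul_le_mul (h p q hpq).1 (h' p q hpq).1 (abs_nonneg _)
      (mul_nonneg hC hpq.left_pos.le)
    have h2 := mul_nonneg hCC hpq.left_pos.le
    linarith
  · refine (abs_mul_sub_mul_le _ _ _ _).trans ?_
    have h1 := mul_le_mul (h p q hpq).2 (h' p q hpq).1 (abs_nonneg _)
      ((abs_nonneg _).trans (h p q hpq).2)
    have h2 := mul_le_mul (h q p hpq.symm).1 (h' p q hpq).2 (abs_nonneg _)
      (mul_nonneg hC hpq.right_pos.le)
    have h3 : q.1 * |p.1 - q.1| ≤ 1 * |p.1 - q.1| := by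
      gcongr
      linarith [hpq.right_lt]
    -- Comparability of the scales trades the weight `q.1` for `p.1`.
    have h4 : q.1 * d p q ≤ 2 * p.1 * d p q := mul_le_mul_of_nonneg_right hpq.right_le (hd p q)
    have h5 := mul_le_mul_of_nonneg_left (add_le_add h3 h4) hCC
    have h6 : 0 ≤ C * C' * |p.1 - q.1| := by positivity
    linarith

theorem isReg (hF : IsSmall s₁ d F) (hs₁ : s₁ ≤ 1) (hd : ∀ p q, 0 ≤ d p q) : IsReg s₁ d F := by
  obtain ⟨C, hC, h⟩ := hF
  refine ⟨C, hC, fun p q hpq => ⟨(h p q hpq).1.trans ?_, (h p q hpq).2.trans ?_⟩⟩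
  · exact mul_le_of_le_one_right hC (by linarith [hpq.left_lt])
  · refine mul_le_mul_of_nonneg_left ?_ hC
    have := mul_le_mul_of_nonneg_right (by linarith [hpq.left_lt] : p.1 ≤ 1) (hd p q)
    linarith

theorem sum {ι : Type*} (I : Finset ι) {F : ι → ℝ × ℝ → ℝ}
    (hF : ∀ i ∈ I, IsSmall s₁ d (F i)) : IsSmall s₁ d fun p => ∑ i ∈ I, F i p := by
  classical
  induction I using Finset.induction_on with
  | empty => simpa using zero
  | insert i I hi ih =>
    simp only [Finset.sum_insert hi]
    exact (hF i (by simp)).add (ih fun j hj => hF j (by simp [hj]))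

end IsSmall

/-- The logarithm of the scale is not Lipschitz near 0, but at comparable scales its increments are
bounded, and they become Lipschitz after multiplication by the scale. This is the reason for the
comparability conditions in `Near`. -/
theorem Near.abs_log_sub_log_le {p q : ℝ × ℝ} (h : Near s₁ p q) :
    |Real.log p.1 - Real.log q.1| ≤ 1 ∧
      p.1 * |Real.log p.1 - Real.log q.1| ≤ 2 * |p.1 - q.1| := by
  have key : ∀ x y : ℝ, 0 < x → 0 < y → Real.log x - Real.log y ≤ (x - y) / y :=
    fun x y hx hy => by
      rw [← Real.log_div hx.ne' hy.ne']
      refine (Real.log_le_sub_one_of_pos (by positivity)).trans (le_of_eq ?_)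
      field_simp
  have hp := h.left_pos
  have hq := h.right_pos
  have h1 := key _ _ hp hq
  have h2 := key _ _ hq hp
  refine ⟨abs_sub_le_iff.2 ⟨h1.trans ?_, h2.trans ?_⟩, ?_⟩
  · rw [div_le_one hq]; linarith [h.left_le]
  · rw [div_le_one hp]; linarith [h.right_le]
  · rw [← le_div_iff₀' hp]
    refine abs_sub_le_iff.2 ⟨h1.trans ?_, h2.trans ?_⟩
    · rw [div_le_div_iff₀ hq hp]
      have := le_abs_self (p.1 - q.1)
      nlinarith [abs_nonneg (p.1 - q.1), h.left_le]
    · gcongr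
      have := neg_abs_le (p.1 - q.1)
      have := abs_nonneg (p.1 - q.1)
      linarith

/-- Hypothesis `hY` places the step at √2 Y = -log(scale) + O(1), so e^{-√2Y} is of the order of the
scale and so are the tail and its Lipschitz constants. The logarithm contained in Y is compensated
by this extra factor of the scale. -/
theorem IsStep.isSmall_tail {δ Λ c m : ℝ} {ϑ : ℝ → ℝ} {b Y : ℝ × ℝ → ℝ} (h : IsStep δ Λ ϑ)
    (hδ : 0 ≤ δ) (hc : |c| ≤ √2) (hm : 0 < m) (hs₁ : s₁ ≤ 1) (hd : ∀ p q, 0 ≤ d p q)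
    (hb : IsReg s₁ d b) (hmb : ∀ p : ℝ × ℝ, 0 < p.1 → p.1 < s₁ → m ≤ b p)
    (hY : IsReg s₁ d fun p => √2 * Y p + Real.log p.1) :
    IsSmall s₁ d fun p => tail ϑ c (b p) (Y p) := by
  obtain ⟨B, hB, hb⟩ := hb
  obtain ⟨Z, hZ, hY⟩ := hY
  simp only at hY
  have h2 : (1 : ℝ) ≤ √2 := by rw [Real.one_le_sqrt]; norm_num
  obtain ⟨T, hT, hdiff⟩ := h.exists_tail_sub_le (Y₀ := 2 * Z + 1) hδ hc hm (le_max_left m B)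
  have hbB : ∀ p q, Near s₁ p q → b p ≤ max m B := fun p q hpq =>
    ((le_abs_self _).trans (hb p q hpq).1).trans (le_max_right _ _)
  have hexp : ∀ p q, Near s₁ p q → Real.exp (-√2 * Y p) ≤ Real.exp Z * p.1 := fun p q hpq => by
    rw [← Real.exp_log hpq.left_pos, ← Real.exp_add]
    refine Real.exp_le_exp.2 ?_
    have := neg_abs_le (√2 * Y p + Real.log p.1)
    linarith [(hY p q hpq).1]
  set T' := 8 * Real.exp (√2 * (max m B * δ)) with hT'
  have hT'0 : 0 ≤ T' := by positivity
  have hE := Real.exp_pos Z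
  refine ⟨T' * Real.exp Z + T * Real.exp Z * (B + Z + 2), by positivity,
    fun p q hpq => ⟨?_, ?_⟩⟩
  · have hp := hpq.left_pos
    have h1 := h.abs_tail_le (Y := Y p) hδ hc (hm.trans_le (hmb p hpq.left_pos hpq.left_lt))
      (hbB p q hpq)
    have h3 := mul_le_mul_of_nonneg_left (hexp p q hpq) hT'0
    have h4 : 0 ≤ T * Real.exp Z * (B + Z + 2) * p.1 := by positivity
    linarith
  · obtain ⟨l1, l2⟩ := hpq.abs_log_sub_log_le
    have hp := hpq.left_pos
    have hdp := hd p q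
    have hYd : |Y p - Y q| ≤ |√2 * Y p + Real.log p.1 - (√2 * Y q + Real.log q.1)| +
        |Real.log p.1 - Real.log q.1| := by
      have e : √2 * (Y p - Y q) = √2 * Y p + Real.log p.1 - (√2 * Y q + Real.log q.1) -
        (Real.log p.1 - Real.log q.1) := by ring
      have h3 : |Y p - Y q| ≤ |√2 * (Y p - Y q)| := by
        rw [abs_mul, abs_of_pos (by positivity : (0 : ℝ) < √2)]
        exact le_mul_of_one_le_left (abs_nonneg _) h2
      rw [e] at h3
      exact h3.trans (abs_sub _ _)
    have hY0 : |Y p - Y q| ≤ 2 * Z + 1 := by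
      have := abs_sub (√2 * Y p + Real.log p.1) (√2 * Y q + Real.log q.1)
      linarith [(hY p q hpq).1, (hY q p hpq.symm).1]
    refine (hdiff _ _ _ _ (hmb p hpq.left_pos hpq.left_lt) (hmb q hpq.right_pos hpq.right_lt)
      (hbB p q hpq) (hbB q p hpq.symm) hY0).trans ?_
    set t := |p.1 - q.1| + d p q with ht
    have hpt : p.1 * t ≤ |p.1 - q.1| + p.1 * d p q := by
      rw [ht, mul_add]
      gcongr
      exact mul_le_of_le_one_left (abs_nonneg _) (by linarith [hpq.left_lt])
    have h3 : p.1 * (|b p - b q| + |Y p - Y q|) ≤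
        (B + Z + 2) * (|p.1 - q.1| + p.1 * d p q) := by
      have h4 := mul_le_mul_of_nonneg_left (hb p q hpq).2 hp.le
      have h5 := mul_le_mul_of_nonneg_left (hYd.trans (add_le_add_left (hY p q hpq).2 _)) hp.le
      have h6 := mul_le_mul_of_nonneg_left hpt (add_nonneg hB hZ)
      have h7 : 0 ≤ p.1 * d p q := by positivity
      linarith
    calc T * Real.exp (-√2 * Y p) * (|b p - b q| + |Y p - Y q|)
        ≤ T * (Real.exp Z * p.1) * (|b p - b q| + |Y p - Y q|) := by
          gcongr; exact hexp p q hpq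
      _ = T * Real.exp Z * (p.1 * (|b p - b q| + |Y p - Y q|)) := by ring
      _ ≤ T * Real.exp Z * ((B + Z + 2) * (|p.1 - q.1| + p.1 * d p q)) := by gcongr
      _ ≤ (T' * Real.exp Z + T * Real.exp Z * (B + Z + 2)) * (|p.1 - q.1| + p.1 * d p q) := by
          have : 0 ≤ T' * Real.exp Z * (|p.1 - q.1| + p.1 * d p q) := by positivity
          linarith

end

end BoundaryLayers

namespace BoundaryLayers

/-! ### Gaps between the layers and the coefficients `γ_{1,j}`, `γ_{2,j}` -/

theorem reflect_of_pos (f : ℕ → ℝ) {j : ℕ} (hj : 1 ≤ j) : reflect f j = f j := by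
  obtain ⟨k, rfl⟩ := Nat.exists_eq_add_of_le' hj
  rfl

theorem gap_one (f : ℕ → ℝ) : gap f 1 = 2 * f 1 := by
  change f 1 - -f 1 = 2 * f 1
  ring

theorem gap_add_two (f : ℕ → ℝ) (k : ℕ) : gap f (k + 2) = f (k + 2) - f (k + 1) := rfl

/-- The factorials and powers of ε in ḟ_j telescope to a single logarithm. The convention f₀ = -f₁
doubles ḟ₁, which is why the first gap obeys the same formula as the others. -/
theorem gap_position {N : ℕ} {b ε : ℝ} {fbar fcheck : ℕ → ℝ} (hb : 0 < b) (hε : 0 < ε) {j : ℕ}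
    (hj : 1 ≤ j) (hjN : j ≤ N) :
    √2 * b * gap (position N b ε fbar fcheck) j =
      -Real.log (((N : ℝ) - j + 1) * ε) + √2 * b * (gap fbar j + gap fcheck j) := by
  have h2 : √2 ≠ 0 := by positivity
  obtain ⟨k, rfl⟩ := Nat.exists_eq_add_of_le' hj
  obtain ⟨n, rfl⟩ := Nat.exists_eq_add_of_le' hjN
  rcases k with _ | k
  · have hf : ((n + (0 + 1) - 1).factorial : ℝ) ≠ 0 := by positivity
    simp only [zero_add, gap_one, position, fDot, Nat.cast_add, Nat.cast_one] at hf ⊢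
    rw [Nat.sub_self, pow_zero, mul_one, div_self hf,
      Real.log_one, one_div ((n + 1 : ℝ) * ε), Real.log_inv]
    field_simp
    ring_nf
  · have e1 : n + (k + 1 + 1) - (k + 1 + 1) = n := by omega
    have e2 : n + (k + 1 + 1) - (k + 1) = n + 1 := by omega
    have e3 : k + 1 + 1 - 1 = k + 1 := by omega
    have e4 : k + 1 - 1 = k := by omega
    have hF : ((n + (k + 1 + 1) - 1).factorial : ℝ) ≠ 0 := by positivity
    have hn : (n.factorial : ℝ) ≠ 0 := by positivity
    have hn1 : (n + 1 : ℝ) ≠ 0 := by positivity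
    have hlog : Real.log (n.factorial / ((n + (k + 1 + 1) - 1).factorial * ε ^ (k + 1))) -
        Real.log ((n + 1).factorial / ((n + (k + 1 + 1) - 1).factorial * ε ^ k)) =
        -Real.log ((n + 1) * ε) := by
      rw [← Real.log_div (by positivity) (by positivity), ← Real.log_inv]
      congr 1
      rw [Nat.factorial_succ]
      push_cast
      field_simp
      rw [pow_succ]
    have e5 : ((n + (k + 1 + 1) : ℕ) : ℝ) - ((k + 1 + 1 : ℕ) : ℝ) + 1 = n + 1 := by
      push_cast; ring
    rw [e5, ← hlog]
    simp only [gap_add_two, position, fDot, e1, e2, e3, e4]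
    field_simp
    ring

section

variable {N : ℕ} {δ Λ b : ℝ} {Θ : ℕ → ℝ → ℝ} {f : ℕ → ℝ} {j : ℕ}

theorem cutoff_eq (hb : b ≠ 0) (hj : 1 ≤ j) (x : ℝ) :
    cutoff N Θ f j (x / b + f j) = Θ j ((x + b * gap f j / 2) / b) -
      if j < N then Θ (j + 1) ((x - b * gap f (j + 1) / 2) / b) else 0 := by
  have h1 : x / b + f j - (reflect f (j - 1) + f j) / 2 = (x + b * gap f j / 2) / b := by
    rw [gap, reflect_of_pos f hj]
    field_simp
    ring
  have h2 : x / b + f j - (f j + f (j + 1)) / 2 = (x - b * gap f (j + 1) / 2) / b := by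
    rw [gap, Nat.add_sub_cancel, reflect_of_pos f hj, reflect_of_pos f (by omega : 1 ≤ j + 1)]
    field_simp
    ring
  rw [cutoff, h1, h2]

/-- The substitution x ↦ -x turns a right tail for c into a left tail for -c, so one estimate of
`tail` handles both sides of a cut-off. -/
theorem integral_step_mul_weight {ϑ : ℝ → ℝ} (h : IsStep δ Λ ϑ) {c : ℝ} (hc : |c| ≤ √2) (Y : ℝ) :
    Integrable (fun x => ϑ ((x - Y) / b) * weight c x) ∧
      ∫ x, ϑ ((x - Y) / b) * weight c x = tail (reflectStep ϑ) (-c) b Y := by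
  have e : ∀ x, (1 - reflectStep ϑ ((x + Y) / b)) * weight (-c) x =
      (fun x => ϑ ((x - Y) / b) * weight c x) (-x) := fun x => by
    simp only [reflectStep, weight_neg, sub_sub_cancel]
    congr 2
    ring_nf
  have hi := h.reflect.integrable_tail (c := -c) (b := b) (Y := Y) (by rwa [abs_neg])
  constructor
  · simp only [e] at hi
    simpa using hi.comp_neg
  · rw [tail, ← integral_neg_eq_self]
    exact integral_congr_ae (ae_of_all _ fun x => (e x).symm)

theorem integral_cutoff (hb : b ≠ 0) (hj : 1 ≤ j) {c : ℝ} (hc : |c| ≤ √2)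
    (h : IsStep δ Λ (Θ j)) (h' : j < N → IsStep δ Λ (Θ (j + 1))) :
    ∫ x, cutoff N Θ f j (x / b + f j) * weight c x =
      (∫ x, weight c x) - tail (Θ j) c b (b * gap f j / 2) -
        if j < N then tail (reflectStep (Θ (j + 1))) (-c) b (b * gap f (j + 1) / 2) else 0 := by
  have hw := integrable_weight hc
  have ht := h.integrable_tail (b := b) (Y := b * gap f j / 2) hc
  simp only [cutoff_eq hb hj]
  by_cases hjN : j < N
  · obtain ⟨hi, he⟩ := integral_step_mul_weight (h' hjN) (b := b) hc (b * gap f (j + 1) / 2)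
    simp only [hjN, if_true]
    rw [← he, tail, ← integral_sub hw ht, ← integral_sub (by exact hw.sub ht) hi]
    exact integral_congr_ae (ae_of_all _ fun x => by ring)
  · simp only [hjN, if_false]
    rw [tail, sub_zero, ← integral_sub hw ht]
    exact integral_congr_ae (ae_of_all _ fun x => by ring)

theorem gammaOne_eq (hb : b ≠ 0) (hj : 1 ≤ j) (h : IsStep δ Λ (Θ j))
    (h' : j < N → IsStep δ Λ (Θ (j + 1))) :
    gammaOne N Θ b f j = gammaLimit - tail (Θ j) (-√2) b (b * gap f j / 2) -
      if j < N then tail (reflectStep (Θ (j + 1))) √2 b (b * gap f (j + 1) / 2) else 0 := by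
  have h2 : |-√2| ≤ √2 := by rw [abs_neg, abs_of_nonneg (Real.sqrt_nonneg 2)]
  have := integral_cutoff (f := f) hb hj h2 h h'
  rw [neg_neg, integral_weight_neg_sqrt_two] at this
  rw [gammaOne, ← this]
  simp only [weight, mul_assoc]

theorem gammaTwo_eq (hb : b ≠ 0) (hj : 1 ≤ j) (h : IsStep δ Λ (Θ j))
    (h' : j < N → IsStep δ Λ (Θ (j + 1))) :
    gammaTwo N Θ b f j = gammaLimit - tail (Θ j) √2 b (b * gap f j / 2) -
      if j < N then tail (reflectStep (Θ (j + 1))) (-√2) b (b * gap f (j + 1) / 2) else 0 := by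
  have h2 : |√2| ≤ √2 := by rw [abs_of_nonneg (Real.sqrt_nonneg 2)]
  have := integral_cutoff (f := f) hb hj h2 h h'
  rw [gammaTwo, gammaLimit, ← this]
  simp only [weight, mul_assoc]

end

theorem IsTransition.exists_isStep {N : ℕ} {δ : ℝ} {Θ : ℕ → ℝ → ℝ} (h : IsTransition N δ Θ) :
    ∃ Λ, ∀ j, 1 ≤ j → j ≤ N → IsStep δ Λ (Θ j) := by
  have : ∀ j, ∃ Λ, 1 ≤ j → j ≤ N → IsStep δ Λ (Θ j) := fun j => by
    by_cases hj : 1 ≤ j ∧ j ≤ N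
    · obtain ⟨Λ, hΛ⟩ := IsStep.exists_of_contDiff ((h.smooth j hj.1 hj.2).of_le (by norm_cast))
        (h.mem_Icc j hj.1 hj.2) (h.eq_zero j hj.1 hj.2) (h.eq_one j hj.1 hj.2)
      exact ⟨Λ, fun _ _ => hΛ⟩
    · exact ⟨0, fun h1 h2 => absurd ⟨h1, h2⟩ hj⟩
  choose Λ hΛ using this
  have hle : ∀ j, 1 ≤ j → j ≤ N → Λ j ≤ ∑ i ∈ Finset.Icc 1 N, |Λ i| := fun j h1 h2 =>
    (le_abs_self _).trans (Finset.single_le_sum (f := fun i => |Λ i|) (fun i _ => abs_nonneg _)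
      (Finset.mem_Icc.2 ⟨h1, h2⟩))
  refine ⟨∑ i ∈ Finset.Icc 1 N, |Λ i|, fun j h1 h2 => ?_⟩
  have hj := hΛ j h1 h2
  exact ⟨hj.mem_Icc, hj.eq_zero, hj.eq_one, fun u v => (hj.lip u v).trans
    (mul_le_mul_of_nonneg_right (hle j h1 h2) (abs_nonneg _))⟩

end BoundaryLayers

namespace BoundaryLayers

/-! ### Asymptotics of the balanced coefficients -/

/-- The distance between the angles of two points. -/
def angleDist (p q : ℝ × ℝ) : ℝ := |p.2 - q.2|

theorem angleDist_nonneg (p q : ℝ × ℝ) : 0 ≤ angleDist p q := abs_nonneg _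

/-- The data entering the coefficients of the linearized layer system, as functions of the scale
`√ε` and the angle; `a` is the common value `12 β² (γ_{1,j} d_j - γ_{2,j} d_{j+1})`. -/
structure IsLayerFamily (N : ℕ) (δ : ℝ) (Θ : ℕ → ℝ → ℝ) (s₁ m : ℝ) (a b : ℝ → ℝ)
    (fbar fcheck : ℕ → ℝ → ℝ → ℝ) : Prop where
  transition : IsTransition N δ Θ
  scale_pos : 0 < s₁
  scale_le : s₁ ≤ 1
  lower_pos : 0 < m
  lower_a : ∀ θ, m ≤ a θ
  lower_b : ∀ θ, m ≤ b θ
  reg_a : IsReg s₁ angleDist fun p => a p.2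
  reg_b : IsReg s₁ angleDist fun p => b p.2
  bound_fbar : ∃ K, ∀ (j : ℕ) (p : ℝ × ℝ), 1 ≤ j → j ≤ N → 0 < p.1 → p.1 < s₁ →
    |fbar j (p.1 ^ 2) p.2| ≤ K
  reg_fcheck : ∀ j, 1 ≤ j → j ≤ N → IsReg s₁ angleDist fun p => fcheck j (p.1 ^ 2) p.2
  balance : ∀ (j : ℕ) (p : ℝ × ℝ), 1 ≤ j → j ≤ N → 0 < p.1 → p.1 < s₁ →
    12 * b p.2 ^ 2 *
      (gammaOne N Θ (b p.2) (position N (b p.2) (p.1 ^ 2) (fun i => fbar i (p.1 ^ 2) p.2)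
          (fun i => fcheck i (p.1 ^ 2) p.2)) j * dCoef N (b p.2) (fun i => fbar i (p.1 ^ 2) p.2) j -
        gammaTwo N Θ (b p.2) (position N (b p.2) (p.1 ^ 2) (fun i => fbar i (p.1 ^ 2) p.2)
          (fun i => fcheck i (p.1 ^ 2) p.2)) j *
          dCoef N (b p.2) (fun i => fbar i (p.1 ^ 2) p.2) (j + 1)) = a p.2

theorem IsReg.gap {N : ℕ} {s₁ : ℝ} {d : ℝ × ℝ → ℝ × ℝ → ℝ} {F : ℕ → ℝ × ℝ → ℝ}
    (hF : ∀ j, 1 ≤ j → j ≤ N → IsReg s₁ d (F j)) {j : ℕ} (hj : 1 ≤ j) (hjN : j ≤ N) :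
    IsReg s₁ d fun p => gap (fun i => F i p) j := by
  obtain ⟨k, rfl⟩ := Nat.exists_eq_add_of_le' hj
  rcases k with _ | k
  · simp only [zero_add, gap_one, two_mul]
    exact (hF 1 le_rfl hjN).add (hF 1 le_rfl hjN)
  · simp only [gap_add_two]
    exact (hF (k + 2) (by omega) hjN).sub (hF (k + 1) (by omega) (by omega))

theorem abs_gap_le {N : ℕ} {K : ℝ} {f : ℕ → ℝ} (hf : ∀ j, 1 ≤ j → j ≤ N → |f j| ≤ K) {j : ℕ}
    (hj : 1 ≤ j) (hjN : j ≤ N) : |gap f j| ≤ 2 * K := by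
  obtain ⟨k, rfl⟩ := Nat.exists_eq_add_of_le' hj
  rcases k with _ | k
  · rw [zero_add, gap_one, abs_mul, abs_two]
    linarith [hf 1 le_rfl hjN]
  · rw [gap_add_two]
    have h1 := hf (k + 2) (by omega) hjN
    have h2 := hf (k + 1) (by omega) (by omega)
    exact (abs_sub _ _).trans (by linarith)

theorem IsSmall.exists_forall_lt {ι : Type*} (I : Finset ι) {s₁ η : ℝ} {d : ℝ × ℝ → ℝ × ℝ → ℝ}
    {F : ι → ℝ × ℝ → ℝ} (hs₁ : 0 < s₁) (hη : 0 < η) (hF : ∀ i ∈ I, IsSmall s₁ d (F i)) :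
    ∃ s₂, 0 < s₂ ∧ s₂ ≤ s₁ ∧ ∀ i ∈ I, ∀ p : ℝ × ℝ, 0 < p.1 → p.1 < s₂ → |F i p| ≤ η := by
  classical
  induction I using Finset.induction_on with
  | empty => exact ⟨s₁, hs₁, le_rfl, by simp⟩
  | insert i I hi ih =>
    obtain ⟨s₂, h0, h1, h2⟩ := ih fun j hj => hF j (by simp [hj])
    obtain ⟨C, hC, h⟩ := hF i (by simp)
    refine ⟨min s₂ (η / (C + 1)), by positivity, (min_le_left _ _).trans h1, fun j hj p hp hps => ?_⟩
    rcases Finset.mem_insert.1 hj with rfl | hj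
    · have hp1 : p.1 < s₁ := hps.trans_le ((min_le_left _ _).trans h1)
      have hp2 : p.1 < η / (C + 1) := hps.trans_le (min_le_right _ _)
      rw [lt_div_iff₀ (by positivity)] at hp2
      have := (h p p (Near.refl hp hp1)).1
      linarith
    · exact h2 j hj p hp (hps.trans_le (min_le_left _ _))

section

variable (N : ℕ) (Θ : ℕ → ℝ → ℝ) (a b : ℝ → ℝ) (fbar fcheck : ℕ → ℝ → ℝ → ℝ)

/-- `γ_{1,j}` as a function of scale and angle. -/
noncomputable def gammaOneAt (j : ℕ) (p : ℝ × ℝ) : ℝ :=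
  gammaOne N Θ (b p.2) (position N (b p.2) (p.1 ^ 2) (fun i => fbar i (p.1 ^ 2) p.2)
    (fun i => fcheck i (p.1 ^ 2) p.2)) j

/-- `γ_{2,j}` as a function of scale and angle. -/
noncomputable def gammaTwoAt (j : ℕ) (p : ℝ × ℝ) : ℝ :=
  gammaTwo N Θ (b p.2) (position N (b p.2) (p.1 ^ 2) (fun i => fbar i (p.1 ^ 2) p.2)
    (fun i => fcheck i (p.1 ^ 2) p.2)) j

/-- `d_j` as a function of scale and angle. -/
noncomputable def dCoefAt (j : ℕ) (p : ℝ × ℝ) : ℝ :=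
  dCoef N (b p.2) (fun i => fbar i (p.1 ^ 2) p.2) j

/-- The normalized flux `12 β² γ_{1,j} d_j / a`. -/
noncomputable def flux (j : ℕ) (p : ℝ × ℝ) : ℝ :=
  12 * b p.2 ^ 2 * gammaOneAt N Θ b fbar fcheck j p * dCoefAt N b fbar j p / a p.2

/-- The rescaled gap `β (f̄_j - f̄_{j-1})`. -/
noncomputable def scaledGap (j : ℕ) (p : ℝ × ℝ) : ℝ := b p.2 * gap (fun i => fbar i (p.1 ^ 2) p.2) j

/-- The distance of the angles and of the rescaled gaps. -/
noncomputable def gapDist (p q : ℝ × ℝ) : ℝ :=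
  angleDist p q + ∑ j ∈ Finset.Icc 1 N, |scaledGap b fbar j p - scaledGap b fbar j q|

end

namespace IsLayerFamily

variable {N : ℕ} {δ : ℝ} {Θ : ℕ → ℝ → ℝ} {s₁ m : ℝ} {a b : ℝ → ℝ} {fbar fcheck : ℕ → ℝ → ℝ → ℝ}

theorem gapDist_nonneg (p q : ℝ × ℝ) : 0 ≤ gapDist N b fbar p q :=
  add_nonneg (angleDist_nonneg p q) (Finset.sum_nonneg fun _ _ => abs_nonneg _)

theorem abs_scaledGap_sub_le {j : ℕ} (hj : 1 ≤ j) (hjN : j ≤ N) (p q : ℝ × ℝ) :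
    |scaledGap b fbar j p - scaledGap b fbar j q| ≤ gapDist N b fbar p q :=
  (Finset.single_le_sum (f := fun j => |scaledGap b fbar j p - scaledGap b fbar j q|)
    (fun _ _ => abs_nonneg _) (Finset.mem_Icc.2 ⟨hj, hjN⟩)).trans
    (le_add_of_nonneg_left (angleDist_nonneg p q))

theorem isReg_of_angleDist {F : ℝ × ℝ → ℝ} (hF : IsReg s₁ angleDist F) :
    IsReg s₁ (gapDist N b fbar) F := by
  refine hF.mono_dist (B := 1) zero_le_one (fun p q _ => ?_) gapDist_nonneg
  have h1 : 0 ≤ ∑ j ∈ Finset.Icc 1 N, |scaledGap b fbar j p - scaledGap b fbar j q| :=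
    Finset.sum_nonneg fun _ _ => abs_nonneg _
  have h2 := abs_nonneg (p.1 - q.1)
  rw [gapDist]
  linarith

theorem b_pos (h : IsLayerFamily N δ Θ s₁ m a b fbar fcheck)
    (θ : ℝ) : 0 < b θ := h.lower_pos.trans_le (h.lower_b θ)

theorem a_pos (h : IsLayerFamily N δ Θ s₁ m a b fbar fcheck)
    (θ : ℝ) : 0 < a θ := h.lower_pos.trans_le (h.lower_a θ)

/-- The Lipschitz part is tautological, since `gapDist` contains the gaps; only the uniform bound on
f̄ is used. It is the entry point of the bootstrap, before anything is known about the regularity of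
f̄. -/
theorem isReg_scaledGap (h : IsLayerFamily N δ Θ s₁ m a b fbar fcheck)
    {j : ℕ} (hj : 1 ≤ j) (hjN : j ≤ N) :
    IsReg s₁ (gapDist N b fbar) (scaledGap b fbar j) := by
  obtain ⟨K, hK⟩ := h.bound_fbar
  obtain ⟨B, hB, hb⟩ := h.reg_b
  refine ⟨1 + |B * (2 * K)|, by positivity, fun p q hpq => ⟨?_, ?_⟩⟩
  · have h1 := abs_gap_le (f := fun i => fbar i (p.1 ^ 2) p.2)
      (fun i hi hiN => hK i p hi hiN hpq.left_pos hpq.left_lt) hj hjN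
    rw [scaledGap, abs_mul]
    have h2 := mul_le_mul (hb p q hpq).1 h1 (abs_nonneg _) hB
    linarith [le_abs_self (B * (2 * K))]
  · have h1 := abs_scaledGap_sub_le (b := b) (fbar := fbar) hj hjN p q
    have h2 := gapDist_nonneg (N := N) (b := b) (fbar := fbar) p q
    have h3 := abs_nonneg (p.1 - q.1)
    have h4 : 0 ≤ |B * (2 * K)| * (|p.1 - q.1| + gapDist N b fbar p q) := by positivity
    linarith

/-- Half of the logarithm of 1/ε in the gap is minus the logarithm of the scale, ε being the square
of the scale; the remaining terms are regular for `gapDist`. -/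
theorem isReg_tailPosition (h : IsLayerFamily N δ Θ s₁ m a b fbar fcheck)
    {j : ℕ} (hj : 1 ≤ j) (hjN : j ≤ N) :
    IsReg s₁ (gapDist N b fbar) fun p => √2 * (b p.2 * gap (position N (b p.2) (p.1 ^ 2)
      (fun i => fbar i (p.1 ^ 2) p.2) (fun i => fcheck i (p.1 ^ 2) p.2)) j / 2) +
      Real.log p.1 := by
  have hd := gapDist_nonneg (N := N) (b := b) (fbar := fbar)
  have h1 := isReg_of_angleDist (N := N) (b := b) (fbar := fbar)
    (h.reg_b.mul (IsReg.gap h.reg_fcheck hj hjN))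
  refine ((IsReg.const hd (-Real.log ((N : ℝ) - j + 1) / 2)).add
    (((h.isReg_scaledGap hj hjN).add h1).const_mul hd (√2 / 2))).congr fun p hp _ => ?_
  have hN : (0 : ℝ) < (N : ℝ) - j + 1 := by
    have : (j : ℝ) ≤ N := by exact_mod_cast hjN
    linarith
  have e := gap_position (fbar := fun i => fbar i (p.1 ^ 2) p.2)
    (fcheck := fun i => fcheck i (p.1 ^ 2) p.2) (h.b_pos p.2) (by positivity : 0 < p.1 ^ 2) hj hjN
  rw [Real.log_mul hN.ne' (by positivity), Real.log_pow] at e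
  push_cast at e
  simp only [scaledGap]
  linear_combination e / 2

/-- Both coefficients are `gammaLimit` minus tails cut off at half gaps, and these tails are of the
order of the scale. -/
theorem isSmall_gamma (h : IsLayerFamily N δ Θ s₁ m a b fbar fcheck)
    {j : ℕ} (hj : 1 ≤ j) (hjN : j ≤ N) :
    IsSmall s₁ (gapDist N b fbar) (fun p => gammaOneAt N Θ b fbar fcheck j p - gammaLimit) ∧
      IsSmall s₁ (gapDist N b fbar)
        (fun p => gammaTwoAt N Θ b fbar fcheck j p - gammaLimit) := by
  have hd := gapDist_nonneg (N := N) (b := b) (fbar := fbar)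
  obtain ⟨Λ, hΛ⟩ := h.transition.exists_isStep
  have h2 : |√2| ≤ √2 := by rw [abs_of_nonneg (Real.sqrt_nonneg 2)]
  have h2' : |-√2| ≤ √2 := by rwa [abs_neg]
  have hb := isReg_of_angleDist (N := N) (b := b) (fbar := fbar) h.reg_b
  have key : ∀ {ϑ : ℝ → ℝ} {c : ℝ} {i : ℕ}, IsStep δ Λ ϑ → |c| ≤ √2 → 1 ≤ i → i ≤ N →
      IsSmall s₁ (gapDist N b fbar) fun p => tail ϑ c (b p.2) (b p.2 * gap (position N (b p.2)
        (p.1 ^ 2) (fun i => fbar i (p.1 ^ 2) p.2) (fun i => fcheck i (p.1 ^ 2) p.2)) i / 2) :=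
    fun hϑ hc hi hiN => hϑ.isSmall_tail h.transition.width_pos.le hc h.lower_pos h.scale_le hd hb
      (fun p _ _ => h.lower_b p.2) (h.isReg_tailPosition hi hiN)
  have hstep := hΛ j hj hjN
  have hstep' : j < N → IsStep δ Λ (Θ (j + 1)) := fun hlt => hΛ (j + 1) (by omega) hlt
  simp only [gammaOneAt, gammaTwoAt, gammaOne_eq (h.b_pos _).ne' hj hstep hstep',
    gammaTwo_eq (h.b_pos _).ne' hj hstep hstep']
  by_cases hlt : j < N
  · simp only [hlt, if_true]
    exact ⟨((key hstep h2' hj hjN).add (key (hstep' hlt).reflect h2 (by omega) hlt)).neg.congr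
      fun p _ _ => by ring, ((key hstep h2 hj hjN).add
      (key (hstep' hlt).reflect h2' (by omega) hlt)).neg.congr fun p _ _ => by ring⟩
  · simp only [hlt, if_false]
    exact ⟨(key hstep h2' hj hjN).neg.congr fun p _ _ => by ring,
      (key hstep h2 hj hjN).neg.congr fun p _ _ => by ring⟩

theorem flux_last (h : IsLayerFamily N δ Θ s₁ m a b fbar fcheck)
    {p : ℝ × ℝ} (hN : 1 ≤ N) (hp : 0 < p.1) (hps : p.1 < s₁) :
    flux N Θ a b fbar fcheck N p = 1 := by
  have hb := h.balance N p hN le_rfl hp hps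
  have ha := h.a_pos p.2
  have h0 : dCoef N (b p.2) (fun i => fbar i (p.1 ^ 2) p.2) (N + 1) = 0 := by simp [dCoef]
  rw [h0, mul_zero, sub_zero] at hb
  rw [flux, div_eq_one_iff_eq ha.ne', ← hb]
  simp only [gammaOneAt, dCoefAt]
  ring

theorem flux_sub_one (h : IsLayerFamily N δ Θ s₁ m a b fbar fcheck)
    {j : ℕ} {p : ℝ × ℝ} (hj : 1 ≤ j) (hjN : j ≤ N) (hp : 0 < p.1)
    (hps : p.1 < s₁) :
    flux N Θ a b fbar fcheck j p - 1 = 12 * b p.2 ^ 2 * gammaTwoAt N Θ b fbar fcheck j p *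
      dCoefAt N b fbar (j + 1) p / a p.2 := by
  have hb := h.balance j p hj hjN hp hps
  have ha := h.a_pos p.2
  rw [flux, div_sub_one ha.ne', div_left_inj' ha.ne']
  simp only [gammaOneAt, gammaTwoAt, dCoefAt]
  linear_combination hb

/-- Descending recursion from the last layer, where the flux is 1: the balance gives flux_j - 1 =
flux_{j+1} γ_{2,j}/γ_{1,j+1}, and the quotient is 1 up to a small family. The scale is first reduced
so that every γ_{1,j} is at least `gammaLimit`/2. -/
theorem exists_isSmall_flux (h : IsLayerFamily N δ Θ s₁ m a b fbar fcheck)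
    (hN : 1 ≤ N) : ∃ s₂, 0 < s₂ ∧ s₂ ≤ s₁ ∧
    (∀ j, 1 ≤ j → j ≤ N → ∀ p : ℝ × ℝ, 0 < p.1 → p.1 < s₂ →
      gammaLimit / 2 ≤ gammaOneAt N Θ b fbar fcheck j p) ∧
    ∀ j, 1 ≤ j → j ≤ N → IsSmall s₂ (gapDist N b fbar)
      fun p => flux N Θ a b fbar fcheck j p - ((N : ℝ) - j + 1) := by
  have hd := gapDist_nonneg (N := N) (b := b) (fbar := fbar)
  have hg := gammaLimit_pos
  obtain ⟨s₂, hs₂, hs₂₁, hsmall⟩ := IsSmall.exists_forall_lt (Finset.Icc 1 N) h.scale_pos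
    (half_pos hg) fun j hj =>
      (h.isSmall_gamma (Finset.mem_Icc.1 hj).1 (Finset.mem_Icc.1 hj).2).1
  have hlow : ∀ j, 1 ≤ j → j ≤ N → ∀ p : ℝ × ℝ, 0 < p.1 → p.1 < s₂ →
      gammaLimit / 2 ≤ gammaOneAt N Θ b fbar fcheck j p := fun j hj hjN p hp hps => by
    have := (abs_le.1 (hsmall j (Finset.mem_Icc.2 ⟨hj, hjN⟩) p hp hps)).1
    linarith
  refine ⟨s₂, hs₂, hs₂₁, hlow, ?_⟩
  have hs₂' : s₂ ≤ 1 := hs₂₁.trans h.scale_le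
  have hratio : ∀ j, 1 ≤ j → j < N → IsSmall s₂ (gapDist N b fbar) fun p =>
      gammaTwoAt N Θ b fbar fcheck j p * (gammaOneAt N Θ b fbar fcheck (j + 1) p)⁻¹ - 1 :=
    fun j hj hjN => by
      have h1 := (h.isSmall_gamma hj hjN.le).2.mono hs₂₁
      have h2 := (h.isSmall_gamma (j := j + 1) (by omega) hjN).1.mono hs₂₁
      have h3 : IsReg s₂ (gapDist N b fbar) (gammaOneAt N Θ b fbar fcheck (j + 1)) :=
        ((h2.isReg hs₂' hd).add (IsReg.const hd gammaLimit)).congr fun p _ _ => by ring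
      have hlow' := hlow (j + 1) (by omega) hjN
      refine ((h1.sub h2).mul_reg (h3.inv (half_pos hg) hlow' hd) hs₂' hd).congr
        fun p hp hps => ?_
      have : gammaOneAt N Θ b fbar fcheck (j + 1) p ≠ 0 := by
        have := hlow' p hp hps
        intro h0
        linarith
      field_simp
      ring
  have key : ∀ k : ℕ, k < N → IsSmall s₂ (gapDist N b fbar)
      fun p => flux N Θ a b fbar fcheck (N - k) p - ((k : ℝ) + 1) := by
    intro k
    induction k with
    | zero =>
      intro _
      refine IsSmall.zero.congr fun p hp hps => ?_
      simp [h.flux_last hN hp (hps.trans_le hs₂₁)]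
    | succ k ih =>
      intro hk
      have ih := ih (by omega)
      set j := N - (k + 1) with hj
      have hjk : N - k = j + 1 := by omega
      rw [hjk] at ih
      have hR := hratio j (by omega) (by omega)
      have hR' := (hR.isReg hs₂' hd).add (IsReg.const hd 1)
      refine ((ih.mul_reg hR' hs₂' hd).add
        (hR.mul_reg (IsReg.const hd ((k : ℝ) + 1)) hs₂' hd)).congr fun p hp hps => ?_
      have h1 := h.flux_sub_one (j := j) (by omega) (by omega) hp (hps.trans_le hs₂₁)
      have h0 : gammaOneAt N Θ b fbar fcheck (j + 1) p ≠ 0 := by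
        have := hlow (j + 1) (by omega) (by omega) p hp hps
        intro h0
        linarith
      have ha := (h.a_pos p.2).ne'
      have h2 : flux N Θ a b fbar fcheck j p - 1 = flux N Θ a b fbar fcheck (j + 1) p *
          (gammaTwoAt N Θ b fbar fcheck j p * (gammaOneAt N Θ b fbar fcheck (j + 1) p)⁻¹) := by
        rw [h1, flux]
        field_simp
      push_cast
      linear_combination h2
  intro j hj hjN
  have := key (N - j) (by omega)
  rw [Nat.sub_sub_self hjN] at this
  refine this.congr fun p _ _ => ?_
  rw [Nat.cast_sub hjN]

/-- The rescaled gaps of the balanced positions are Lipschitz in the scale and the angle. -/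
theorem exists_gapDist_le (h : IsLayerFamily N δ Θ s₁ m a b fbar fcheck)
    (hN : 1 ≤ N) : ∃ s₂ B, 0 < s₂ ∧ s₂ ≤ s₁ ∧ 0 ≤ B ∧
    ∀ p q, Near s₂ p q → gapDist N b fbar p q ≤ B * (|p.1 - q.1| + angleDist p q) := by
  have hd := gapDist_nonneg (N := N) (b := b) (fbar := fbar)
  obtain ⟨s₂, hs₂, hs₂₁, hlow, hflux⟩ := h.exists_isSmall_flux hN
  have hs₂' : s₂ ≤ 1 := hs₂₁.trans h.scale_le
  -- In `d₂` the gaps enter only with the weight of the scale, so a family small for `gapDist` is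
  -- regular for `d₂`. Recovering the gaps from the fluxes thus gains the factor needed for
  -- absorption.
  set d₂ : ℝ × ℝ → ℝ × ℝ → ℝ := fun p q => angleDist p q + |p.1| * gapDist N b fbar p q with hd₂
  have hd₂0 : ∀ p q, 0 ≤ d₂ p q := fun p q =>
    add_nonneg (angleDist_nonneg p q) (mul_nonneg (abs_nonneg _) (hd p q))
  have ofSmall : ∀ {F : ℝ × ℝ → ℝ}, IsSmall s₂ (gapDist N b fbar) F → IsReg s₂ d₂ F :=
    fun {F} hF => by
      obtain ⟨C, hC, hF⟩ := hF
      refine ⟨C, hC, fun p q hpq => ⟨(hF p q hpq).1.trans ?_, (hF p q hpq).2.trans ?_⟩⟩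
      · exact mul_le_of_le_one_right hC (by linarith [hpq.left_lt])
      · rw [hd₂]
        simp only [abs_of_pos hpq.left_pos]
        gcongr
        exact le_add_of_nonneg_left (angleDist_nonneg p q)
  have ofReg : ∀ {F : ℝ × ℝ → ℝ}, IsReg s₁ angleDist F → IsReg s₂ d₂ F := fun {F} hF => by
    refine (hF.mono hs₂₁).mono_dist (B := 1) zero_le_one (fun p q _ => ?_) hd₂0
    have := mul_nonneg (abs_nonneg p.1) (hd p q)
    have := abs_nonneg (p.1 - q.1)
    simp only [hd₂]
    linarith
  have hu : ∀ j, 1 ≤ j → j ≤ N → IsReg s₂ d₂ (scaledGap b fbar j) := fun j hj hjN => by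
    have hNj : (0 : ℝ) < (N : ℝ) - j + 1 := by
      have : (j : ℝ) ≤ N := by exact_mod_cast hjN
      linarith
    have h1 : IsReg s₂ d₂ (flux N Θ a b fbar fcheck j) :=
      ((ofSmall (hflux j hj hjN)).add (IsReg.const hd₂0 ((N : ℝ) - j + 1))).congr
        fun p _ _ => by ring
    have h2 : IsReg s₂ d₂ (gammaOneAt N Θ b fbar fcheck j) :=
      ((ofSmall ((h.isSmall_gamma hj hjN).1.mono hs₂₁)).add (IsReg.const hd₂0 gammaLimit)).congr
        fun p _ _ => by ring
    have h3 := h2.inv (half_pos gammaLimit_pos) (hlow j hj hjN) hd₂0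
    have hbi := (ofReg h.reg_b).inv h.lower_pos (fun p _ _ => h.lower_b p.2) hd₂0
    -- The definition of the flux solved for the exponential of the gap, every other factor being
    -- already regular for `d₂`.
    have h4 : IsReg s₂ d₂ fun p => Real.exp (-√2 * scaledGap b fbar j p) := by
      refine (((((h1.mul (ofReg h.reg_a)).mul h3).mul hbi).mul hbi).const_mul hd₂0
        (12 * ((N : ℝ) - j + 1))⁻¹).congr fun p hp hps => ?_
      have hγ : gammaOneAt N Θ b fbar fcheck j p ≠ 0 := by
        have := hlow j hj hjN p hp hps
        have := gammaLimit_pos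
        intro h0
        linarith
      have ha := (h.a_pos p.2).ne'
      have hb := (h.b_pos p.2).ne'
      have hdc : dCoefAt N b fbar j p =
          ((N : ℝ) - j + 1) * Real.exp (-√2 * scaledGap b fbar j p) := by
        rw [dCoefAt, dCoef, if_pos hjN, scaledGap, mul_assoc]
      rw [flux, hdc]
      field_simp
    obtain ⟨K, hK, hbd⟩ := h.isReg_scaledGap hj hjN
    -- The a priori bound on the gap keeps the exponential away from 0, so the logarithm is
    -- Lipschitz.
    have h5 := h4.log (m := Real.exp (-√2 * K)) (Real.exp_pos _) (fun p hp hps => by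
      refine Real.exp_le_exp.2 ?_
      have := (le_abs_self _).trans (hbd p p (Near.refl hp (hps.trans_le hs₂₁))).1
      have := Real.sqrt_nonneg 2
      nlinarith) hd₂0
    refine (h5.const_mul hd₂0 (-(√2)⁻¹)).congr fun p _ _ => ?_
    rw [Real.log_exp]
    field_simp
  have hsum : ∃ C, 0 ≤ C ∧ ∀ p q, Near s₂ p q →
      ∑ j ∈ Finset.Icc 1 N, |scaledGap b fbar j p - scaledGap b fbar j q| ≤
        C * (|p.1 - q.1| + d₂ p q) := by
    have : ∀ j, ∃ C, 0 ≤ C ∧ (j ∈ Finset.Icc 1 N → ∀ p q, Near s₂ p q →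
        |scaledGap b fbar j p - scaledGap b fbar j q| ≤ C * (|p.1 - q.1| + d₂ p q)) := fun j => by
      by_cases hj : j ∈ Finset.Icc 1 N
      · obtain ⟨C, hC, hj'⟩ := hu j (Finset.mem_Icc.1 hj).1 (Finset.mem_Icc.1 hj).2
        exact ⟨C, hC, fun _ p q hpq => (hj' p q hpq).2⟩
      · exact ⟨0, le_rfl, fun h => absurd h hj⟩
    choose C hC hCj using this
    refine ⟨∑ j ∈ Finset.Icc 1 N, C j, Finset.sum_nonneg fun j _ => hC j, fun p q hpq => ?_⟩
    rw [Finset.sum_mul]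
    exact Finset.sum_le_sum fun j hj => hCj j hj p q hpq
  obtain ⟨C, hC, hsum⟩ := hsum
  -- With this threshold C·p.1 ≤ 1/2, so half of `gapDist` is absorbed; the factor 2 in the constant
  -- pays for it.
  refine ⟨min s₂ (1 / (2 * (C + 1))), 2 * (C + 1), by positivity,
    (min_le_left _ _).trans hs₂₁, by positivity, fun p q hpq => ?_⟩
  have h1 := hsum p q (hpq.mono (min_le_left _ _))
  have hp : C * p.1 ≤ 1 / 2 := by
    have := hpq.left_lt.trans_le (min_le_right _ _)
    rw [lt_div_iff₀ (by positivity)] at this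
    have := hpq.left_pos
    linarith
  simp only [hd₂, abs_of_pos hpq.left_pos] at h1
  have h2 : gapDist N b fbar p q = angleDist p q +
    ∑ j ∈ Finset.Icc 1 N, |scaledGap b fbar j p - scaledGap b fbar j q| := rfl
  have h3 := mul_le_mul_of_nonneg_right hp (hd p q)
  have h4 := abs_nonneg (p.1 - q.1)
  have h5 := angleDist_nonneg p q
  have h6 : 0 ≤ C * |p.1 - q.1| := by positivity
  have h7 : 0 ≤ C * angleDist p q := by positivity
  linarith

/-- The normalized fluxes are `N - j + 1` up to small families. -/
theorem exists_isSmall_flux_angleDist (h : IsLayerFamily N δ Θ s₁ m a b fbar fcheck)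
    (hN : 1 ≤ N) : ∃ s₂, 0 < s₂ ∧ s₂ ≤ s₁ ∧
    ∀ j, 1 ≤ j → j ≤ N → IsSmall s₂ angleDist
      fun p => flux N Θ a b fbar fcheck j p - ((N : ℝ) - j + 1) := by
  obtain ⟨s₂, hs₂, hs₂₁, -, hflux⟩ := h.exists_isSmall_flux hN
  obtain ⟨s₃, B, hs₃, hs₃₁, hB, hdist⟩ := h.exists_gapDist_le hN
  refine ⟨min s₂ s₃, lt_min hs₂ hs₃, (min_le_left _ _).trans hs₂₁, fun j hj hjN => ?_⟩
  exact ((hflux j hj hjN).mono (min_le_left _ _)).mono_dist hB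
    ((min_le_left _ _).trans (hs₂₁.trans h.scale_le))
    (fun p q hpq => hdist p q (hpq.mono (min_le_right _ _))) angleDist_nonneg

end IsLayerFamily

end BoundaryLayers

namespace BoundaryLayers

/-! ### Families of class `C²` in the angle -/

theorem periodic_deriv {E : Type*} [NormedAddCommGroup E] [NormedSpace ℝ E] {g : ℝ → E} {ℓ : ℝ}
    (hg : Function.Periodic g ℓ) : Function.Periodic (deriv g) ℓ := fun x => by
  have : (fun y => g (y + ℓ)) = g := funext hg
  rw [← deriv_comp_add_const, this]

/-- Families of periodic `C²` functions of the angle, bounded with two derivatives uniformly in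
the scale. -/
def IsC2Family (ℓ s₁ : ℝ) (F : ℝ × ℝ → ℝ) : Prop :=
  ∃ C, 0 ≤ C ∧ ∀ s, 0 < s → s < s₁ → Function.Periodic (fun θ => F (s, θ)) ℓ ∧
    ∃ f₁ f₂ : ℝ → ℝ, (∀ x, HasDerivAt (fun θ => F (s, θ)) (f₁ x) x) ∧
      (∀ x, HasDerivAt f₁ (f₂ x) x) ∧ Continuous f₂ ∧
      ∀ x, |F (s, x)| ≤ C ∧ |f₁ x| ≤ C ∧ |f₂ x| ≤ C

namespace IsC2Family

variable {ℓ s₁ s₂ : ℝ} {F G : ℝ × ℝ → ℝ}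

theorem mono (hF : IsC2Family ℓ s₁ F) (hs : s₂ ≤ s₁) : IsC2Family ℓ s₂ F :=
  let ⟨C, hC, h⟩ := hF
  ⟨C, hC, fun s h0 h1 => h s h0 (h1.trans_le hs)⟩

theorem const (c : ℝ) : IsC2Family ℓ s₁ fun _ => c :=
  ⟨|c|, abs_nonneg c, fun s _ _ => ⟨fun _ => rfl, fun _ => 0, fun _ => 0,
    fun x => hasDerivAt_const x c, fun x => hasDerivAt_const x 0, continuous_const,
    fun x => by simp⟩⟩

theorem add (hF : IsC2Family ℓ s₁ F) (hG : IsC2Family ℓ s₁ G) :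
    IsC2Family ℓ s₁ fun p => F p + G p := by
  obtain ⟨C, hC, hF⟩ := hF
  obtain ⟨D, hD, hG⟩ := hG
  refine ⟨C + D, by positivity, fun s h0 h1 => ?_⟩
  obtain ⟨hp, f₁, f₂, d1, d2, hc, hb⟩ := hF s h0 h1
  obtain ⟨hp', g₁, g₂, e1, e2, hc', hb'⟩ := hG s h0 h1
  exact ⟨hp.add hp', _, _, fun x => (d1 x).add (e1 x), fun x => (d2 x).add (e2 x), hc.add hc',
    fun x => ⟨(abs_add_le _ _).trans (add_le_add (hb x).1 (hb' x).1),
      (abs_add_le _ _).trans (add_le_add (hb x).2.1 (hb' x).2.1),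
      (abs_add_le _ _).trans (add_le_add (hb x).2.2 (hb' x).2.2)⟩⟩

theorem mul (hF : IsC2Family ℓ s₁ F) (hG : IsC2Family ℓ s₁ G) :
    IsC2Family ℓ s₁ fun p => F p * G p := by
  obtain ⟨C, hC, hF⟩ := hF
  obtain ⟨D, hD, hG⟩ := hG
  refine ⟨4 * (C * D), by positivity, fun s h0 h1 => ?_⟩
  obtain ⟨hp, f₁, f₂, d1, d2, hc, hb⟩ := hF s h0 h1
  obtain ⟨hp', g₁, g₂, e1, e2, hc', hb'⟩ := hG s h0 h1
  have cont : ∀ {f g : ℝ → ℝ}, (∀ x, HasDerivAt f (g x) x) → Continuous f := fun hf =>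
    continuous_iff_continuousAt.2 fun x => (hf x).continuousAt
  have hmul : ∀ {x y : ℝ}, |x| ≤ C → |y| ≤ D → |x * y| ≤ C * D := fun hx hy => by
    rw [abs_mul]
    exact mul_le_mul hx hy (abs_nonneg _) hC
  have hCD : 0 ≤ C * D := by positivity
  refine ⟨hp.mul hp', fun x => f₁ x * G (s, x) + F (s, x) * g₁ x,
    fun x => (f₂ x * G (s, x) + f₁ x * g₁ x) + (f₁ x * g₁ x + F (s, x) * g₂ x),
    fun x => (d1 x).mul (e1 x),
    fun x => ((d2 x).mul (e1 x)).add ((d1 x).mul (e2 x)), ?_, fun x => ?_⟩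
  · exact ((hc.mul (cont e1)).add ((cont d2).mul (cont e2))).add
      (((cont d2).mul (cont e2)).add ((cont d1).mul hc'))
  · obtain ⟨b0, b1, b2⟩ := hb x
    obtain ⟨c0, c1, c2⟩ := hb' x
    have m00 := hmul b0 c0
    have m10 := hmul b1 c0
    have m01 := hmul b0 c1
    have m20 := hmul b2 c0
    have m11 := hmul b1 c1
    have m02 := hmul b0 c2
    refine ⟨by linarith, (abs_add_le _ _).trans (by linarith), ?_⟩
    have t1 := abs_add_le (f₂ x * G (s, x)) (f₁ x * g₁ x)
    have t2 := abs_add_le (f₁ x * g₁ x) (F (s, x) * g₂ x)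
    exact (abs_add_le _ _).trans (by linarith)

theorem const_mul (hF : IsC2Family ℓ s₁ F) (c : ℝ) : IsC2Family ℓ s₁ fun p => c * F p :=
  (const c).mul hF

theorem sub (hF : IsC2Family ℓ s₁ F) (hG : IsC2Family ℓ s₁ G) :
    IsC2Family ℓ s₁ fun p => F p - G p := by
  have := hF.add (hG.const_mul (-1))
  simpa only [neg_one_mul, ← sub_eq_add_neg] using this

theorem sum {ι : Type*} (I : Finset ι) {F : ι → ℝ × ℝ → ℝ}
    (hF : ∀ i ∈ I, IsC2Family ℓ s₁ (F i)) : IsC2Family ℓ s₁ fun p => ∑ i ∈ I, F i p := by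
  classical
  induction I using Finset.induction_on with
  | empty => simpa using const 0
  | insert i I hi ih =>
    simp only [Finset.sum_insert hi]
    exact (hF i (by simp)).add (ih fun j hj => hF j (by simp [hj]))

theorem comp (hF : IsC2Family ℓ s₁ F) {g g₁ g₂ : ℝ → ℝ} {S : Set ℝ} (hS : IsCompact S)
    (hg : ∀ y ∈ S, HasDerivAt g (g₁ y) y) (hg₁ : ∀ y ∈ S, HasDerivAt g₁ (g₂ y) y)
    (hg₂ : ContinuousOn g₂ S) (hFS : ∀ p : ℝ × ℝ, 0 < p.1 → p.1 < s₁ → F p ∈ S) :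
    IsC2Family ℓ s₁ fun p => g (F p) := by
  obtain ⟨C, hC, hF⟩ := hF
  have hgc : ContinuousOn g S := fun y hy => (hg y hy).continuousAt.continuousWithinAt
  have hgc₁ : ContinuousOn g₁ S := fun y hy => (hg₁ y hy).continuousAt.continuousWithinAt
  obtain ⟨M, hM⟩ := hS.exists_bound_of_continuousOn hgc
  obtain ⟨M₁, hM₁⟩ := hS.exists_bound_of_continuousOn hgc₁
  obtain ⟨M₂, hM₂⟩ := hS.exists_bound_of_continuousOn hg₂
  refine ⟨|M| + |M₁| * C + |M₂| * C * C, by positivity, fun s h0 h1 => ?_⟩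
  obtain ⟨hp, f₁, f₂, d1, d2, hc, hb⟩ := hF s h0 h1
  have hmem : ∀ x, F (s, x) ∈ S := fun x => hFS (s, x) h0 h1
  have hFc : Continuous fun x => F (s, x) :=
    continuous_iff_continuousAt.2 fun x => (d1 x).continuousAt
  have hf₁c : Continuous f₁ := continuous_iff_continuousAt.2 fun x => (d2 x).continuousAt
  refine ⟨hp.comp g, fun x => g₁ (F (s, x)) * f₁ x,
    fun x => g₂ (F (s, x)) * f₁ x * f₁ x + g₁ (F (s, x)) * f₂ x,
    fun x => (hg _ (hmem x)).comp x (d1 x),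
    fun x => ((hg₁ _ (hmem x)).comp x (d1 x)).mul (d2 x), ?_, fun x => ?_⟩
  · exact (((hg₂.comp_continuous hFc hmem).mul hf₁c).mul hf₁c).add
      ((hgc₁.comp_continuous hFc hmem).mul hc)
  · obtain ⟨-, b1, b2⟩ := hb x
    have k0 : |g (F (s, x))| ≤ |M| := (hM _ (hmem x)).trans (le_abs_self _)
    have k1 : |g₁ (F (s, x))| ≤ |M₁| := (hM₁ _ (hmem x)).trans (le_abs_self _)
    have k2 : |g₂ (F (s, x))| ≤ |M₂| := (hM₂ _ (hmem x)).trans (le_abs_self _)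
    have n1 : |g₁ (F (s, x)) * f₁ x| ≤ |M₁| * C := by rw [abs_mul]; gcongr
    have n2 : |g₂ (F (s, x)) * f₁ x * f₁ x| ≤ |M₂| * C * C := by
      rw [abs_mul, abs_mul]; gcongr
    have n3 : |g₁ (F (s, x)) * f₂ x| ≤ |M₁| * C := by rw [abs_mul]; gcongr
    have p0 := abs_nonneg M
    have p1 : 0 ≤ |M₁| * C := by positivity
    have p2 : 0 ≤ |M₂| * C * C := by positivity
    exact ⟨by linarith, by linarith, (abs_add_le _ _).trans (by linarith)⟩

theorem exists_mem_Icc (hF : IsC2Family ℓ s₁ F) :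
    ∃ C, ∀ p : ℝ × ℝ, 0 < p.1 → p.1 < s₁ → F p ∈ Icc (-C) C := by
  obtain ⟨C, -, h⟩ := hF
  refine ⟨C, fun p h0 h1 => ?_⟩
  obtain ⟨-, f₁, f₂, -, -, -, hb⟩ := h p.1 h0 h1
  exact abs_le.1 (hb p.2).1

theorem exp (hF : IsC2Family ℓ s₁ F) : IsC2Family ℓ s₁ fun p => Real.exp (F p) := by
  obtain ⟨C, hC⟩ := hF.exists_mem_Icc
  exact hF.comp (g₁ := Real.exp) (g₂ := Real.exp) isCompact_Icc (fun y _ => Real.hasDerivAt_exp y)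
    (fun y _ => Real.hasDerivAt_exp y) Real.continuous_exp.continuousOn hC

theorem sqrt {m : ℝ} (hm : 0 < m) (hF : IsC2Family ℓ s₁ F)
    (hmF : ∀ p : ℝ × ℝ, 0 < p.1 → p.1 < s₁ → m ≤ F p) : IsC2Family ℓ s₁ fun p => √(F p) := by
  obtain ⟨C, hC⟩ := hF.exists_mem_Icc
  have hpos : ∀ y ∈ Icc m C, 0 < y := fun y hy => hm.trans_le hy.1
  refine hF.comp (g := Real.sqrt) (g₁ := fun y => 1 / (2 * √y))
    (g₂ := fun y => -(2 * (1 / (2 * √y))) / (2 * √y) ^ 2) (isCompact_Icc (a := m) (b := C))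
    (fun y hy => Real.hasDerivAt_sqrt (hpos y hy).ne') (fun y hy => ?_) (fun y hy => ?_)
    fun p h0 h1 => ⟨hmF p h0 h1, (hC p h0 h1).2⟩
  · have hne : 2 * √y ≠ 0 := by
      have := Real.sqrt_pos.2 (hpos y hy)
      positivity
    have h1 := (((Real.hasDerivAt_sqrt (hpos y hy).ne').const_mul 2).inv hne)
    simpa only [one_div, Pi.inv_def] using h1
  · have hne : 2 * √y ≠ 0 := by
      have := Real.sqrt_pos.2 (hpos y hy)
      positivity
    have hne2 : (2 * √y) ^ 2 ≠ 0 := pow_ne_zero 2 hne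
    exact ContinuousAt.continuousWithinAt (by fun_prop (disch := assumption))

theorem of_contDiff {f : ℝ → ℝ} (hℓ : 0 < ℓ) (hf : ContDiff ℝ 2 f) (hp : Function.Periodic f ℓ) :
    IsC2Family ℓ s₁ fun p => f p.2 := by
  have h1 : ContDiff ℝ 1 (deriv f) := 
    ((contDiff_succ_iff_deriv (n := 1)).1 (by rw [one_add_one_eq_two]; exact hf)).2.2
  have h2 : Continuous (deriv (deriv f)) := h1.continuous_deriv le_rfl
  have hbound : ∀ {g : ℝ → ℝ}, Continuous g → Function.Periodic g ℓ → ∃ C, ∀ x, |g x| ≤ C :=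
    fun {g} hg hgp => by
      obtain ⟨C, hC⟩ := (isCompact_Icc (a := (0 : ℝ)) (b := ℓ)).exists_bound_of_continuousOn
        hg.continuousOn
      refine ⟨C, fun x => ?_⟩
      obtain ⟨y, hy, hxy⟩ := hgp.exists_mem_Ico₀ hℓ x
      rw [hxy]
      exact hC y ⟨hy.1, hy.2.le⟩
  obtain ⟨C, hC⟩ := hbound hf.continuous hp
  obtain ⟨C₁, hC₁⟩ := hbound h1.continuous (periodic_deriv hp)
  obtain ⟨C₂, hC₂⟩ := hbound h2 (periodic_deriv (periodic_deriv hp))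
  refine ⟨|C| + |C₁| + |C₂|, by positivity, fun s _ _ => ⟨hp, deriv f, deriv (deriv f),
    fun x => ((hf.differentiable two_ne_zero) x).hasDerivAt,
    fun x => ((h1.differentiable one_ne_zero) x).hasDerivAt, h2, fun x => ?_⟩⟩
  have := le_abs_self C
  have := le_abs_self C₁
  have := le_abs_self C₂
  have := abs_nonneg C
  have := abs_nonneg C₁
  have := abs_nonneg C₂
  exact ⟨by linarith [hC x], by linarith [hC₁ x], by linarith [hC₂ x]⟩

theorem isReg {K : ℝ} (hF : IsC2Family ℓ s₁ F) (hK : 0 ≤ K)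
    (hscale : ∀ s s' θ, 0 < s → s < s₁ → 0 < s' → s' < s₁ →
      |F (s, θ) - F (s', θ)| ≤ K * |s - s'|) : IsReg s₁ angleDist F := by
  obtain ⟨C, hC, h⟩ := hF
  refine ⟨C + K, by positivity, fun p q hpq => ⟨?_, ?_⟩⟩
  · obtain ⟨-, f₁, f₂, -, -, -, hb⟩ := h p.1 hpq.left_pos hpq.left_lt
    have := (hb p.2).1
    simp only [Prod.mk.eta] at this
    linarith
  · obtain ⟨-, f₁, f₂, d1, -, -, hb⟩ := h q.1 hpq.right_pos hpq.right_lt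
    have h1 := hscale p.1 q.1 p.2 hpq.left_pos hpq.left_lt hpq.right_pos hpq.right_lt
    have h2 := Convex.norm_image_sub_le_of_norm_hasDerivWithin_le
      (f := fun θ => F (q.1, θ)) (f' := f₁) (s := univ) (C := C)
      (fun x _ => (d1 x).hasDerivWithinAt) (fun x _ => (hb x).2.1) convex_univ
      (mem_univ q.2) (mem_univ p.2)
    simp only [Real.norm_eq_abs, Prod.mk.eta] at h1 h2
    have h3 := abs_sub_le (F p) (F (q.1, p.2)) (F q)
    have h4 : 0 ≤ C * |p.1 - q.1| := by positivity
    have h5 : 0 ≤ K * |p.2 - q.2| := by positivity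
    simp only [angleDist]
    linarith

end IsC2Family

/-! ### Families of the order of the scale -/

/-- Families bounded by a multiple of the scale. -/
def IsOrderScale (s₁ : ℝ) (F : ℝ × ℝ → ℝ) : Prop :=
  ∃ C, 0 ≤ C ∧ ∀ p : ℝ × ℝ, 0 < p.1 → p.1 < s₁ → |F p| ≤ C * p.1

namespace IsOrderScale

variable {s₁ s₂ : ℝ} {d : ℝ × ℝ → ℝ × ℝ → ℝ} {F G : ℝ × ℝ → ℝ}

theorem of_isSmall (hF : IsSmall s₁ d F) : IsOrderScale s₁ F :=
  let ⟨C, hC, h⟩ := hF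
  ⟨C, hC, fun p h0 h1 => (h p p (Near.refl h0 h1)).1⟩

theorem mono (hF : IsOrderScale s₁ F) (hs : s₂ ≤ s₁) : IsOrderScale s₂ F :=
  let ⟨C, hC, h⟩ := hF
  ⟨C, hC, fun p h0 h1 => h p h0 (h1.trans_le hs)⟩

theorem congr (hF : IsOrderScale s₁ F) (hG : ∀ p : ℝ × ℝ, 0 < p.1 → p.1 < s₁ → G p = F p) :
    IsOrderScale s₁ G :=
  let ⟨C, hC, h⟩ := hF
  ⟨C, hC, fun p h0 h1 => by rw [hG p h0 h1]; exact h p h0 h1⟩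

theorem add (hF : IsOrderScale s₁ F) (hG : IsOrderScale s₁ G) :
    IsOrderScale s₁ fun p => F p + G p := by
  obtain ⟨C, hC, h⟩ := hF
  obtain ⟨D, hD, h'⟩ := hG
  refine ⟨C + D, by positivity, fun p h0 h1 => (abs_add_le _ _).trans ?_⟩
  linarith [h p h0 h1, h' p h0 h1]

theorem mul_bounded {K : ℝ} (hF : IsOrderScale s₁ F)
    (hG : ∀ p : ℝ × ℝ, 0 < p.1 → p.1 < s₁ → |G p| ≤ K) : IsOrderScale s₁ fun p => F p * G p := by
  obtain ⟨C, hC, h⟩ := hF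
  refine ⟨C * |K|, by positivity, fun p h0 h1 => ?_⟩
  rw [abs_mul]
  have := mul_le_mul (h p h0 h1) ((hG p h0 h1).trans (le_abs_self K)) (abs_nonneg _) (by positivity)
  linarith

theorem mul_reg (hF : IsOrderScale s₁ F) (hG : IsReg s₁ d G) :
    IsOrderScale s₁ fun p => F p * G p :=
  let ⟨_, _, h⟩ := hG
  hF.mul_bounded fun p h0 h1 => (h p p (Near.refl h0 h1)).1

theorem const_mul (hF : IsOrderScale s₁ F) (c : ℝ) : IsOrderScale s₁ fun p => c * F p := by
  have := hF.mul_bounded (G := fun _ => c) (K := |c|) fun _ _ _ => le_rfl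
  simpa only [mul_comm c] using this

theorem gap {N : ℕ} {F : ℕ → ℝ × ℝ → ℝ} (hF : ∀ j, 1 ≤ j → j ≤ N → IsOrderScale s₁ (F j)) {j : ℕ}
    (hj : 1 ≤ j) (hjN : j ≤ N) : IsOrderScale s₁ fun p => gap (fun i => F i p) j := by
  obtain ⟨k, rfl⟩ := Nat.exists_eq_add_of_le' hj
  rcases k with _ | k
  · simp only [zero_add, gap_one]
    exact (hF 1 le_rfl hjN).const_mul 2
  · refine ((hF (k + 2) (by omega) hjN).add
      ((hF (k + 1) (by omega) (by omega)).const_mul (-1))).congr fun p _ _ => ?_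
    rw [gap_add_two]
    ring

theorem exp_sub_one (hF : IsOrderScale s₁ F) (hs₁ : s₁ ≤ 1) :
    IsOrderScale s₁ fun p => Real.exp (F p) - 1 := by
  obtain ⟨C, hC, h⟩ := hF
  refine ⟨(Real.exp C + 1) * C, by positivity, fun p h0 h1 => ?_⟩
  have hb := h p h0 h1
  have hC' : F p ≤ C := (le_abs_self _).trans
    (hb.trans (mul_le_of_le_one_right hC (by linarith)))
  have key : |Real.exp (F p) - 1| ≤ (Real.exp C + 1) * |F p| := by
    have hE : Real.exp (F p) ≤ Real.exp C := Real.exp_le_exp.2 hC'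
    have h2 := Real.add_one_le_exp (F p)
    have h3 := Real.add_one_le_exp (-F p)
    have h4 : Real.exp (F p) * Real.exp (-F p) = 1 := by rw [← Real.exp_add]; simp
    have h5 := Real.exp_pos (F p)
    have h6 := Real.exp_pos C
    have h7 := abs_nonneg (F p)
    have h8 : Real.exp (F p) * |F p| ≤ Real.exp C * |F p| := by gcongr
    refine abs_le.2 ⟨?_, ?_⟩
    · have := neg_abs_le (F p)
      nlinarith
    · have h9 := mul_le_mul_of_nonneg_left h3 h5.le
      have h10 := mul_le_mul_of_nonneg_left (le_abs_self (F p)) h5.le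
      nlinarith
  refine key.trans ?_
  rw [mul_assoc]
  gcongr

end IsOrderScale

end BoundaryLayers

namespace BoundaryLayers

/-! ### Expansion of the eigenvalues -/

/-- The coefficient of `c` in the entries of `triMatrix N c d`. -/
def subWeight (N : ℕ) (i j : Fin N) : ℝ := triMatrix N (fun _ => 1) (fun _ => 0) i j

/-- The coefficient of `d` in the entries of `triMatrix N c d`. -/
def superWeight (N : ℕ) (i j : Fin N) : ℝ := triMatrix N (fun _ => 0) (fun _ => 1) i j

theorem triMatrix_apply (N : ℕ) (c d : ℕ → ℝ) (i j : Fin N) :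
    triMatrix N c d i j = subWeight N i j * c (i + 1) + superWeight N i j * d (i + 1) := by
  simp only [subWeight, superWeight, triMatrix, Matrix.of_apply]
  split_ifs <;> ring

/-- Makes the calculus of scalar families available, entry by entry, for a linear functional of a
matrix family. -/
theorem clm_apply_eq_sum {N : ℕ} (L : (Fin N → Fin N → ℝ) →L[ℝ] ℝ) (X : Fin N → Fin N → ℝ) :
    L X = ∑ i, ∑ j, L (Pi.single i (Pi.single j 1)) * X i j := by
  have hX : X = ∑ i, ∑ j, X i j • (Pi.single i (Pi.single j 1) : Fin N → Fin N → ℝ) := by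
    funext k l
    simp [Finset.sum_apply, Pi.single_apply, Finset.sum_ite_eq, apply_ite, ite_apply]
  conv_lhs => rw [hX]
  simp only [map_sum, map_smul, smul_eq_mul, mul_comm]

section

variable {N : ℕ} {s₁ : ℝ} {X : ℝ × ℝ → Fin N → Fin N → ℝ} {T : Fin N → Fin N → ℝ}

theorem exists_norm_le_of_isOrderScale
    (hX : ∀ i j, IsOrderScale s₁ fun p => X p i j - T i j) :
    ∃ C, 0 ≤ C ∧ ∀ p : ℝ × ℝ, 0 < p.1 → p.1 < s₁ → ‖X p - T‖ ≤ C * p.1 := by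
  choose C hC h using hX
  have hle : ∀ i j, C i j ≤ ∑ i, ∑ j, C i j := fun i j =>
    (Finset.single_le_sum (f := fun j => C i j) (fun j _ => hC i j) (Finset.mem_univ j)).trans
      (Finset.single_le_sum (f := fun i => ∑ j, C i j)
        (fun i _ => Finset.sum_nonneg fun j _ => hC i j) (Finset.mem_univ i))
  have h0 : 0 ≤ ∑ i, ∑ j, C i j := Finset.sum_nonneg fun i _ => Finset.sum_nonneg fun j _ => hC i j
  refine ⟨∑ i, ∑ j, C i j, h0, fun p hp hps => ?_⟩
  have hn : 0 ≤ (∑ i, ∑ j, C i j) * p.1 := by positivity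
  refine (pi_norm_le_iff_of_nonneg hn).2 fun i => (pi_norm_le_iff_of_nonneg hn).2 fun j => ?_
  exact (h i j p hp hps).trans (mul_le_mul_of_nonneg_right (hle i j) hp.le)

theorem exists_norm_sub_le_of_isReg (hX : ∀ i j, IsReg s₁ angleDist fun p => X p i j) :
    ∃ C, 0 ≤ C ∧ ∀ p q, Near s₁ p q → ‖X p - X q‖ ≤ C * (|p.1 - q.1| + angleDist p q) := by
  choose C hC h using hX
  have hle : ∀ i j, C i j ≤ ∑ i, ∑ j, C i j := fun i j =>
    (Finset.single_le_sum (f := fun j => C i j) (fun j _ => hC i j) (Finset.mem_univ j)).trans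
      (Finset.single_le_sum (f := fun i => ∑ j, C i j)
        (fun i _ => Finset.sum_nonneg fun j _ => hC i j) (Finset.mem_univ i))
  have h0 : 0 ≤ ∑ i, ∑ j, C i j := Finset.sum_nonneg fun i _ => Finset.sum_nonneg fun j _ => hC i j
  refine ⟨∑ i, ∑ j, C i j, h0, fun p q hpq => ?_⟩
  have ht : 0 ≤ |p.1 - q.1| + angleDist p q := add_nonneg (abs_nonneg _) (angleDist_nonneg p q)
  have hn := mul_nonneg h0 ht
  refine (pi_norm_le_iff_of_nonneg hn).2 fun i => (pi_norm_le_iff_of_nonneg hn).2 fun j => ?_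
  exact (h i j p q hpq).2.trans (mul_le_mul_of_nonneg_right (hle i j) ht)

/-- The remainder of the first order expansion of a function along a family of matrices at a
distance of the order of the scale is a small family. -/
theorem exists_isSmall_expansion {φ : (Fin N → Fin N → ℝ) → ℝ} {L : (Fin N → Fin N → ℝ) →L[ℝ] ℝ}
    {C R : ℝ} (hs₁ : 0 < s₁) (hs₁' : s₁ ≤ 1) (hC : 0 < C) (hR : 0 < R)
    (hφ : ∀ r, 0 ≤ r → r < R → ∀ X Y : Fin N → Fin N → ℝ, ‖X - T‖ ≤ r → ‖Y - T‖ ≤ r →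
      |φ X - φ Y - L (X - Y)| ≤ C * r * ‖X - Y‖)
    (hX : ∀ i j, IsReg s₁ angleDist fun p => X p i j)
    (hXT : ∀ i j, IsOrderScale s₁ fun p => X p i j - T i j) :
    ∃ s₂, 0 < s₂ ∧ s₂ ≤ s₁ ∧ (∀ p : ℝ × ℝ, 0 < p.1 → p.1 < s₂ → ‖X p - T‖ < R) ∧
      IsSmall s₂ angleDist fun p => φ (X p) - φ T - L (X p - T) := by
  obtain ⟨B, hB, hXT⟩ := exists_norm_le_of_isOrderScale hXT
  obtain ⟨D, hD, hX⟩ := exists_norm_sub_le_of_isReg hX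
  -- The radius 2B·p.1 contains X p and X q alike, because q.1 ≤ 2p.1. A ball of this size makes the
  -- Lipschitz constant of the linearization error of the order of the scale.
  have hlt : ∀ p : ℝ × ℝ, 0 < p.1 → p.1 < min s₁ (R / (2 * B + 1)) → 2 * B * p.1 < R :=
    fun p h0 h1 => by
      have := h1.trans_le (min_le_right _ _)
      rw [lt_div_iff₀ (by positivity)] at this
      linarith
  refine ⟨min s₁ (R / (2 * B + 1)), by positivity, min_le_left _ _, fun p h0 h1 => ?_, ?_⟩
  · have h2 := hXT p h0 (h1.trans_le (min_le_left _ _))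
    have h3 := hlt p h0 h1
    have h4 : 0 ≤ B * p.1 := by positivity
    linarith
  · refine ⟨C * (2 * B) * (B + D), by positivity, fun p q hpq => ⟨?_, ?_⟩⟩
    · have hp := hpq.left_pos
      have hp1 : p.1 ≤ 1 := (hpq.left_lt.le.trans (min_le_left _ _)).trans hs₁'
      have h2 := hXT p hp (hpq.left_lt.trans_le (min_le_left _ _))
      have h4 : 0 ≤ B * p.1 := by positivity
      have h3 := hφ (2 * B * p.1) (by linarith) (hlt p hp hpq.left_lt) (X p) T (by linarith)
        (by rw [sub_self, norm_zero]; linarith)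
      refine h3.trans ?_
      calc C * (2 * B * p.1) * ‖X p - T‖ ≤ C * (2 * B * 1) * (B * p.1) := by gcongr
        _ ≤ C * (2 * B) * (B + D) * p.1 := by
            have : 0 ≤ C * (2 * B) * D * p.1 := by positivity
            linarith
    · have hp := hpq.left_pos
      have hq := hpq.right_pos
      have hp1 : p.1 ≤ 1 := (hpq.left_lt.le.trans (min_le_left _ _)).trans hs₁'
      have h2 := hXT p hp (hpq.left_lt.trans_le (min_le_left _ _))
      have h2' := hXT q hq (hpq.right_lt.trans_le (min_le_left _ _))
      have h4 : 0 ≤ B * p.1 := by positivity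
      have h5 : B * q.1 ≤ B * (2 * p.1) := mul_le_mul_of_nonneg_left hpq.right_le hB
      have h3 := hφ (2 * B * p.1) (by linarith) (hlt p hp hpq.left_lt) (X p) (X q) (by linarith)
        (by linarith)
      have hXd := hX p q (hpq.mono (min_le_left _ _))
      have e : φ (X p) - φ T - L (X p - T) - (φ (X q) - φ T - L (X q - T)) =
          φ (X p) - φ (X q) - L (X p - X q) := by
        simp only [map_sub]
        ring
      rw [e]
      refine h3.trans ?_
      have hA := angleDist_nonneg p q
      have h6 : p.1 * (|p.1 - q.1| + angleDist p q) ≤ |p.1 - q.1| + p.1 * angleDist p q := by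
        rw [mul_add]
        gcongr
        exact mul_le_of_le_one_left (abs_nonneg _) hp1
      calc C * (2 * B * p.1) * ‖X p - X q‖
          ≤ C * (2 * B * p.1) * (D * (|p.1 - q.1| + angleDist p q)) := by gcongr
        _ = C * (2 * B) * D * (p.1 * (|p.1 - q.1| + angleDist p q)) := by ring
        _ ≤ C * (2 * B) * D * (|p.1 - q.1| + p.1 * angleDist p q) := by gcongr
        _ ≤ C * (2 * B) * (B + D) * (|p.1 - q.1| + p.1 * angleDist p q) := by
            gcongr
            linarith

end

/-! ### The layer matrix divided by a, and its C² approximation -/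

section

variable (N : ℕ) (Θ : ℕ → ℝ → ℝ) (a b : ℝ → ℝ) (fbar fcheck : ℕ → ℝ → ℝ → ℝ)

/-- The factor `e^{-√2 β (f̌_j - f̌_{j-1})}`, extended by `1` beyond the last layer. -/
noncomputable def checkFactor (j : ℕ) (p : ℝ × ℝ) : ℝ :=
  if j ≤ N then Real.exp (-√2 * b p.2 * gap (fun i => fcheck i (p.1 ^ 2) p.2) j) else 1

/-- The entries of the matrix of the linearized system, divided by `a`. -/
noncomputable def normalizedEntries (p : ℝ × ℝ) (i j : Fin N) : ℝ :=
  triMatrix N (fun k => flux N Θ a b fbar fcheck k p * checkFactor N b fcheck k p)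
    (fun k => (flux N Θ a b fbar fcheck k p - 1) * checkFactor N b fcheck (k + 1) p) i j

/-- The approximation of `normalizedEntries` in which the fluxes have their limit values. -/
noncomputable def approxEntries (p : ℝ × ℝ) (i j : Fin N) : ℝ :=
  triMatrix N (fun k => ((N : ℝ) - k + 1) * checkFactor N b fcheck k p)
    (fun k => ((N : ℝ) - k) * checkFactor N b fcheck (k + 1) p) i j

end

/-- `IsLayerFamily`, with data of class `C²` in the angle and corrections of the order of the
scale. -/
structure IsSmoothLayerFamily (ℓ : ℝ) (N : ℕ) (δ : ℝ) (Θ : ℕ → ℝ → ℝ) (s₁ m : ℝ) (a b : ℝ → ℝ)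
    (fbar fcheck : ℕ → ℝ → ℝ → ℝ) : Prop where
  isLayerFamily : IsLayerFamily N δ Θ s₁ m a b fbar fcheck
  c2_a : IsC2Family ℓ s₁ fun p => a p.2
  c2_b : IsC2Family ℓ s₁ fun p => b p.2
  c2_fcheck : ∀ j, 1 ≤ j → j ≤ N → IsC2Family ℓ s₁ fun p => fcheck j (p.1 ^ 2) p.2
  order_fcheck : ∀ j, 1 ≤ j → j ≤ N → IsOrderScale s₁ fun p => fcheck j (p.1 ^ 2) p.2

theorem IsC2Family.gap {N : ℕ} {ℓ s₁ : ℝ} {F : ℕ → ℝ × ℝ → ℝ}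
    (hF : ∀ j, 1 ≤ j → j ≤ N → IsC2Family ℓ s₁ (F j)) {j : ℕ} (hj : 1 ≤ j) (hjN : j ≤ N) :
    IsC2Family ℓ s₁ fun p => gap (fun i => F i p) j := by
  obtain ⟨k, rfl⟩ := Nat.exists_eq_add_of_le' hj
  rcases k with _ | k
  · simp only [zero_add, gap_one]
    exact (hF 1 le_rfl hjN).const_mul 2
  · simp only [gap_add_two]
    exact (hF (k + 2) (by omega) hjN).sub (hF (k + 1) (by omega) (by omega))

namespace IsSmoothLayerFamily

variable {ℓ : ℝ} {N : ℕ} {δ : ℝ} {Θ : ℕ → ℝ → ℝ} {s₁ m : ℝ} {a b : ℝ → ℝ}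
  {fbar fcheck : ℕ → ℝ → ℝ → ℝ}

/-- f̌ is of the order of the scale, but its angular derivative is merely bounded, so this factor is
not 1 plus a small family in the sense of `IsSmall`. Its C² regularity is recorded instead, since
that lets it enter the amplitude q. -/
theorem checkFactor_properties
    (h : IsSmoothLayerFamily ℓ N δ Θ s₁ m a b fbar fcheck) {j : ℕ} (hj : 1 ≤ j) :
    IsC2Family ℓ s₁ (checkFactor N b fcheck j) ∧ IsReg s₁ angleDist (checkFactor N b fcheck j) ∧
      IsOrderScale s₁ fun p => checkFactor N b fcheck j p - 1 := by
  unfold checkFactor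
  by_cases hjN : j ≤ N
  · simp only [hjN, if_true]
    have h1 := h.isLayerFamily
    have hs : IsOrderScale s₁ fun p =>
        -√2 * b p.2 * BoundaryLayers.gap (fun i => fcheck i (p.1 ^ 2) p.2) j :=
      (((IsOrderScale.gap h.order_fcheck hj hjN).mul_reg h1.reg_b).const_mul (-√2)).congr
        fun p _ _ => by ring
    exact ⟨((h.c2_b.const_mul (-√2)).mul (IsC2Family.gap h.c2_fcheck hj hjN)).exp,
      ((h1.reg_b.const_mul angleDist_nonneg (-√2)).mul (IsReg.gap h1.reg_fcheck hj hjN)).exp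
        angleDist_nonneg, hs.exp_sub_one h1.scale_le⟩
  · simp only [hjN, if_false, sub_self]
    exact ⟨IsC2Family.const 1, IsReg.const angleDist_nonneg 1, 0, le_rfl, fun p _ _ => by simp⟩

/-- By balance 12β²γ_{2,j}d_{j+1} = a(flux_j - 1), so the superdiagonal needs no separate unknown.
In the last row both sides vanish. -/
theorem layerMatrix_apply (h : IsLayerFamily N δ Θ s₁ m a b fbar fcheck) {p : ℝ × ℝ}
    (hp : 0 < p.1) (hps : p.1 < s₁) (i j : Fin N) :
    layerMatrix N Θ (b p.2) (p.1 ^ 2) (fun k => fbar k (p.1 ^ 2) p.2)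
      (fun k => fcheck k (p.1 ^ 2) p.2) i j =
        a p.2 * normalizedEntries N Θ a b fbar fcheck p i j := by
  have hN : 1 ≤ N := by have := i.2; omega
  have hi : 1 ≤ (i : ℕ) + 1 := by omega
  have hiN : (i : ℕ) + 1 ≤ N := i.2
  have ha := (h.a_pos p.2).ne'
  have hc : cEntry N Θ (b p.2) (p.1 ^ 2) (fun k => fbar k (p.1 ^ 2) p.2)
      (fun k => fcheck k (p.1 ^ 2) p.2) (i + 1) =
      a p.2 * (flux N Θ a b fbar fcheck (i + 1) p * checkFactor N b fcheck (i + 1) p) := by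
    rw [flux, checkFactor, if_pos hiN, cEntry, kCoef, gammaOneAt, dCoefAt]
    field_simp
  have hd : dEntry N Θ (b p.2) (p.1 ^ 2) (fun k => fbar k (p.1 ^ 2) p.2)
      (fun k => fcheck k (p.1 ^ 2) p.2) (i + 1) =
      a p.2 * ((flux N Θ a b fbar fcheck (i + 1) p - 1) *
        checkFactor N b fcheck (i + 1 + 1) p) := by
    rcases hiN.lt_or_eq with hlt | heq
    · rw [h.flux_sub_one hi hiN hp hps, checkFactor, if_pos (Nat.succ_le_of_lt hlt), dEntry, kCoef, gammaTwoAt,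
        dCoefAt]
      field_simp
    · rw [heq, h.flux_last hN hp hps, dEntry, kCoef, dCoef, if_neg (by omega)]
      ring
  have e : layerMatrix N Θ (b p.2) (p.1 ^ 2) (fun k => fbar k (p.1 ^ 2) p.2)
      (fun k => fcheck k (p.1 ^ 2) p.2) = triMatrix N
        (cEntry N Θ (b p.2) (p.1 ^ 2) (fun k => fbar k (p.1 ^ 2) p.2)
          (fun k => fcheck k (p.1 ^ 2) p.2))
        (dEntry N Θ (b p.2) (p.1 ^ 2) (fun k => fbar k (p.1 ^ 2) p.2)
          (fun k => fcheck k (p.1 ^ 2) p.2)) := rfl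
  rw [e, normalizedEntries, triMatrix_apply, triMatrix_apply, hc, hd]
  ring

theorem approxEntries_properties
    (h : IsSmoothLayerFamily ℓ N δ Θ s₁ m a b fbar fcheck) (i j : Fin N) :
    IsC2Family ℓ s₁ (fun p => approxEntries N b fcheck p i j) ∧
      IsReg s₁ angleDist (fun p => approxEntries N b fcheck p i j) ∧
      IsOrderScale s₁ fun p => approxEntries N b fcheck p i j - limitEntries N i j := by
  obtain ⟨c1, r1, o1⟩ := h.checkFactor_properties (j := i + 1) (by omega)
  obtain ⟨c2, r2, o2⟩ := h.checkFactor_properties (j := i + 1 + 1) (by omega)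
  have hd := angleDist_nonneg
  simp only [approxEntries, limitEntries, limitMatrix, triMatrix_apply]
  set α := subWeight N i j
  set β := superWeight N i j
  refine ⟨((c1.const_mul _).const_mul α).add ((c2.const_mul _).const_mul β),
    ((r1.const_mul hd _).const_mul hd α).add ((r2.const_mul hd _).const_mul hd β), ?_⟩
  refine (((o1.const_mul ((N : ℝ) - ((i + 1 : ℕ) : ℝ) + 1)).const_mul α).add
    ((o2.const_mul ((N : ℝ) - ((i + 1 : ℕ) : ℝ))).const_mul β)).congr fun p _ _ => ?_
  ring

/-- The two matrices differ only in the fluxes, by small families, multiplied by regular factors. -/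
theorem exists_normalizedEntries_properties
    (h : IsSmoothLayerFamily ℓ N δ Θ s₁ m a b fbar fcheck) (hN : 1 ≤ N) : ∃ s₂, 0 < s₂ ∧ s₂ ≤ s₁ ∧
    ∀ i j : Fin N, IsSmall s₂ angleDist fun p =>
      normalizedEntries N Θ a b fbar fcheck p i j - approxEntries N b fcheck p i j := by
  obtain ⟨s₂, hs₂, hs₂₁, hflux⟩ := h.isLayerFamily.exists_isSmall_flux_angleDist hN
  refine ⟨s₂, hs₂, hs₂₁, fun i j => ?_⟩
  have hs' : s₂ ≤ 1 := hs₂₁.trans h.isLayerFamily.scale_le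
  have hf := hflux (i + 1) (by omega) i.2
  have r1 := (h.checkFactor_properties (j := i + 1) (by omega)).2.1.mono hs₂₁
  have r2 := (h.checkFactor_properties (j := i + 1 + 1) (by omega)).2.1.mono hs₂₁
  have hd := angleDist_nonneg
  simp only [approxEntries, normalizedEntries, triMatrix_apply]
  set α := subWeight N i j
  set β := superWeight N i j
  refine ((hf.mul_reg (r1.const_mul hd α) hs' hd).add
    (hf.mul_reg (r2.const_mul hd β) hs' hd)).congr fun p _ _ => ?_
  push_cast
  ring

end IsSmoothLayerFamily

end BoundaryLayers

namespace BoundaryLayers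

/-! ### The families of scalar problems -/

theorem IsOrderScale.exists_abs_le {s₁ η : ℝ} {F : ℝ × ℝ → ℝ} (hF : IsOrderScale s₁ F)
    (hs₁ : 0 < s₁) (hη : 0 < η) :
    ∃ s₂, 0 < s₂ ∧ s₂ ≤ s₁ ∧ ∀ p : ℝ × ℝ, 0 < p.1 → p.1 < s₂ → |F p| ≤ η := by
  obtain ⟨C, hC, h⟩ := hF
  refine ⟨min s₁ (η / (C + 1)), by positivity, min_le_left _ _, fun p hp hps => ?_⟩
  have hp2 : p.1 < η / (C + 1) := hps.trans_le (min_le_right _ _)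
  rw [lt_div_iff₀ (by positivity)] at hp2
  have := h p hp (hps.trans_le (min_le_left _ _))
  linarith

namespace IsSmoothLayerFamily

variable {ℓ : ℝ} {N : ℕ} {δ : ℝ} {Θ : ℕ → ℝ → ℝ} {s₁ m : ℝ} {a b : ℝ → ℝ}
  {fbar fcheck : ℕ → ℝ → ℝ → ℝ}

/-- Up to a small family, the eigenvalues of the layer matrix are fourth powers of families of
class `C²`. -/
theorem exists_eigenvalue_decomposition
    (h : IsSmoothLayerFamily ℓ N δ Θ s₁ m a b fbar fcheck) (n : Fin N) :
    ∃ (s₂ m' : ℝ) (q r : ℝ × ℝ → ℝ), 0 < s₂ ∧ s₂ ≤ s₁ ∧ 0 < m' ∧ IsC2Family ℓ s₂ q ∧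
      IsReg s₂ angleDist q ∧ (∀ p : ℝ × ℝ, 0 < p.1 → p.1 < s₂ → m' ≤ q p) ∧
      IsSmall s₂ angleDist r ∧ ∀ p : ℝ × ℝ, 0 < p.1 → p.1 < s₂ →
        sortedEigenvalue (layerMatrix N Θ (b p.2) (p.1 ^ 2) (fun k => fbar k (p.1 ^ 2) p.2)
          (fun k => fcheck k (p.1 ^ 2) p.2)) n = q p ^ 4 + r p := by
  have hN : 1 ≤ N := by have := n.2; omega
  have hd := angleDist_nonneg
  have hL := h.isLayerFamily
  obtain ⟨τ, φ, L, C, R, hC, hR, hτ, hφ, hexp⟩ := exists_eigenvalue_expansion N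
  obtain ⟨s₂, hs₂, hs₂₁, hdiff⟩ := h.exists_normalizedEntries_properties hN
  have hs₂' : s₂ ≤ 1 := hs₂₁.trans hL.scale_le
  set X := normalizedEntries N Θ a b fbar fcheck with hX
  set Y := approxEntries N b fcheck with hY
  have hXreg : ∀ i j, IsReg s₂ angleDist fun p => X p i j := fun i j =>
    (((hdiff i j).isReg hs₂' hd).add ((h.approxEntries_properties i j).2.1.mono hs₂₁)).congr
      fun p _ _ => by ring
  have hXT : ∀ i j, IsOrderScale s₂ fun p => X p i j - limitEntries N i j := fun i j =>
    ((IsOrderScale.of_isSmall (hdiff i j)).add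
      ((h.approxEntries_properties i j).2.2.mono hs₂₁)).congr fun p _ _ => by ring
  obtain ⟨s₃, hs₃, hs₃₂, hnorm, hsmall⟩ :=
    exists_isSmall_expansion hs₂ hs₂' hC hR (hexp n) hXreg hXT
  -- The first order term is taken along the approximation `Y`, which is C² in the angle, and not
  -- along `X`, which is only Lipschitz.
  set D : ℝ × ℝ → ℝ := fun p => L n (Y p - limitEntries N) with hD
  have hDsum : ∀ p, D p = ∑ i, ∑ j, L n (Pi.single i (Pi.single j 1)) *
      (Y p i j - limitEntries N i j) := fun p => clm_apply_eq_sum (L n) _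
  have hDreg : IsReg s₁ angleDist D := by
    rw [funext hDsum]
    exact IsReg.sum _ hd fun i _ => IsReg.sum _ hd fun j _ =>
      ((h.approxEntries_properties i j).2.1.sub (IsReg.const hd _)).const_mul hd _
  have hDc2 : IsC2Family ℓ s₁ D := by
    rw [funext hDsum]
    exact IsC2Family.sum _ fun i _ => IsC2Family.sum _ fun j _ =>
      ((h.approxEntries_properties i j).1.sub (IsC2Family.const _)).const_mul _
  have hDord : IsOrderScale s₁ D := by
    obtain ⟨B, hB, hYT⟩ := exists_norm_le_of_isOrderScale fun i j =>
      (h.approxEntries_properties i j).2.2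
    refine ⟨‖L n‖ * B, by positivity, fun p hp hps => ?_⟩
    have := (L n).le_opNorm (Y p - limitEntries N)
    rw [Real.norm_eq_abs] at this
    refine this.trans ?_
    rw [mul_assoc]
    exact mul_le_mul_of_nonneg_left (hYT p hp hps) (norm_nonneg _)
  obtain ⟨s₄, hs₄, hs₄₁, hDle⟩ := hDord.exists_abs_le hL.scale_pos (half_pos (hτ n).1)
  set s₅ := min s₃ s₄ with hs₅
  have h53 : s₅ ≤ s₃ := min_le_left _ _
  have h54 : s₅ ≤ s₄ := min_le_right _ _
  have h51 : s₅ ≤ s₁ := h54.trans hs₄₁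
  have hs₅' : s₅ ≤ 1 := h51.trans hL.scale_le
  -- The C² part of the eigenvalue; its fourth root is the amplitude q. Restricting to scales with
  -- |D| ≤ τ/2 keeps it bounded below.
  set ρ : ℝ × ℝ → ℝ := fun p => a p.2 * (τ n + D p) with hρ
  have hρlow : ∀ p : ℝ × ℝ, 0 < p.1 → p.1 < s₅ → m * (τ n / 2) ≤ ρ p := fun p hp hps => by
    have h1 := (abs_le.1 (hDle p hp (hps.trans_le h54))).1
    have h2 := hL.lower_a p.2
    have h3 := hL.lower_pos
    have h4 := (hτ n).1
    exact mul_le_mul h2 (by linarith) (by positivity) (h3.le.trans h2)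
  have hlow0 : 0 < m * (τ n / 2) := mul_pos hL.lower_pos (half_pos (hτ n).1)
  have hρc2 : IsC2Family ℓ s₅ ρ := (h.c2_a.mul ((IsC2Family.const (τ n)).add hDc2)).mono h51
  have hρreg : IsReg s₅ angleDist ρ :=
    (hL.reg_a.mul ((IsReg.const hd (τ n)).add hDreg)).mono h51
  have hlow1 : ∀ p : ℝ × ℝ, 0 < p.1 → p.1 < s₅ → √(m * (τ n / 2)) ≤ √(ρ p) := fun p hp hps =>
    Real.sqrt_le_sqrt (hρlow p hp hps)
  have hpos1 : 0 < √(m * (τ n / 2)) := Real.sqrt_pos.2 hlow0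
  refine ⟨s₅, √√(m * (τ n / 2)), fun p => √√(ρ p), fun p => sortedEigenvalue (layerMatrix N Θ
    (b p.2) (p.1 ^ 2) (fun k => fbar k (p.1 ^ 2) p.2) (fun k => fcheck k (p.1 ^ 2) p.2)) n - ρ p,
    lt_min hs₃ hs₄, h51, Real.sqrt_pos.2 hpos1, (hρc2.sqrt hlow0 hρlow).sqrt hpos1 hlow1,
    (hρreg.sqrt hlow0 hρlow hd).sqrt hpos1 hlow1 hd,
    fun p hp hps => Real.sqrt_le_sqrt (hlow1 p hp hps), ?_, fun p hp hps => ?_⟩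
  · have hLsmall : IsSmall s₅ angleDist fun p => L n (X p - Y p) := by
      rw [funext fun p => clm_apply_eq_sum (L n) (X p - Y p)]
      refine IsSmall.sum _ fun i _ => IsSmall.sum _ fun j _ => ?_
      refine ((hdiff i j).mul_reg (IsReg.const hd (L n (Pi.single i (Pi.single j 1)))) hs₂'
        hd).mono (h53.trans hs₃₂) |>.congr fun p _ _ => ?_
      rw [Pi.sub_apply, Pi.sub_apply]
      ring
    -- The remainder is a times the linearization error along X plus L(X - Y), and both are small
    -- families.
    refine (((hsmall.mono h53).add hLsmall).mul_reg (hL.reg_a.mono h51) hs₅' hd).congr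
      fun p hp hps => ?_
    rw [hφ (X p) (hnorm p hp (hps.trans_le h53)) (a p.2) (hL.a_pos p.2) _
      (layerMatrix_apply hL hp (hps.trans_le h51)) n, (hτ n).2]
    simp only [hρ, hD, map_sub]
    ring
  · have h0 : 0 ≤ ρ p := hlow0.le.trans (hρlow p hp hps)
    have : √√(ρ p) ^ 4 = ρ p := by
      rw [show 4 = 2 * 2 from rfl, pow_mul, Real.sq_sqrt (Real.sqrt_nonneg _), Real.sq_sqrt h0]
    rw [this]
    ring

end IsSmoothLayerFamily

/-- At a fixed scale s the term |p.1 - q.1| vanishes, so smallness of r reads: size and Lipschitz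
constant at most Ds. Dividing by η = sκ gives a constant independent of s. -/
theorem exists_isWKBData_of_families {ℓ s₁ m κ : ℝ} {q r : ℝ × ℝ → ℝ} (hκ : 0 < κ)
    (hq : IsC2Family ℓ s₁ q) (hm : ∀ p : ℝ × ℝ, 0 < p.1 → p.1 < s₁ → m ≤ q p)
    (hr : IsSmall s₁ angleDist r) :
    ∃ A, ∀ s, 0 < s → s < s₁ → ∃ q₁ q₂, IsWKBData ℓ m A (s * κ) (fun θ => q (s, θ)) q₁ q₂
      fun θ => r (s, θ) := by
  obtain ⟨C, hC, hq⟩ := hq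
  obtain ⟨D, hD, hr⟩ := hr
  have hDκ : 0 ≤ D / κ := by positivity
  refine ⟨C + D / κ, fun s h0 h1 => ?_⟩
  obtain ⟨hp, q₁, q₂, d1, d2, hc, hb⟩ := hq s h0 h1
  have hend : q (s, ℓ) = q (s, 0) := by simpa using hp 0
  have hsκ : 0 < s * κ := by positivity
  refine ⟨q₁, q₂, d1, d2, hc, fun x => hm (s, x) h0 h1, fun x => ?_, fun x => ?_, fun x => ?_,
    ⟨fun x => ?_, fun x y => ?_⟩, hend, ?_⟩
  · linarith [(hb x).1]
  · linarith [(hb x).2.1]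
  · linarith [(hb x).2.2]
  · have := (hr (s, x) (s, x) (Near.refl h0 h1)).1
    rw [abs_div, abs_of_pos hsκ, div_le_iff₀ hsκ]
    have e : (C + D / κ) * (s * κ) = C * (s * κ) + D * s := by field_simp
    rw [e]
    have : 0 ≤ C * (s * κ) := by positivity
    simp only at *
    linarith
  · have := (hr (s, x) (s, y) ⟨h0, h1, h0, h1, by simp only; linarith, by simp only; linarith⟩).2
    simp only [sub_self, abs_zero, zero_add, angleDist] at this
    rw [← sub_div, abs_div, abs_of_pos hsκ, div_le_iff₀ hsκ]
    have e : (C + D / κ) * |x - y| * (s * κ) = C * |x - y| * (s * κ) + D * (s * |x - y|) := by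
      field_simp
    rw [e]
    have : 0 ≤ C * |x - y| * (s * κ) := by positivity
    linarith
  · have h2 : HasDerivAt (fun θ => q (s, θ)) (q₁ ℓ) 0 := by
      have h3 : HasDerivAt (fun θ => q (s, θ)) (q₁ (0 + ℓ)) (0 + ℓ) := d1 _
      have h4 := h3.comp_add_const 0 ℓ
      rw [zero_add] at h4
      have e : (fun x => q (s, x + ℓ)) = fun x => q (s, x) := funext hp
      rwa [e] at h4
    exact h2.unique (d1 0)

/-- Bounds for the total phase, multiplied by the scale. -/
theorem exists_phase_bounds {ℓ s₁ m κ : ℝ} {q r : ℝ × ℝ → ℝ} (hℓ : 0 < ℓ) (hκ : 0 < κ) (hm : 0 < m)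
    (hs₁ : 0 < s₁) (hs₁' : s₁ ≤ 1) (hq : IsReg s₁ angleDist q)
    (hmq : ∀ p : ℝ × ℝ, 0 < p.1 → p.1 < s₁ → m ≤ q p) (hr : IsSmall s₁ angleDist r) :
    ∃ (s₂ j₀ j₁ M : ℝ) (J : ℝ → ℝ), 0 < s₂ ∧ s₂ ≤ s₁ ∧ 0 < j₀ ∧ 0 ≤ M ∧
      (∀ s, 0 < s → s < s₂ → j₀ ≤ J s ∧ J s ≤ j₁ ∧
        phase (s * κ) (fun θ => q (s, θ)) (fun θ => r (s, θ)) ℓ = J s / s) ∧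
      ∀ s s', 0 < s → s < s₂ → 0 < s' → s' < s₂ → s ≤ 2 * s' → s' ≤ 2 * s →
        |J s - J s'| ≤ M * |s - s'| := by
  have hd := angleDist_nonneg
  have hq2 := hq.mul hq
  have hinv : IsReg s₁ angleDist fun p => (q p * q p)⁻¹ := hq2.inv (mul_pos hm hm) (fun p h0 h1 =>
    mul_self_le_mul_self hm.le (hmq p h0 h1)) hd
  have hcorr := hr.mul_reg (hinv.const_mul hd (1 / 2)) hs₁' hd
  obtain ⟨C, hC, hF⟩ := hq2.add (hcorr.isReg hs₁' hd)
  obtain ⟨s₂, hs₂, hs₂₁, hle⟩ := (IsOrderScale.of_isSmall hcorr).exists_abs_le hs₁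
    (half_pos (mul_pos hm hm))
  set F : ℝ × ℝ → ℝ := fun p => q p * q p + r p * (1 / 2 * (q p * q p)⁻¹) with hFdef
  have hfreq : ∀ s t, frequency (fun θ => q (s, θ)) (fun θ => r (s, θ)) t = F (s, t) := fun s t => by
    simp only [frequency, hFdef]
    rw [sq, div_eq_mul_inv, mul_inv]
    ring
  have hcont : ∀ s, 0 < s → s < s₁ → Continuous fun t => F (s, t) := fun s h0 h1 => by
    refine (LipschitzWith.of_dist_le_mul (K := C.toNNReal) fun x y => ?_).continuous
    have := (hF (s, x) (s, y)
      ⟨h0, h1, h0, h1, by simp only; linarith, by simp only; linarith⟩).2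
    simp only [sub_self, abs_zero, zero_add, angleDist] at this
    rw [Real.coe_toNNReal _ hC]
    exact this
  have hIntegrable : ∀ s, 0 < s → s < s₁ → IntervalIntegrable (fun t => F (s, t)) volume 0 ℓ :=
    fun s h0 h1 => (hcont s h0 h1).intervalIntegrable _ _
  -- J is the frequency integrated over the period and divided by κ. The lower bound m² of q² loses
  -- at most half to the correction on scales below s₂.
  refine ⟨s₂, κ⁻¹ * (ℓ * (m * m / 2)), κ⁻¹ * (ℓ * C), κ⁻¹ * (C * ℓ),
    fun s => κ⁻¹ * ∫ t in (0 : ℝ)..ℓ, F (s, t), hs₂, hs₂₁, by positivity, by positivity,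
    fun s h0 h1 => ⟨?_, ?_, ?_⟩, fun s s' h0 h1 h0' h1' hss hss' => ?_⟩
  · have h2 : ∫ _ in (0 : ℝ)..ℓ, m * m / 2 ≤ ∫ t in (0 : ℝ)..ℓ, F (s, t) := by
      refine intervalIntegral.integral_mono_on hℓ.le (by simp) (hIntegrable s h0 (h1.trans_le hs₂₁))
        fun t _ => ?_
      have h3 := (abs_le.1 (hle (s, t) h0 h1)).1
      have h4 := hmq (s, t) h0 (h1.trans_le hs₂₁)
      have h5 := mul_self_le_mul_self hm.le h4
      simp only [hFdef]
      linarith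
    rw [intervalIntegral.integral_const, sub_zero, smul_eq_mul] at h2
    exact mul_le_mul_of_nonneg_left h2 (inv_pos.2 hκ).le
  · have h2 : ∫ t in (0 : ℝ)..ℓ, F (s, t) ≤ ∫ _ in (0 : ℝ)..ℓ, C := by
      refine intervalIntegral.integral_mono_on hℓ.le (hIntegrable s h0 (h1.trans_le hs₂₁)) (by simp)
        fun t _ => ?_
      exact (le_abs_self _).trans (hF (s, t) (s, t) (Near.refl h0 (h1.trans_le hs₂₁))).1
    rw [intervalIntegral.integral_const, sub_zero, smul_eq_mul] at h2
    exact mul_le_mul_of_nonneg_left h2 (inv_pos.2 hκ).le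
  · simp only [phase, hfreq]
    rw [intervalIntegral.integral_div]
    field_simp
  · have hs := h1.trans_le hs₂₁
    have hs' := h1'.trans_le hs₂₁
    rw [← mul_sub, abs_mul, abs_of_pos (inv_pos.2 hκ), mul_assoc,
      ← intervalIntegral.integral_sub (hIntegrable s h0 hs) (hIntegrable s' h0' hs')]
    gcongr
    have h2 := intervalIntegral.norm_integral_le_of_norm_le_const (a := (0 : ℝ)) (b := ℓ)
      (f := fun t => F (s, t) - F (s', t)) (C := C * |s - s'|) fun t _ => by
        have := (hF (s, t) (s', t) ⟨h0, hs, h0', hs', hss, hss'⟩).2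
        simpa [angleDist] using this
    rw [sub_zero, abs_of_pos hℓ, Real.norm_eq_abs] at h2
    linarith

end BoundaryLayers

namespace BoundaryLayers

/-! ### The geometric coefficients -/

theorem exists_pos_le_of_periodic {f : ℝ → ℝ} {ℓ : ℝ} (hℓ : 0 < ℓ) (hf : Continuous f)
    (hp : Function.Periodic f ℓ) (hpos : ∀ x, 0 < f x) : ∃ m, 0 < m ∧ ∀ x, m ≤ f x := by
  obtain ⟨x₀, -, hx₀⟩ := (isCompact_Icc (a := (0 : ℝ)) (b := ℓ)).exists_isMinOn
    (nonempty_Icc.2 hℓ.le) hf.continuousOn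
  refine ⟨f x₀, hpos x₀, fun x => ?_⟩
  obtain ⟨y, hy, hxy⟩ := hp.exists_mem_Ico₀ hℓ x
  rw [hxy]
  exact hx₀ ⟨hy.1, hy.2.le⟩

section

variable {Ω : Set Plane} {ℓ : ℝ} {γ : ℝ → Plane} {V : Plane → ℝ}

theorem IsDomainWithBoundary.contDiff_deriv (hΩ : IsDomainWithBoundary Ω ℓ γ) :
    ContDiff ℝ ∞ (deriv γ) :=
  ((contDiff_infty_iff_deriv).1 hΩ.smooth).2

theorem IsDomainWithBoundary.contDiff_normal (hΩ : IsDomainWithBoundary Ω ℓ γ) :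
    ContDiff ℝ ∞ (normal γ) := by
  have h := contDiff_euclidean.1 hΩ.contDiff_deriv
  refine contDiff_euclidean.2 fun i => ?_
  fin_cases i
  · exact h 1
  · exact (h 0).neg

theorem IsDomainWithBoundary.contDiff_curvature (hΩ : IsDomainWithBoundary Ω ℓ γ) :
    ContDiff ℝ ∞ (curvature γ) :=
  ((contDiff_infty_iff_deriv).1 hΩ.contDiff_normal).2.inner ℝ hΩ.contDiff_deriv

theorem fermi_zero (γ : ℝ → Plane) (V : Plane → ℝ) (θ : ℝ) : fermi γ V 0 θ = V (γ θ) := by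
  simp [fermi]

theorem betaOne_eq (hV : ContDiff ℝ ∞ V) (γ : ℝ → Plane) (θ : ℝ) :
    betaOne γ V θ = fderiv ℝ V (γ θ) (-normal γ θ) := by
  have h1 : HasDerivAt (fun t : ℝ => γ θ - t • normal γ θ) (-normal γ θ) 0 := by
    simpa using ((hasDerivAt_id (0 : ℝ)).smul_const (normal γ θ)).const_sub (γ θ)
  have h2 : HasFDerivAt V (fderiv ℝ V (γ θ)) (γ θ - (0 : ℝ) • normal γ θ) := by
    rw [zero_smul, sub_zero]
    exact (hV.differentiable (by simp) _).hasFDerivAt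
  exact (h2.comp_hasDerivAt (0 : ℝ) h1).deriv

theorem IsDomainWithBoundary.contDiff_betaOne (hΩ : IsDomainWithBoundary Ω ℓ γ)
    (hV : ContDiff ℝ ∞ V) : ContDiff ℝ ∞ (betaOne γ V) := by
  rw [funext (betaOne_eq hV γ)]
  exact ((hV.fderiv_right (m := ∞) (by simp)).comp hΩ.smooth).clm_apply hΩ.contDiff_normal.neg

theorem IsDomainWithBoundary.potential_pos (hΩ : IsDomainWithBoundary Ω ℓ γ)
    (hVpos : ∀ y ∈ closure Ω, 0 < V y) (θ : ℝ) : 0 < V (γ θ) :=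
  hVpos _ (frontier_subset_closure (hΩ.range_eq ▸ mem_range_self θ))

theorem IsDomainWithBoundary.periodic_normal (hΩ : IsDomainWithBoundary Ω ℓ γ) :
    Function.Periodic (normal γ) ℓ := fun θ => by
  simp only [normal, periodic_deriv hΩ.periodic θ]

theorem IsDomainWithBoundary.contDiff_beta (hΩ : IsDomainWithBoundary Ω ℓ γ)
    (hV : ContDiff ℝ ∞ V) (hVpos : ∀ y ∈ closure Ω, 0 < V y) : ContDiff ℝ ∞ (beta γ V) := by
  have : beta γ V = fun θ => √(V (γ θ)) := funext fun θ => by rw [beta, fermi_zero]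
  rw [this]
  exact (hV.comp hΩ.smooth).sqrt fun θ => (hΩ.potential_pos hVpos θ).ne'

theorem IsDomainWithBoundary.periodic_beta (hΩ : IsDomainWithBoundary Ω ℓ γ) :
    Function.Periodic (beta γ V) ℓ := fun θ => by
  simp only [beta, fermi_zero, hΩ.periodic θ]

theorem IsDomainWithBoundary.contDiff_genMeanCurvature (hΩ : IsDomainWithBoundary Ω ℓ γ)
    (hV : ContDiff ℝ ∞ V) (hVpos : ∀ y ∈ closure Ω, 0 < V y) :
    ContDiff ℝ ∞ (genMeanCurvature γ V) := by
  have : genMeanCurvature γ V = fun θ => curvature γ θ - betaOne γ V θ / (2 * V (γ θ)) :=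
    funext fun θ => by rw [genMeanCurvature, fermi_zero]
  rw [this]
  refine hΩ.contDiff_curvature.sub ((hΩ.contDiff_betaOne hV).div
    (contDiff_const.mul (hV.comp hΩ.smooth)) fun θ => ?_)
  have := hΩ.potential_pos hVpos θ
  positivity

theorem IsDomainWithBoundary.periodic_genMeanCurvature (hΩ : IsDomainWithBoundary Ω ℓ γ) :
    Function.Periodic (genMeanCurvature γ V) ℓ := fun θ => by
  simp only [genMeanCurvature, curvature, betaOne, fermi, hΩ.periodic θ,
    periodic_deriv hΩ.periodic θ, periodic_deriv hΩ.periodic_normal θ, hΩ.periodic_normal θ]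

theorem IsSmallCorrection.isC2Family {N : ℕ} {ε₀ K s₁ : ℝ} {fcheck : ℕ → ℝ → ℝ → ℝ}
    (hcheck : IsSmallCorrection N ℓ ε₀ K fcheck) (hs₁ : s₁ ≤ 1)
    (hs₁ε : ∀ s, 0 < s → s < s₁ → s ^ 2 < ε₀) {j : ℕ} (hj : 1 ≤ j) (hjN : j ≤ N) :
    IsC2Family ℓ s₁ fun p => fcheck j (p.1 ^ 2) p.2 := by
  refine ⟨|K|, abs_nonneg K, fun s h0 h1 => ?_⟩
  have hε : 0 < s ^ 2 := by positivity
  have hε' := hs₁ε s h0 h1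
  have hf := hcheck.contDiff j (s ^ 2) hj hjN hε hε'
  have hf1 : ContDiff ℝ 1 (deriv (fcheck j (s ^ 2))) :=
    ((contDiff_succ_iff_deriv (n := 1)).1 (by rw [one_add_one_eq_two]; exact hf)).2.2
  refine ⟨hcheck.periodic j (s ^ 2) hj hjN hε hε', deriv (fcheck j (s ^ 2)),
    deriv (deriv (fcheck j (s ^ 2))), fun x => ((hf.differentiable two_ne_zero) x).hasDerivAt,
    fun x => ((hf1.differentiable one_ne_zero) x).hasDerivAt, hf1.continuous_deriv le_rfl,
    fun x => ⟨?_, (hcheck.bound_deriv j _ x hj hjN hε hε').trans (le_abs_self K),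
      (hcheck.bound_deriv_two j _ x hj hjN hε hε').trans (le_abs_self K)⟩⟩
  have h2 := hcheck.bound j (s ^ 2) x hj hjN hε hε'
  rw [Real.sqrt_sq h0.le] at h2
  refine h2.trans ((mul_le_mul_of_nonneg_right (le_abs_self K) h0.le).trans ?_)
  exact mul_le_of_le_one_right (abs_nonneg K) (by linarith)

/-- The geometric data form a smooth layer family, with `a = (4/3) (k - V_t / (2 V))`. -/
theorem exists_isSmoothLayerFamily (hΩ : IsDomainWithBoundary Ω ℓ γ) (hV : ContDiff ℝ ∞ V)
    (hVpos : ∀ y ∈ closure Ω, 0 < V y) (hH : ∀ θ, 0 < genMeanCurvature γ V θ) {N : ℕ} {δ : ℝ}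
    {Θ : ℕ → ℝ → ℝ} (hΘ : IsTransition N δ Θ) {ε₀ K : ℝ} (hε₀ : 0 < ε₀)
    {fbar fcheck : ℕ → ℝ → ℝ → ℝ} (hcheck : IsSmallCorrection N ℓ ε₀ K fcheck)
    (hbar : IsBalanced N γ V Θ ε₀ K fbar fcheck) :
    ∃ m, IsSmoothLayerFamily ℓ N δ Θ (min 1 √ε₀) m (fun θ => 4 / 3 * genMeanCurvature γ V θ)
      (beta γ V) fbar fcheck := by
  have hℓ := hΩ.length_pos
  have hs₁ε : ∀ s, 0 < s → s < min 1 √ε₀ → s ^ 2 < ε₀ := fun s h0 h1 =>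
    (Real.lt_sqrt h0.le).1 (h1.trans_le (min_le_right _ _))
  have hbpos : ∀ θ, 0 < beta γ V θ := fun θ => by
    rw [beta, fermi_zero]
    exact Real.sqrt_pos.2 (hΩ.potential_pos hVpos θ)
  have hbc := hΩ.contDiff_beta hV hVpos
  have hac : ContDiff ℝ ∞ fun θ => 4 / 3 * genMeanCurvature γ V θ :=
    contDiff_const.mul (hΩ.contDiff_genMeanCurvature hV hVpos)
  have hap : Function.Periodic (fun θ => 4 / 3 * genMeanCurvature γ V θ) ℓ := fun θ => by
    simp only [hΩ.periodic_genMeanCurvature (V := V) θ]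
  have h2 : (2 : WithTop ℕ∞) ≤ ∞ := by norm_cast
  obtain ⟨m₁, hm₁, hb⟩ := exists_pos_le_of_periodic hℓ hbc.continuous hΩ.periodic_beta hbpos
  obtain ⟨m₂, hm₂, ha⟩ := exists_pos_le_of_periodic hℓ hac.continuous hap fun θ => by
    have := hH θ
    positivity
  have hc2a : IsC2Family ℓ (min 1 √ε₀) fun p => 4 / 3 * genMeanCurvature γ V p.2 :=
    IsC2Family.of_contDiff (f := fun θ => 4 / 3 * genMeanCurvature γ V θ) hℓ (hac.of_le h2) hap
  have hc2b : IsC2Family ℓ (min 1 √ε₀) fun p => beta γ V p.2 :=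
    IsC2Family.of_contDiff hℓ (hbc.of_le h2) hΩ.periodic_beta
  have hc2f := fun j (hj : 1 ≤ j) (hjN : j ≤ N) =>
    hcheck.isC2Family (min_le_left 1 √ε₀) hs₁ε hj hjN
  refine ⟨min m₁ m₂, ⟨hΘ, lt_min one_pos (Real.sqrt_pos.2 hε₀), min_le_left _ _, lt_min hm₁ hm₂,
    fun θ => (min_le_right _ _).trans (ha θ), fun θ => (min_le_left _ _).trans (hb θ),
    hc2a.isReg le_rfl (by simp), hc2b.isReg le_rfl (by simp), ⟨K, fun j p hj hjN h0 h1 =>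
      hbar.bound j _ _ hj hjN (by positivity) (hs₁ε _ h0 h1)⟩, fun j hj hjN => ?_,
    fun j p hj hjN h0 h1 => ?_⟩, hc2a, hc2b, hc2f, fun j hj hjN => ?_⟩
  · refine (hc2f j hj hjN).isReg (abs_nonneg K) fun s s' θ h0 h1 h0' h1' => ?_
    have := hcheck.lipschitz j (s ^ 2) (s' ^ 2) θ hj hjN (by positivity) (hs₁ε s h0 h1)
      (by positivity) (hs₁ε s' h0' h1')
    rw [Real.sqrt_sq h0.le, Real.sqrt_sq h0'.le] at this
    exact this.trans (mul_le_mul_of_nonneg_right (le_abs_self K) (abs_nonneg _))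
  -- Multiplying the balance equation by √2 turns 6√2 β² into 12β² and its left side into (4/3)(k -
  -- β₁/(2β²)), with β² = V on the boundary.
  · have h3 := hbar.balance j (p.1 ^ 2) p.2 hj hjN (by positivity) (hs₁ε _ h0 h1)
    have h4 : beta γ V p.2 ^ 2 = fermi γ V 0 p.2 := by
      rw [beta, Real.sq_sqrt]
      rw [fermi_zero]
      exact (hΩ.potential_pos hVpos _).le
    have h5 : √2 * √2 = 2 := Real.mul_self_sqrt zero_le_two
    have h6 : betaOne γ V p.2 / (2 * fermi γ V 0 p.2) =
        betaOne γ V p.2 / beta γ V p.2 ^ 2 / 2 := by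
      rw [h4, mul_comm, div_div]
    rw [genMeanCurvature, h6]
    generalize betaOne γ V p.2 / beta γ V p.2 ^ 2 = x at h3 ⊢
    generalize gammaOne N Θ (beta γ V p.2) _ j * dCoef N (beta γ V p.2) _ j -
      gammaTwo N Θ (beta γ V p.2) _ j * dCoef N (beta γ V p.2) _ (j + 1) = y at h3 ⊢
    linear_combination (-√2) * h3 + (2 / 3 * curvature γ p.2 - x / 3 -
      6 * beta γ V p.2 ^ 2 * y) * h5
  · refine ⟨|K|, abs_nonneg K, fun p h0 h1 => ?_⟩
    have h2 := hcheck.bound j (p.1 ^ 2) p.2 hj hjN (by positivity) (hs₁ε _ h0 h1)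
    rw [Real.sqrt_sq h0.le] at h2
    exact h2.trans (mul_le_mul_of_nonneg_right (le_abs_self K) h0.le)

end

end BoundaryLayers

namespace BoundaryLayers

/-! ### Uniform constants for finitely many problems -/

theorem exists_common_scale {ι : Type*} [Finite ι] {P : ι → ℝ → Prop}
    (hmono : ∀ i s s', 0 < s' → s' ≤ s → P i s → P i s') (h : ∀ i, ∃ s, 0 < s ∧ P i s) :
    ∃ s, 0 < s ∧ ∀ i, P i s := by
  have hev : ∀ i, ∀ᶠ s in 𝓝[>] (0 : ℝ), P i s := fun i => by
    obtain ⟨s, hs, hP⟩ := h i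
    filter_upwards [Ioc_mem_nhdsGT hs] with s' hs' using hmono i s s' hs'.1 hs'.2 hP
  obtain ⟨s, hs, h0⟩ := ((eventually_all.2 hev).and self_mem_nhdsWithin).exists
  exact ⟨s, h0, hs⟩

theorem exists_common_bound {ι : Type*} [Finite ι] (f : ι → ℝ) : ∃ A, 0 < A ∧ ∀ i, f i ≤ A := by
  obtain ⟨B, hB⟩ := (Set.finite_range f).bddAbove
  exact ⟨max B 1, by positivity, fun i => (hB (mem_range_self i)).trans (le_max_left _ _)⟩

/-- For arbitrarily small scales, all the scalar problems of a layer family are uniquely solvable,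
with uniform estimates. -/
theorem IsSmoothLayerFamily.exists_scalar_estimates {ℓ : ℝ} {N : ℕ} {δ : ℝ} {Θ : ℕ → ℝ → ℝ}
    {s₁ m : ℝ} {a b : ℝ → ℝ} {fbar fcheck : ℕ → ℝ → ℝ → ℝ}
    (h : IsSmoothLayerFamily ℓ N δ Θ s₁ m a b fbar fcheck) (hℓ : 0 < ℓ) :
    ∃ C, 0 < C ∧ ∀ s₂ > 0, ∃ s, 0 < s ∧ s < s₂ ∧ s < s₁ ∧ ∀ (n : Fin N) (f : ℝ → ℝ),
      MemLp f 2 (intervalMeasure ℓ) →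
      ∀ ρ : ℝ → ℝ, (∀ θ, ρ θ = sortedEigenvalue (layerMatrix N Θ (b θ) (s ^ 2)
        (fun k => fbar k (s ^ 2) θ) (fun k => fcheck k (s ^ 2) θ)) n) →
      (∃ v v₁ v₂, IsPeriodicSolution ℓ (s ^ 2) ρ f v v₁ v₂) ∧
      (∀ v v₁ v₂ w w₁ w₂, IsPeriodicSolution ℓ (s ^ 2) ρ f v v₁ v₂ →
        IsPeriodicSolution ℓ (s ^ 2) ρ f w w₁ w₂ → EqOn v w (Icc 0 ℓ)) ∧
      ∀ v v₁ v₂, IsPeriodicSolution ℓ (s ^ 2) ρ f v v₁ v₂ →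
        s ^ 2 * normL2 ℓ v₂ + s * normL2 ℓ v₁ + normLinf ℓ v ≤ C * (1 / s) * normL2 ℓ f ∧
        ∀ f₁ f₂, IsPeriodicH2 ℓ f f₁ f₂ →
          s ^ 2 * normL2 ℓ v₂ + normL2 ℓ v₁ + normLinf ℓ v ≤ C * normH2 ℓ f f₁ f₂ := by
  have hκ := gammaZero_pos
  have hκ' : 0 < √gammaZero := Real.sqrt_pos.2 hκ
  choose σ m' q r hσ hσ₁ hm' hqc2 hq hmq hr hρ using fun n => h.exists_eigenvalue_decomposition n
  have hσ1 : ∀ n, σ n ≤ 1 := fun n => (hσ₁ n).trans h.isLayerFamily.scale_le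
  choose A hA using fun n => exists_isWKBData_of_families hκ' (hqc2 n) (hmq n) (hr n)
  choose σ' j₀ j₁ M J hσ' hσ'σ hj₀ hM hJ hJlip using fun n =>
    exists_phase_bounds hℓ hκ' (hm' n) (hσ n) (hσ1 n) (hq n) (hmq n) (hr n)
  obtain ⟨s₀, hs₀, hs₀σ⟩ := exists_common_scale (P := fun n s => s ≤ σ' n)
    (fun n s s' _ hs hP => hs.trans hP) fun n => ⟨σ' n, hσ' n, le_rfl⟩
  obtain ⟨j, hj, hjle⟩ := exists_common_scale (P := fun n s => s ≤ j₀ n)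
    (fun n s s' _ hs hP => hs.trans hP) fun n => ⟨j₀ n, hj₀ n, le_rfl⟩
  obtain ⟨j', -, hj'⟩ := exists_common_bound j₁
  obtain ⟨M', hM'0, hM'⟩ := exists_common_bound M
  -- The order of choices matters: the distance c from resonance depends only on the bounds for the
  -- J_n, the constants and thresholds of the scalar estimates depend on c, and the scale is
  -- selected last, below all thresholds.
  obtain ⟨c, hc, hres⟩ := exists_nonresonant (J := J) (j₁ := j') hj hM'0.le hs₀
    (fun n s h0 h1 => (hjle n).trans (hJ n s h0 (h1.trans_le (hs₀σ n))).1)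
    (fun n s h0 h1 => (hJ n s h0 (h1.trans_le (hs₀σ n))).2.1.trans (hj' n))
    fun n s s' h0 h1 h0' h1' hss hss' => (hJlip n s s' h0 (h1.trans_le (hs₀σ n)) h0'
      (h1'.trans_le (hs₀σ n)) hss hss').trans (mul_le_mul_of_nonneg_right (hM' n) (abs_nonneg _))
  choose C t hC ht hest using fun n => exists_scalar_estimate (A := A n) hℓ (hm' n) hc hκ
  obtain ⟨t₀, ht₀, ht₀t⟩ := exists_common_scale (P := fun n s => s ≤ t n)
    (fun n s s' _ hs hP => hs.trans hP) fun n => ⟨t n, ht n, le_rfl⟩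
  obtain ⟨C', hC', hCle⟩ := exists_common_bound C
  refine ⟨C', hC', fun s₂ hs₂ => ?_⟩
  obtain ⟨s, hs, hlt, hcs⟩ := hres (min (min s₂ s₁) (min s₀ t₀))
    (lt_min (lt_min hs₂ h.isLayerFamily.scale_pos) (lt_min hs₀ ht₀))
  have hlt2 : s < s₂ := hlt.trans_le ((min_le_left _ _).trans (min_le_left _ _))
  have hlt1 : s < s₁ := hlt.trans_le ((min_le_left _ _).trans (min_le_right _ _))
  have hlt0 : s < s₀ := hlt.trans_le ((min_le_right _ _).trans (min_le_left _ _))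
  have hltt : s < t₀ := hlt.trans_le ((min_le_right _ _).trans (min_le_right _ _))
  refine ⟨s, hs, hlt2, hlt1, fun n f hf ρ hρeq => ?_⟩
  have hlt' : s < σ' n := hlt0.trans_le (hs₀σ n)
  have hltσ : s < σ n := hlt'.trans_le (hσ'σ n)
  obtain ⟨q₁, q₂, hdata⟩ := hA n s hs hltσ
  have hphase := (hJ n s hs hlt').2.2
  obtain ⟨hex, huniq, hbound⟩ := hest n s _ q₁ q₂ _ ρ hs (hltt.trans_le (ht₀t n)) hdata
    (fun θ => by rw [hρeq θ]; exact hρ n (s, θ) hs hltσ) (by rw [hphase]; exact hcs n) f hf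
  refine ⟨hex, huniq, fun v v₁ v₂ hv => ⟨(hbound v v₁ v₂ hv).1.trans ?_, fun f₁ f₂ hf₂ =>
    ((hbound v v₁ v₂ hv).2 f₁ f₂ hf₂).trans ?_⟩⟩
  · have h1 : 0 ≤ normL2 ℓ f := ENNReal.toReal_nonneg
    gcongr
    exact hCle n
  · exact mul_le_mul_of_nonneg_right (hCle n) (Real.sqrt_nonneg _)

end BoundaryLayers

/-! ### The sequence of scales and the conclusion -/

theorem mainTheorem4
    (Ω : Set Plane) (ℓ : ℝ) (γ : ℝ → Plane) (hΩ : IsDomainWithBoundary Ω ℓ γ)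
    (V : Plane → ℝ) (hV : ContDiff ℝ ∞ V) (hVpos : ∀ y ∈ closure Ω, 0 < V y)
    (hH : ∀ θ, 0 < genMeanCurvature γ V θ)
    (N : ℕ) (hN : 1 ≤ N)
    (δ : ℝ) (Θ : ℕ → ℝ → ℝ) (hΘ : IsTransition N δ Θ)
    (ε₀ : ℝ) (hε₀ : 0 < ε₀) (K : ℝ) (fbar fcheck : ℕ → ℝ → ℝ → ℝ)
    (hcheck : IsSmallCorrection N ℓ ε₀ K fcheck)
    (hbar : IsBalanced N γ V Θ ε₀ K fbar fcheck) :
    ∃ (e : ℕ → ℝ) (C : ℝ), (∀ l, 0 < e l ∧ e l < ε₀) ∧ Tendsto e atTop (𝓝 0) ∧ 0 < C ∧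
      ∀ (l : ℕ) (h : Fin N → ℝ → ℝ), (∀ n, MemLp (h n) 2 (intervalMeasure ℓ)) →
        (∃ v v₁ v₂ : Fin N → ℝ → ℝ, ∀ n, IsPeriodicSolution ℓ (e l)
          (rho N γ V Θ fbar fcheck (e l) n) (h n) (v n) (v₁ n) (v₂ n)) ∧
        (∀ v v₁ v₂ w w₁ w₂ : Fin N → ℝ → ℝ,
          (∀ n, IsPeriodicSolution ℓ (e l)
            (rho N γ V Θ fbar fcheck (e l) n) (h n) (v n) (v₁ n) (v₂ n)) →
          (∀ n, IsPeriodicSolution ℓ (e l)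
            (rho N γ V Θ fbar fcheck (e l) n) (h n) (w n) (w₁ n) (w₂ n)) →
          ∀ n, EqOn (v n) (w n) (Icc 0 ℓ)) ∧
        (∀ v v₁ v₂ : Fin N → ℝ → ℝ,
          (∀ n, IsPeriodicSolution ℓ (e l)
            (rho N γ V Θ fbar fcheck (e l) n) (h n) (v n) (v₁ n) (v₂ n)) →
          ∀ n,
            e l * normL2 ℓ (v₂ n) + √(e l) * normL2 ℓ (v₁ n) + normLinf ℓ (v n)
              ≤ C * √(1 / e l) * normL2 ℓ (h n) ∧
            ∀ h₁ h₂ : ℝ → ℝ, IsPeriodicH2 ℓ (h n) h₁ h₂ →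
              e l * normL2 ℓ (v₂ n) + normL2 ℓ (v₁ n) + normLinf ℓ (v n)
                ≤ C * normH2 ℓ (h n) h₁ h₂) := by
  obtain ⟨m, hfam⟩ := exists_isSmoothLayerFamily hΩ hV hVpos hH hΘ hε₀ hcheck hbar
  obtain ⟨C, hC, hsol⟩ := hfam.exists_scalar_estimates hΩ.length_pos
  -- One admissible scale below 1/(l + 1) for every l; the sequence is ε_l = s_l², so that √ε_l =
  -- s_l and √(1/ε_l) = 1/s_l.
  choose s hs hsl hs₁ hest using fun l : ℕ => hsol (1 / ((l : ℝ) + 1)) (by positivity)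
  have hsqrt : ∀ l, √(s l ^ 2) = s l := fun l => Real.sqrt_sq (hs l).le
  have hsqrt' : ∀ l, √(1 / s l ^ 2) = 1 / s l := fun l => by
    rw [Real.sqrt_div zero_le_one, Real.sqrt_one, hsqrt]
  refine ⟨fun l => s l ^ 2, C, fun l => ⟨pow_pos (hs l) 2,
    (Real.lt_sqrt (hs l).le).1 ((hs₁ l).trans_le (min_le_right _ _))⟩, ?_, hC,
    fun l h hh => ⟨?_, ?_, ?_⟩⟩
  · have h0 : Tendsto s atTop (𝓝 0) := squeeze_zero (fun l => (hs l).le) (fun l => (hsl l).le)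
      tendsto_one_div_add_atTop_nhds_zero_nat
    simpa using h0.pow 2
  · choose v v₁ v₂ hv using fun n => (hest l n (h n) (hh n) _ fun _ => rfl).1
    exact ⟨v, v₁, v₂, hv⟩
  · intro v v₁ v₂ w w₁ w₂ hv hw n
    exact (hest l n (h n) (hh n) _ fun _ => rfl).2.1 _ _ _ _ _ _ (hv n) (hw n)
  · intro v v₁ v₂ hv n
    simp only [hsqrt, hsqrt']
    exact (hest l n (h n) (hh n) _ fun _ => rfl).2.2 _ _ _ (hv n)
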